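/- **Process number.** A process strategy for a finite graph $G$ is a sequence of the following actions: (1) put an agent on an unoccupied node that is not yet processed; (2) remove the agent from a node all of whose neighbours are processed or occupied, the node is then processed; (3) process an unoccupied node all of whose neighbours are occupied. It starts with no agent and no processed node and ends when all nodes are processed; it is a $p$-process strategy if at most $p$ nodes are occupied at any time. $\mathrm{pn}(G)$ is the least $p$ for which a $p$-process strategy exists, and $\mathrm{pn}^+(G)$, for a root $r$ of $G$, is the least $p$ for which there is one in which $r$ is the last node to have an agent (no condition if no agent is used at all). A rooted tree is *stable* if $\mathrm{pn}^+=\mathrm{pn}$ or $\mathrm{pn}^+\le 2$, and *unstable* otherwise. **Hierarchical decompositions.** Let $T$ be a rooted tree. $T_v$ is the component containing $v$ of $T$ minus the edge from $v$ to its father ($T_v=T$ for the root). A hierarchical decomposition of $T_v$ is a partition of $T_v$ into subtrees $aT^w$ ($w\in R_v$), the associated-trees, with $w\in aT^w\subseteq T_w$, such that: $\mathrm{pn}(aT^w)>\mathrm{pn}(aT^x)$ whenever $aT^x$ contains the father of $w$; at most one $aT^w$ (rooted at $w$) is stable and, if there is one, no $aT^x$ contains the father of its root; each unstable $aT^w$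 consists of $w$, of the stable associated-trees $aT^{w_1},aT^{w_2}$ of two children $w_1\ne w_2$ of $w$ with $\mathrm{pn}(aT^{w_1})=\mathrm{pn}(aT^{w_2})=\mathrm{pn}(aT^w)$, and of subtrees rooted at other children of $w$ of process number less than $\mathrm{pn}(aT^w)$. It is described by the pair $(vect,t)$, where $vect=(\mathrm{pn},\mathrm{pn}^+)$ of the stable associated-tree if there is one and $(-1,-1)$ otherwise, and $t$ is the table of length $L(t)=\max_{w\in R_v}\mathrm{pn}(aT^w)$ whose cell $t[i]$ is the number of unstable associated-trees with $(\mathrm{pn},\mathrm{pn}^+)=(i,i+1)$. It is *minimal* if for no $i\le L(t)$ the union of the associated-trees of process number at most $i$ has process number $i+1$. **Algorithm 1 (local merge at $v$).** Cells of a table outside $[1..L(t)]$ count as $0$. Input: from the pairs $(vect(v_i),t_{v_i})$ of the visited neighbours $v_i$ of $v$, the list $N_v$ of the vectors $\ne(-1,-1)$, the list $M_v$ of the vectors of maximum first entry $\mu$ (with multiplicity; $\mu:=-1$ if there is no visited neighbour), and the cellwise sum $t$ of the tables. 1. Let $(p,p^+):=(0,0)$ if $\mu=-1$; $(1,1)$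 if $\mu=0$; $(1,2)$ if $\mu=1$ and $N_v$ consists of a single vector, which is $(1,1)$; $(2,2)$ if $\mu=1$ otherwise; and, if $\mu\ge2$, $(\mu,\mu)$, $(\mu,\mu+1)$, $(\mu+1,\mu+1)$ according as $|M_v|=1$, $|M_v|=2$, $|M_v|>2$. 2. Extend $t$ by cells $0$ to length at least $p$. If $1<p<p^+$, increase $t[p]$ by $1$, empty the cells below $p$, and set $(p,p^+):=(-1,-1)$. 3. Let $k$ be the largest index with $t[k]>1$, if any; if $k$ exists, let $k_1$ be the least index $>k$ with $t[k_1]=0$. Let $k_2$ be the least index $\ge\max(p,0)$ with $t[k_2]=0$. If $k$ exists, set $m:=\max(k_1,k_2)$; if $k$ does not exist and $p\ge2$, set $m:=k_2$. In these two cases empty the cells $t[1..m]$ (extending $t$ to length $m$ if necessary) and return $((m,m),t)$. Otherwise return $((p,p^+),t)$. **Algorithm algoHD** on a tree $T$ with $n$ nodes. Initially no node is visited. At each step one unvisited node $v$ acts, chosen arbitrarily (asynchronous environment) among the possible ones: if $v$ has received messages from all its neighbours but one (e.g. $v$ is a leaf), it computes a pair $(vect(v),t_v)$ by Algorithm 1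 and sends it to this last neighbour, its father; if $v$ has received messages from all its neighbours, it becomes the root, computes $(vect(v),t_v)$ in the same way and outputs $L(t_v)$ if $t_v$ has a cell $0$ (possibly the virtual cell of index $0$) followed only by cells $1$ up to cell $L(t_v)$, and $\max\{a,L(t_v)+1\}$ otherwise, $a$ being the first entry of $vect(v)$. A node is visited once it has acted. Operations counted: arithmetic operations and comparisons on integers, elementary list operations, reading, writing or adding one cell of a table, and, for each acting node, one operation per neighbour. **Lemma.** For every tree $T$ with $n$ nodes and every execution of algoHD on $T$: the execution stops after exactly $n$ steps (it is never blocked before); then exactly one node is the root, and its output is $\mathrm{pn}(T)$. Moreover there are subtrees $aT^w$ and sets $R_v$ of nodes of $T$ such that, for every node $v$, $(aT^w)_{w\in R_v}$ is a minimal hierarchical decomposition of $T_v$ that is described by the pair $(vect(v),t_v)$ computed by Algorithm 1 at $v$. Finally, there is an absolute constant $C$ such that, if $n\ge2$, each execution of Algorithm 1 uses at most $C\log n$ operations, and the whole execution of algoHD uses at most $C\,n\log n$ operations. -/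

import Mathlib

namespace ProcNum

/-! ### Process strategies and the process number -/

/-- The three actions of a process strategy. -/
inductive Action (V : Type*) where
  /-- put an agent on a node -/
  | place (v : V)
  /-- remove the agent from a node, which is then processed -/
  | remove (v : V)
  /-- process a surrounded node without putting an agent on it -/
  | surround (v : V)

/-- The node from which an action removes an agent, if any. -/
def Action.vacated {V : Type*} : Action V → Option V
  | .remove v => some v
  | _ => none

/-- The state of a process strategy: the nodes occupied by an agent and the processed nodes. -/
structure PState (V : Type*) where
  occ : Set V
  processed : Set V

/-- The legal actions when the subgraph of `G` induced by `S` is being processed. An agent is put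
only on a node that still has to be processed. -/
inductive PStep {V : Type*} (G : SimpleGraph V) (S : Set V) :
    PState V → Action V → PState V → Prop
  | place (s : PState V) (v : V) (hS : v ∈ S) (ho : v ∉ s.occ) (hp : v ∉ s.processed) :
      PStep G S s (.place v) ⟨insert v s.occ, s.processed⟩
  | remove (s : PState V) (v : V) (ho : v ∈ s.occ)
      (hn : ∀ u ∈ S, G.Adj v u → u ∈ s.processed ∨ u ∈ s.occ) :
      PStep G S s (.remove v) ⟨s.occ \ {v}, insert v s.processed⟩
  | surround (s : PState V) (v : V) (hS : v ∈ S) (ho : v ∉ s.occ) (hp : v ∉ s.processed)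
      (hn : ∀ u ∈ S, G.Adj v u → u ∈ s.occ) :
      PStep G S s (.surround v) ⟨s.occ, insert v s.processed⟩

/-- Sequences of legal actions along which at most `p` nodes are occupied at any time. -/
inductive PRun {V : Type*} (G : SimpleGraph V) (S : Set V) (p : ℕ) :
    PState V → List (Action V) → PState V → Prop
  | nil (s : PState V) : PRun G S p s [] s
  | cons (s s' s'' : PState V) (a : Action V) (l : List (Action V))
      (ha : PStep G S s a s') (hp : s'.occ.encard ≤ p) (hl : PRun G S p s' l s'') :
      PRun G S p s (a :: l) s''

/-- `l` is a `p`-process strategy for the subgraph of `G` induced by `S`: starting with no agent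
and no processed node, it ends with all nodes of `S` processed. -/
def IsStrategy {V : Type*} (G : SimpleGraph V) (S : Set V) (p : ℕ) (l : List (Action V)) : Prop :=
  PRun G S p ⟨∅, ∅⟩ l ⟨∅, S⟩

/-- The last node to have an agent is `r`: the last removal of an agent takes place at `r`
(no condition for a strategy that uses no agent at all). -/
def FinishesAt {V : Type*} (l : List (Action V)) (r : V) : Prop :=
  ∀ v ∈ (l.filterMap Action.vacated).getLast?, v = r

/-- The process number of the subgraph of `G` induced by `S`. -/
noncomputable def pn {V : Type*} (G : SimpleGraph V) (S : Set V) : ℕ :=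
  sInf {p | ∃ l, IsStrategy G S p l}

/-- `pn⁺`: the least number of agents of a process strategy for the subgraph of `G` induced
by `S` in which the last node to have an agent is `r`. -/
noncomputable def pnPlus {V : Type*} (G : SimpleGraph V) (S : Set V) (r : V) : ℕ :=
  sInf {p | ∃ l, IsStrategy G S p l ∧ FinishesAt l r}

/-- The tree `G[S]` with root `r` is stable: an optimal strategy, or a strategy with at most
two agents, finishes at `r`. -/
def Stable {V : Type*} (G : SimpleGraph V) (S : Set V) (r : V) : Prop :=
  (∃ l, IsStrategy G S (pn G S) l ∧ FinishesAt l r) ∨ (∃ l, IsStrategy G S 2 l ∧ FinishesAt l r)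

/-! ### Hierarchical decompositions

`father v = none` means that `v` is the root. `aT w` is the associated-tree with root `w`, and
`R` is the set of the roots of the associated-trees of the decomposition at hand. -/

/-- `T_v`: the connected component containing `v` of `G` minus the edge from `v` to its father. -/
def subtree {V : Type*} (G : SimpleGraph V) (father : V → Option V) (v : V) : Set V :=
  {u | (G.deleteEdges {e | ∃ w ∈ father v, e = s(v, w)}).Reachable v u}

/-- `aT^x < aT^w`: the associated-tree with root `x` contains the father of `w`. -/
def AssocLT {V : Type*} (father : V → Option V) (aT : V → Set V) (x w : V) : Prop :=
  ∃ f ∈ father w, f ∈ aT x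

/-- The structure required of an unstable associated-tree `aT^w`: it consists of `w`, of the stable
associated-trees of two children of `w` with the same process number as `aT^w`, and of subtrees
`B x`, rooted at other children `x ∈ O` of `w`, of smaller process number. -/
def UnstableShape {V : Type*} (G : SimpleGraph V) (father : V → Option V) (aT : V → Set V)
    (w : V) : Prop :=
  ∃ w₁ w₂ : V, w₁ ≠ w₂ ∧ father w₁ = some w ∧ father w₂ = some w ∧
    Stable G (aT w₁) w₁ ∧ Stable G (aT w₂) w₂ ∧
    pn G (aT w₁) = pn G (aT w) ∧ pn G (aT w₂) = pn G (aT w) ∧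
    ∃ (O : Set V) (B : V → Set V),
      (∀ x ∈ O, father x = some w ∧ x ≠ w₁ ∧ x ≠ w₂ ∧ x ∈ B x ∧ B x ⊆ subtree G father x ∧
        (G.induce (B x)).Connected ∧ pn G (B x) < pn G (aT w)) ∧
      aT w = {w} ∪ aT w₁ ∪ aT w₂ ∪ ⋃ x ∈ O, B x

/-- The trees `aT w`, `w ∈ R`, form a hierarchical decomposition of `T_v`. -/
structure IsHierDecomp {V : Type*} (G : SimpleGraph V) (father : V → Option V) (aT : V → Set V)
    (v : V) (R : Set V) : Prop where
  cover : ⋃ w ∈ R, aT w = subtree G father v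
  disj : R.PairwiseDisjoint aT
  root_mem : ∀ w ∈ R, w ∈ aT w
  sub : ∀ w ∈ R, aT w ⊆ subtree G father w
  connected : ∀ w ∈ R, (G.induce (aT w)).Connected
  increasing : ∀ x ∈ R, ∀ w ∈ R, AssocLT father aT x w → pn G (aT x) < pn G (aT w)
  one_stable : ∀ w ∈ R, ∀ w' ∈ R, Stable G (aT w) w → Stable G (aT w') w' → w = w'
  stable_minimal : ∀ w ∈ R, Stable G (aT w) w → ∀ x ∈ R, ¬ AssocLT father aT x w
  unstable_shape : ∀ w ∈ R, ¬ Stable G (aT w) w → UnstableShape G father aT w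

/-- `T_i`: the part of a decomposition made of the associated-trees of process number
at most `i`. -/
def restricted {V : Type*} (G : SimpleGraph V) (aT : V → Set V) (R : Set V) (i : ℕ) : Set V :=
  ⋃ w ∈ {w ∈ R | pn G (aT w) ≤ i}, aT w

/-- A vector `(pn, pn⁺)`; `(-1, -1)` stands for the absence of a stable associated-tree. -/
abbrev Vect : Type := ℤ × ℤ

/-- The data that a node stores and sends: a vector and a table. -/
structure HD where
  vect : Vect
  table : List ℕ

/-- Cell `i` of a table, for `i = 1, …, L(t)`; the virtual cells outside of this range hold `0`. -/
def cell (t : List ℕ) (i : ℕ) : ℕ := if i = 0 then 0 else t.getD (i - 1) 0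

/-- The decomposition `(aT w)_{w ∈ R}` is described by the vector and the table of `h`. -/
structure Describes {V : Type*} (G : SimpleGraph V) (aT : V → Set V) (R : Set V) (h : HD) :
    Prop where
  vect_stable : ∀ w ∈ R, Stable G (aT w) w →
    h.vect = ((pn G (aT w) : ℤ), (pnPlus G (aT w) w : ℤ))
  vect_unstable : (∀ w ∈ R, ¬ Stable G (aT w) w) → h.vect = (-1, -1)
  table_length : IsGreatest ((fun w => pn G (aT w)) '' R) h.table.length
  table_cell : ∀ i, 1 ≤ i → i ≤ h.table.length → cell h.table i =
    {w ∈ R | ¬ Stable G (aT w) w ∧ pn G (aT w) = i ∧ pnPlus G (aT w) w = i + 1}.ncard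

/-- `h` describes the minimal hierarchical decomposition `(aT w)_{w ∈ R}` of `T_v`: it is a
hierarchical decomposition and no restriction `T_i`, `i ≤ L(t)`, has process number `i + 1`, so
that it cannot be simplified. -/
def IsMinimalHD {V : Type*} (G : SimpleGraph V) (father : V → Option V) (aT : V → Set V)
    (v : V) (R : Set V) (h : HD) : Prop :=
  IsHierDecomp G father aT v R ∧ Describes G aT R h ∧
    ∀ i ≤ h.table.length, pn G (restricted G aT R i) ≠ i + 1

/-! ### Programs with an operation count -/

/-- A value together with the number of elementary operations spent to compute it. -/
structure Timed (α : Type) where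
  val : α
  ops : ℕ

instance : Monad Timed where
  pure a := ⟨a, 0⟩
  bind x f := ⟨(f x.val).val, x.ops + (f x.val).ops⟩

/-- One elementary operation: an arithmetic operation or a comparison on integers, a test of the
shape of a list, adding an element to a list, reading or writing one cell of a table, or extending
a table by one cell. -/
def op {α : Type} (a : α) : Timed α := ⟨a, 1⟩

/-- Write `x` into cell `i`. -/
def write (t : List ℕ) (i x : ℕ) : Timed (List ℕ) := op (t.set (i - 1) x)

/-- Append up to `k` empty cells. -/
def extendBy (t : List ℕ) : ℕ → Timed (List ℕ)
  | 0 => pure t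
  | k + 1 => do
    let t' ← op (t ++ [0])
    extendBy t' k

/-- Make the length of the table at least `L`. -/
def extendTo (t : List ℕ) (L : ℕ) : Timed (List ℕ) := do
  let k ← op (L - t.length)
  extendBy t k

/-- Empty the cells `m, …, 1`. -/
def clear (t : List ℕ) : ℕ → Timed (List ℕ)
  | 0 => pure t
  | m + 1 => do
    let t' ← write t (m + 1) 0
    clear t' m

/-- Add the cells `k, …, 1` of `u` to those of `t`. -/
def addCells (u t : List ℕ) : ℕ → Timed (List ℕ)
  | 0 => pure t
  | k + 1 => do
    let a ← op (cell t (k + 1))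
    let b ← op (cell u (k + 1))
    let s ← op (a + b)
    let t' ← write t (k + 1) s
    addCells u t' k

/-- The largest `k ≤ i` with `t[k] > 1`, if there is one. -/
def lastBig (t : List ℕ) : ℕ → Timed (Option ℕ)
  | 0 => pure none
  | i + 1 => do
    let a ← op (cell t (i + 1))
    if ← op (decide (1 < a)) then pure (some (i + 1)) else lastBig t i

/-- The first `j ≥ i` with `t[j] = 0`, searched for in the cells `i, …, i + fuel - 1`; the answer
is `i + fuel` if there is none. -/
def firstZero (t : List ℕ) : (fuel i : ℕ) → Timed ℕ
  | 0, i => pure i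
  | fuel + 1, i => do
    let a ← op (cell t i)
    if ← op (decide (a = 0)) then pure i else firstZero t fuel (i + 1)

/-! ### The local computation of a node -/

/-- The sum of the received tables. -/
def sumTables : List HD → Timed (List ℕ)
  | [] => op []
  | h :: l => do
    let t ← sumTables l
    let t' ← extendTo t h.table.length
    addCells h.table t' h.table.length

/-- The received vectors different from `(-1, -1)`. -/
def activeVects : List HD → Timed (List Vect)
  | [] => op []
  | h :: l => do
    let N ← activeVects l
    if ← op (decide (h.vect = (-1, -1))) then pure N else op (h.vect :: N)

/-- `M_v`: the received vectors whose first entry is maximum. -/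
def maxVects : List HD → Timed (List Vect)
  | [] => op []
  | h :: l => do
    let M ← maxVects l
    match M with
    | [] => op [h.vect]
    | y :: _ =>
      if ← op (decide (y.1 < h.vect.1)) then op [h.vect]
      else if ← op (decide (y.1 = h.vect.1)) then op (h.vect :: M)
      else pure M

/-- The vector of the associated-tree of `v` in the initial cases, when the elements of `M` have
process number less than `2`. `N` contains the received vectors different from `(-1, -1)`. -/
def initialVect (N M : List Vect) : Timed Vect :=
  match M with
  | [] => op (0, 0)
  | x :: _ => do
    if ← op (decide (x.1 = -1)) then op (0, 0)
    else if ← op (decide (x.1 = 0)) then op (1, 1)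
    else
      match N with
      | [y] => do
        if ← op (decide (y = (1, 1))) then op (1, 2) else op (2, 2)
      | _ => op (2, 2)

/-- The vector of the associated-tree of `v`. -/
def ownVect (N M : List Vect) : Timed Vect :=
  match M with
  | [] => initialVect N M
  | x :: M' => do
    if ← op (decide (x.1 < 2)) then initialVect N M
    else
      match M' with
      | [] => op (x.1, x.1)
      | [_] => op (x.1, x.1 + 1)
      | _ :: _ :: _ => op (x.1 + 1, x.1 + 1)

/-- The table and the vector after the associated-tree of `v` has been taken into account: an
unstable one is counted in the table and absorbs all unstable associated-trees of smaller process
number. -/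
def insertOwn (p : Vect) (t : List ℕ) : Timed (Vect × List ℕ) := do
  if ← op (decide (p.1 < p.2 ∧ 1 < p.1)) then
    let a ← op (cell t p.1.toNat)
    let b ← op (a + 1)
    let t' ← write t p.1.toNat b
    let t'' ← clear t' (p.1.toNat - 1)
    op ((-1, -1), t'')
  else op (p, t)

/-- The final simplification of the decomposition, for `p` stable or equal to `(-1, -1)`. -/
def simplify (p : Vect) (t : List ℕ) : Timed HD := do
  let k ← lastBig t t.length
  let k₂ ← firstZero t (t.length + 1 - p.1.toNat) p.1.toNat
  match k with
  | some k => do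
    let k₁ ← firstZero t (t.length - k) (k + 1)
    let m ← op (max k₁ k₂)
    let t' ← extendTo t m
    let t'' ← clear t' m
    op ⟨(m, m), t''⟩
  | none => do
    if ← op (decide (2 ≤ p.1)) then
      let t' ← extendTo t k₂
      let t'' ← clear t' k₂
      op ⟨(k₂, k₂), t''⟩
    else op ⟨p, t⟩

/-- The local merge: the computation of the minimal hierarchical decomposition at a node from the
vectors `N` different from `(-1, -1)`, the vectors `M` that are maximum, and the sum `t` of the
tables, of its visited neighbours. -/
def mergeHD (N M : List Vect) (t : List ℕ) : Timed HD := do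
  let p ← ownVect N M
  let t' ← extendTo t p.1.toNat
  let q ← insertOwn p t'
  simplify q.1 q.2

/-- The input of the local merge, computed from the received messages. -/
def prepare (msgs : List HD) : Timed (List Vect × List Vect × List ℕ) := do
  let N ← activeVects msgs
  let M ← maxVects msgs
  let t ← sumTables msgs
  pure (N, M, t)

/-- The local merge applied to the received messages, without the cost of the preparation. -/
def mergeMsgs (msgs : List HD) : Timed HD :=
  let i := (prepare msgs).val
  mergeHD i.1 i.2.1 i.2.2

/-- The largest `j ≤ i` such that `t[j] ≠ 1`. -/
def skipOnes (t : List ℕ) : ℕ → Timed ℕ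
  | 0 => pure 0
  | i + 1 => do
    let a ← op (cell t (i + 1))
    if ← op (decide (a = 1)) then skipOnes t i else pure (i + 1)

/-- The process number read off a decomposition: it is `L(t)` if the table has a cell `0` followed
by cells `1` only, and `max {pn, L(t) + 1}` otherwise. (The virtual cell `0` takes care of the
empty table of a single node.) -/
def readPN (h : HD) : Timed ℤ := do
  let i ← skipOnes h.table h.table.length
  let a ← op (cell h.table i)
  if ← op (decide (a = 0)) then op (h.table.length : ℤ)
  else op (max h.vect.1 ((h.table.length : ℤ) + 1))

/-! ### The distributed algorithm -/

/-- A configuration of the network. -/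
structure Config (V : Type*) where
  /-- the messages received by each node with their senders, in the order of arrival -/
  inbox : V → List (V × HD)
  /-- the node to which a node has sent its message -/
  father : V → Option V
  /-- the decomposition computed by each node that has been visited -/
  hd : V → Option HD
  /-- the number of operations spent by each node in the local merge -/
  mergeOps : V → ℕ
  /-- the number of operations spent so far in the whole network -/
  totalOps : ℕ
  /-- the root and the process number that it has computed -/
  result : Option (V × ℤ)

/-- The initial configuration: nothing has been received, computed or sent. -/
def Config.initial (V : Type*) : Config V where
  inbox := fun _ => []
  father := fun _ => none
  hd := fun _ => none
  mergeOps := fun _ => 0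
  totalOps := 0
  result := none

/-- `v` has received a message from `u`. -/
def Config.Heard {V : Type*} (c : Config V) (v u : V) : Prop := ∃ h, (u, h) ∈ c.inbox v

/-- The messages received by `v`. -/
def Config.msgs {V : Type*} (c : Config V) (v : V) : List HD := (c.inbox v).map Prod.snd

open Classical in
/-- `v` computes its decomposition. Besides the preparation and the local merge, `v` spends one
operation for each of its neighbours, to see which of them have already sent a message. -/
noncomputable def Config.compute {V : Type*} (G : SimpleGraph V) (c : Config V) (v : V) :
    Config V :=
  { c with
    hd := Function.update c.hd v (some (mergeMsgs (c.msgs v)).val)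
    mergeOps := Function.update c.mergeOps v (mergeMsgs (c.msgs v)).ops
    totalOps := c.totalOps + (G.neighborSet v).ncard + (prepare (c.msgs v)).ops +
      (mergeMsgs (c.msgs v)).ops }

open Classical in
/-- `v` computes its decomposition and sends it to `w`. -/
noncomputable def Config.send {V : Type*} (G : SimpleGraph V) (c : Config V) (v w : V) :
    Config V :=
  { c.compute G v with
    inbox := Function.update c.inbox w (c.inbox w ++ [(v, (mergeMsgs (c.msgs v)).val)])
    father := Function.update c.father v (some w) }

/-- `v` computes its decomposition and, as the root, the process number. -/
noncomputable def Config.finish {V : Type*} (G : SimpleGraph V) (c : Config V) (v : V) :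
    Config V :=
  { c.compute G v with
    totalOps := (c.compute G v).totalOps + (readPN (mergeMsgs (c.msgs v)).val).ops
    result := some (v, (readPN (mergeMsgs (c.msgs v)).val).val) }

/-- One step of the distributed algorithm: some unvisited node that has received messages from
all its neighbours but one (in particular, a leaf) sends a message to that neighbour, or some
unvisited node that has received messages from all its neighbours finishes as the root. Which of
the possible steps takes place is left to the asynchronous environment. -/
inductive Step {V : Type*} (G : SimpleGraph V) : Config V → Config V → Prop
  | send (c : Config V) (v w : V) (hv : c.hd v = none) (hw : G.Adj v w) (hn : ¬ c.Heard v w)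
      (hall : ∀ u, G.Adj v u → u ≠ w → c.Heard v u) : Step G c (c.send G v w)
  | finish (c : Config V) (v : V) (hv : c.hd v = none)
      (hall : ∀ u, G.Adj v u → c.Heard v u) : Step G c (c.finish G v)

/-- `c` is reached after `k` steps of some execution of the distributed algorithm on `G`. -/
inductive Run {V : Type*} (G : SimpleGraph V) : ℕ → Config V → Prop
  | init : Run G 0 (Config.initial V)
  | step (k : ℕ) (c c' : Config V) (hc : Run G k c) (hs : Step G c c') : Run G (k + 1) c'

end ProcNum

namespace ProcNum

/-! A strategy with `p` agents is a path in the graph of states (`Reach`). Such paths can be run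
inside a larger graph (`Reach.frame`), reversed in time (`Reach.rev`) and restricted to a subset of
the nodes (`Reach.restrict`); the upper bounds are assembled from these operations. A node `v` may
have one branch as expensive as the whole tree and still be the last node with an agent: the branch
is finished at its root and the agent moves up (`Rooted.endable_of_child`). With two such branches
the second one is run backwards (`Rooted.searchable_of_two`), which keeps the number of agents but
loses control over the end. Conversely, three branches at a node that each need `q + 1` agents force
`q + 2` (`not_searchable_of_three`), and two of them force `q + 2` when the strategy has to end at
that node (`not_endable_of_two`). This gap is the source of unstable trees.

The decompositions are defined from two functions: `m`, the process number of the associated-tree of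
each node, and `unst`, its instability. The invariant `NodeInv` says that these functions and the
computed data are correct and that every level carries at most one unstable tree. Under it, the part
of the decomposition up to level `i` needs at most `i` agents (`Rooted.searchable_lower`): the two
stable subtrees of the unstable tree of level `i` are joined through its root, and the rest is
handled with fewer agents. This gives minimality, and it shows that the process number of the whole
tree is the length of the table.

A merge may create a conflict on a level, for instance two unstable trees, or an unstable and a
stable one. Such a conflict costs one more agent (`MergeStep.not_searchable_of_base`), and the
obstruction climbs through all consecutive nonempty levels (`MergeStep.not_searchable_of_chain`). It
stops at the first empty level `m`, where everything below becomes one stable tree of process number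
`m`. Algorithm 1 computes exactly this: `mergeMsgs_spec` extracts the combinatorial outcome, and
`MergeStep.nodeInv` turns it into the invariant.

An execution cannot block, since an unvisited node at maximal distance from another unvisited node
has at most one unvisited neighbour. For the cost, choosing the largest child shows that a tree with
`n` nodes needs at most `log₂ n + 2` agents (`Rooted.endable_log`), so tables have logarithmic
length. As each node sends at most one message, summing the cost per message gives the bound for the
whole execution. -/

section Strategies

variable {V : Type*} {G : SimpleGraph V}

/-! ### Reachability of states -/

/-- A legal action after which at most `p` nodes are occupied. -/
def Move (G : SimpleGraph V) (S : Set V) (p : ℕ) (s s' : PState V) : Prop :=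
  (∃ a, PStep G S s a s') ∧ s'.occ.encard ≤ p

/-- Reachability by legal actions, with at most `p` agents. -/
def Reach (G : SimpleGraph V) (S : Set V) (p : ℕ) : PState V → PState V → Prop :=
  Relation.ReflTransGen (Move G S p)

/-- The subgraph induced by `S` has a `p`-process strategy. -/
def Searchable (G : SimpleGraph V) (S : Set V) (p : ℕ) : Prop := Reach G S p ⟨∅, ∅⟩ ⟨∅, S⟩

/-- With `p` agents, one can process all nodes of `S` but `r`, leaving an agent on `r`. -/
def Endable (G : SimpleGraph V) (S : Set V) (p : ℕ) (r : V) : Prop :=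
  Reach G S p ⟨∅, ∅⟩ ⟨{r}, S \ {r}⟩

lemma PRun.reach {S : Set V} {p : ℕ} {s s' : PState V} {l : List (Action V)}
    (h : PRun G S p s l s') : Reach G S p s s' := by
  induction h with
  | nil s => exact Relation.ReflTransGen.refl
  | cons s s' s'' a l ha hp hl ih => exact Relation.ReflTransGen.head ⟨⟨a, ha⟩, hp⟩ ih

lemma PRun.append {S : Set V} {p : ℕ} {s s' s'' : PState V} {l l' : List (Action V)}
    (h : PRun G S p s l s') (h' : PRun G S p s' l' s'') : PRun G S p s (l ++ l') s'' := by
  induction h with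
  | nil s => exact h'
  | cons s s' t a l ha hp hl ih => exact PRun.cons _ _ _ _ _ ha hp (ih h')

lemma PRun.of_append {S : Set V} {p : ℕ} {l l' : List (Action V)} : ∀ {s s'' : PState V},
    PRun G S p s (l ++ l') s'' → ∃ s', PRun G S p s l s' ∧ PRun G S p s' l' s'' := by
  induction l with
  | nil => intro s s'' h; exact ⟨s, PRun.nil s, h⟩
  | cons a l ih =>
    intro s s'' h
    cases h with
    | cons s s' s'' a l ha hp hl =>
      obtain ⟨t, h1, h2⟩ := ih hl
      exact ⟨t, PRun.cons _ _ _ _ _ ha hp h1, h2⟩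

lemma Reach.exists_run {S : Set V} {p : ℕ} {s s' : PState V} (h : Reach G S p s s') :
    ∃ l, PRun G S p s l s' := by
  induction h using Relation.ReflTransGen.head_induction_on with
  | refl => exact ⟨[], PRun.nil _⟩
  | head h _ ih =>
    obtain ⟨l, hl⟩ := ih
    obtain ⟨⟨a, ha⟩, hp⟩ := h
    exact ⟨a :: l, PRun.cons _ _ _ _ _ ha hp hl⟩

lemma searchable_iff {S : Set V} {p : ℕ} : Searchable G S p ↔ ∃ l, IsStrategy G S p l :=
  ⟨fun h => h.exists_run, fun ⟨_, h⟩ => PRun.reach h⟩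

lemma Reach.trans {S : Set V} {p : ℕ} {s s' s'' : PState V} (h : Reach G S p s s')
    (h' : Reach G S p s' s'') : Reach G S p s s'' := Relation.ReflTransGen.trans h h'

lemma Reach.mono {S : Set V} {p q : ℕ} (hpq : p ≤ q) {s s' : PState V} (h : Reach G S p s s') :
    Reach G S q s s' := by
  induction h with
  | refl => exact Relation.ReflTransGen.refl
  | tail _ h ih =>
    exact Relation.ReflTransGen.tail ih ⟨h.1, h.2.trans (by exact_mod_cast hpq)⟩

lemma Searchable.mono {S : Set V} {p q : ℕ} (hpq : p ≤ q) (h : Searchable G S p) :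
    Searchable G S q := Reach.mono hpq h

lemma Endable.mono {S : Set V} {p q : ℕ} {r : V} (hpq : p ≤ q) (h : Endable G S p r) :
    Endable G S q r := Reach.mono hpq h

/-! ### Invariants -/

/-- The consistency conditions satisfied by all the states of a strategy. -/
structure Consistent (G : SimpleGraph V) (S : Set V) (s : PState V) : Prop where
  occ_sub : s.occ ⊆ S
  processed_sub : s.processed ⊆ S
  disj : ∀ u ∈ s.occ, u ∉ s.processed
  closed : ∀ u ∈ s.processed, ∀ w ∈ S, G.Adj u w → w ∈ s.processed ∨ w ∈ s.occ

lemma consistent_init (S : Set V) : Consistent G S ⟨∅, ∅⟩ :=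
  ⟨by simp, by simp, by simp, by simp⟩

lemma Consistent.step {S : Set V} {s s' : PState V} {a : Action V} (hs : Consistent G S s)
    (h : PStep G S s a s') : Consistent G S s' := by
  obtain ⟨h1, h2, h3, h4⟩ := hs
  cases h with
  | place v hS ho hp =>
    refine ⟨Set.insert_subset hS h1, h2, ?_, ?_⟩
    · rintro u (rfl | hu)
      · exact hp
      · exact h3 u hu
    · intro u hu w hw ha
      rcases h4 u hu w hw ha with h | h
      · exact Or.inl h
      · exact Or.inr (Or.inr h)
  | remove v ho hn =>
    refine ⟨fun u hu => h1 hu.1, Set.insert_subset (h1 ho) h2, ?_, ?_⟩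
    · rintro u ⟨hu, huv⟩ (rfl | hu')
      · exact huv rfl
      · exact h3 u hu hu'
    · intro u hu w hw ha
      by_cases hwv : w = v
      · exact Or.inl (Or.inl hwv)
      · have : w ∈ s.processed ∨ w ∈ s.occ := by
          rcases hu with rfl | hu
          · exact hn w hw ha
          · exact h4 u hu w hw ha
        rcases this with h | h
        · exact Or.inl (Or.inr h)
        · exact Or.inr ⟨h, hwv⟩
  | surround v hS ho hp hn =>
    refine ⟨h1, Set.insert_subset hS h2, ?_, ?_⟩
    · rintro u hu (rfl | hu')
      · exact ho hu
      · exact h3 u hu hu'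
    · rintro u (rfl | hu) w hw ha
      · exact Or.inr (hn w hw ha)
      · rcases h4 u hu w hw ha with h | h
        · exact Or.inl (Or.inr h)
        · exact Or.inr h

lemma Consistent.reach {S : Set V} {p : ℕ} {s s' : PState V} (hs : Consistent G S s)
    (h : Reach G S p s s') : Consistent G S s' := by
  induction h with
  | refl => exact hs
  | tail _ h ih => obtain ⟨⟨a, ha⟩, _⟩ := h; exact ih.step ha

lemma Reach.encard_le {S : Set V} {p : ℕ} {s s' : PState V} (hs : s.occ.encard ≤ p)
    (h : Reach G S p s s') : s'.occ.encard ≤ p := by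
  induction h with
  | refl => exact hs
  | tail _ h ih => exact h.2

lemma PStep.processed_mono {S : Set V} {s s' : PState V} {a : Action V} (h : PStep G S s a s') :
    s.processed ⊆ s'.processed := by
  cases h with
  | place v hS ho hp => exact subset_rfl
  | remove v ho hn => exact Set.subset_insert _ _
  | surround v hS ho hp hn => exact Set.subset_insert _ _

lemma PStep.touched_mono {S : Set V} {s s' : PState V} {a : Action V} (h : PStep G S s a s') :
    s.occ ∪ s.processed ⊆ s'.occ ∪ s'.processed := by
  cases h with
  | place v hS ho hp => intro u hu; simp at hu ⊢; tauto
  | remove v ho hn => intro u hu; simp at hu ⊢; tauto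
  | surround v hS ho hp hn => intro u hu; simp at hu ⊢; tauto

lemma Reach.processed_mono {S : Set V} {p : ℕ} {s s' : PState V} (h : Reach G S p s s') :
    s.processed ⊆ s'.processed := by
  induction h with
  | refl => exact subset_rfl
  | tail _ h ih => obtain ⟨⟨a, ha⟩, _⟩ := h; exact ih.trans ha.processed_mono

lemma Reach.touched_mono {S : Set V} {p : ℕ} {s s' : PState V} (h : Reach G S p s s') :
    s.occ ∪ s.processed ⊆ s'.occ ∪ s'.processed := by
  induction h with
  | refl => exact subset_rfl
  | tail _ h ih => obtain ⟨⟨a, ha⟩, _⟩ := h; exact ih.trans ha.touched_mono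

/-! ### Reversal -/

/-- The state in which the processed and the untouched nodes are exchanged. -/
def PState.rev (S : Set V) (s : PState V) : PState V := ⟨s.occ, S \ (s.occ ∪ s.processed)⟩

/-- Placing and removing are exchanged. The reverse of a placement at `v` is a legal removal
because, by consistency, no processed node is adjacent to the still untouched `v`. -/
lemma PStep.rev {S : Set V} {s s' : PState V} {a : Action V} (hs : Consistent G S s)
    (h : PStep G S s a s') : ∃ b, PStep G S (s'.rev S) b (s.rev S) := by
  obtain ⟨h1, h2, h3, h4⟩ := hs
  cases h with
  | place v hS ho hp =>
    refine ⟨.remove v, ?_⟩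
    have := PStep.remove (G := G) (S := S) (PState.rev S ⟨insert v s.occ, s.processed⟩) v
      (by simp [PState.rev]) (by
        intro u hu ha
        simp only [PState.rev, Set.mem_sdiff, Set.mem_union, Set.mem_insert_iff]
        by_cases huo : u = v ∨ u ∈ s.occ
        · exact Or.inr huo
        · refine Or.inl ⟨hu, ?_⟩
          rintro (h | h)
          · exact huo h
          · rcases h4 u h v hS ha.symm with h | h
            · exact hp h
            · exact ho h)
    convert this using 1
    simp only [PState.rev, PState.mk.injEq]
    constructor
    · ext u; simp only [Set.mem_sdiff, Set.mem_insert_iff, Set.mem_singleton_iff]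
      constructor
      · intro h; exact ⟨Or.inr h, fun e => ho (e ▸ h)⟩
      · tauto
    · ext u
      simp only [Set.mem_sdiff, Set.mem_insert_iff, Set.mem_union]
      by_cases huv : u = v
      · subst huv; simp [hS, ho, hp]
      · simp [huv]
  | remove v ho hn =>
    refine ⟨.place v, ?_⟩
    have := PStep.place (G := G) (S := S) (PState.rev S ⟨s.occ \ {v}, insert v s.processed⟩) v
      (h1 ho) (by simp [PState.rev]) (by simp [PState.rev])
    convert this using 1
    simp only [PState.rev, PState.mk.injEq]
    constructor
    · simp [ho]
    · ext u
      simp only [Set.mem_sdiff, Set.mem_insert_iff, Set.mem_union, Set.mem_singleton_iff]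
      by_cases huv : u = v
      · subst huv; simp [ho]
      · simp [huv]
  | surround v hS ho hp hn =>
    refine ⟨.surround v, ?_⟩
    have := PStep.surround (G := G) (S := S) (PState.rev S ⟨s.occ, insert v s.processed⟩) v
      hS (by simpa [PState.rev] using ho) (by simp [PState.rev]) hn
    convert this using 1
    simp only [PState.rev, PState.mk.injEq, true_and]
    ext u
    simp only [Set.mem_sdiff, Set.mem_insert_iff, Set.mem_union]
    by_cases huv : u = v
    · subst huv; simp [ho, hp, hS]
    · simp [huv]

lemma Reach.rev {S : Set V} {p : ℕ} {s s' : PState V} (hs : Consistent G S s)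
    (hp : s.occ.encard ≤ p) (h : Reach G S p s s') : Reach G S p (s'.rev S) (s.rev S) := by
  induction h with
  | refl => exact Relation.ReflTransGen.refl
  | @tail t s' h1 h ih =>
    obtain ⟨⟨a, ha⟩, _⟩ := h
    obtain ⟨b, hb⟩ := ha.rev (hs.reach h1)
    exact Relation.ReflTransGen.head ⟨⟨b, hb⟩, (Reach.encard_le hp h1 : t.occ.encard ≤ p)⟩ ih

/-! ### Strategies inside larger graphs and their restrictions -/

/-- The strategy on `B` is played while the agents on `X` and the processed set `Y` outside `B` stay
fixed. An outer neighbour that is only processed is enough for a removal but not for a `surround`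
move, which requires occupied neighbours. For this reason the alternative `w ∈ Y` comes with the
condition that `u` is occupied from the start. -/
lemma Reach.frame {B S X Y : Set V} {p q : ℕ} {s s' : PState V} (hBS : B ⊆ S)
    (hs : Consistent G B s) (hX : Disjoint X B) (hY : Disjoint Y B)
    (hq : p + X.encard ≤ q) (h : Reach G B p s s')
    (hN : ∀ u ∈ s'.processed, u ∉ s.processed → ∀ w ∈ S, w ∉ B → G.Adj u w →
      w ∈ X ∨ (w ∈ Y ∧ u ∈ s.occ)) :
    Reach G S q ⟨s.occ ∪ X, s.processed ∪ Y⟩ ⟨s'.occ ∪ X, s'.processed ∪ Y⟩ := by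
  have hXB : ∀ u ∈ B, u ∉ X := fun u hu hx => Set.disjoint_left.1 hX hx hu
  have hYB : ∀ u ∈ B, u ∉ Y := fun u hu hx => Set.disjoint_left.1 hY hx hu
  induction h with
  | refl => exact Relation.ReflTransGen.refl
  | @tail t s' h1 h ih =>
    obtain ⟨⟨a, ha⟩, hpt⟩ := h
    have hc := hs.reach h1
    have ht := Reach.touched_mono h1
    refine Relation.ReflTransGen.tail
      (ih fun u hu => hN u (ha.processed_mono hu)) ⟨?_, ?_⟩
    · cases ha with
      | place v hS ho hp =>
        refine ⟨.place v, ?_⟩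
        have := PStep.place (G := G) (S := S) ⟨t.occ ∪ X, t.processed ∪ Y⟩ v (hBS hS)
          (by simp [ho, hXB v hS]) (by simp [hp, hYB v hS])
        rwa [← Set.insert_union] at this
      | remove v ho hn =>
        refine ⟨.remove v, ?_⟩
        have hvB := hc.occ_sub ho
        have := PStep.remove (G := G) (S := S) ⟨t.occ ∪ X, t.processed ∪ Y⟩ v (Or.inl ho)
          (by
            intro u hu hadj
            by_cases huB : u ∈ B
            · rcases hn u huB hadj with h | h
              · exact Or.inl (Or.inl h)
              · exact Or.inr (Or.inl h)
            · rcases hN v (by simp) (fun h => hc.disj v ho (Reach.processed_mono h1 h)) u hu huB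
                hadj with h | h
              · exact Or.inr (Or.inr h)
              · exact Or.inl (Or.inr h.1))
        have e : (t.occ ∪ X) \ {v} = (t.occ \ {v}) ∪ X := by
          ext u
          have := hXB v hvB
          simp only [Set.mem_sdiff, Set.mem_union, Set.mem_singleton_iff]
          constructor
          · tauto
          · rintro (h | h)
            · tauto
            · exact ⟨Or.inr h, fun e => this (e ▸ h)⟩
        rw [← Set.insert_union] at this
        simpa only [e] using this
      | surround v hS ho hp hn =>
        refine ⟨.surround v, ?_⟩
        have := PStep.surround (G := G) (S := S) ⟨t.occ ∪ X, t.processed ∪ Y⟩ v (hBS hS)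
          (by simp [ho, hXB v hS]) (by simp [hp, hYB v hS])
          (by
            intro u hu hadj
            by_cases huB : u ∈ B
            · exact Or.inl (hn u huB hadj)
            · rcases hN v (by simp) (fun h => hp (Reach.processed_mono h1 h)) u hu huB
                hadj with h | h
              · exact Or.inr h
              -- A node occupied at the start stays occupied or processed, so it can never be the
              -- object of a `surround` move.
              · rcases ht (Or.inl h.2) with h | h
                · exact absurd h ho
                · exact absurd h hp)
        rwa [← Set.insert_union] at this
    · calc (s'.occ ∪ X).encard ≤ s'.occ.encard + X.encard := Set.encard_union_le _ _
        _ ≤ p + X.encard := by gcongr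
        _ ≤ q := hq

/-- The restriction of a state to `A`. -/
def PState.restrict (A : Set V) (s : PState V) : PState V := ⟨s.occ ∩ A, s.processed ∩ A⟩

/-- Inside `A` there are fewer neighbours to take care of, so an action at a node of `A` stays
legal; an action elsewhere becomes invisible. -/
lemma PStep.restrict {A S : Set V} (hA : A ⊆ S) {s s' : PState V} {a : Action V}
    (h : PStep G S s a s') :
    s'.restrict A = s.restrict A ∨ ∃ b, PStep G A (s.restrict A) b (s'.restrict A) := by
  cases h with
  | place v hS ho hp =>
    by_cases hv : v ∈ A
    · right
      refine ⟨.place v, ?_⟩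
      have := PStep.place (G := G) (s.restrict A) v hv (by simp [PState.restrict, ho])
        (by simp [PState.restrict, hp])
      simpa only [PState.restrict, Set.insert_inter_of_mem hv] using this
    · left; simp only [PState.restrict, Set.insert_inter_of_notMem hv]
  | remove v ho hn =>
    by_cases hv : v ∈ A
    · right
      refine ⟨.remove v, ?_⟩
      have := PStep.remove (G := G) (S := A) (s.restrict A) v ⟨ho, hv⟩ (by
        intro u hu ha
        rcases hn u (hA hu) ha with h | h
        · exact Or.inl ⟨h, hu⟩
        · exact Or.inr ⟨h, hu⟩)
      have e : s.occ \ {v} ∩ A = (s.occ ∩ A) \ {v} := by ext; simp; tauto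
      simpa only [PState.restrict, Set.insert_inter_of_mem hv, e] using this
    · left
      simp only [PState.restrict, Set.insert_inter_of_notMem hv, PState.mk.injEq, and_true]
      ext u
      simp only [Set.mem_inter_iff, Set.mem_sdiff, Set.mem_singleton_iff]
      constructor
      · tauto
      · rintro ⟨h1, h2⟩; exact ⟨⟨h1, fun e => hv (e ▸ h2)⟩, h2⟩
  | surround v hS ho hp hn =>
    by_cases hv : v ∈ A
    · right
      refine ⟨.surround v, ?_⟩
      have := PStep.surround (G := G) (s.restrict A) v hv (by simp [PState.restrict, ho])
        (by simp [PState.restrict, hp]) (fun u hu ha => ⟨hn u (hA hu) ha, hu⟩)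
      simpa only [PState.restrict, Set.insert_inter_of_mem hv] using this
    · left; simp only [PState.restrict, Set.insert_inter_of_notMem hv]

lemma Reach.restrict {A S : Set V} (hA : A ⊆ S) {p q : ℕ} {s e : PState V}
    (h : Reach G S p s e)
    (hq : ∀ t, Reach G S p s t → Reach G S p t e → (t.occ ∩ A).encard ≤ q) :
    Reach G A q (s.restrict A) (e.restrict A) := by
  suffices H : ∀ t, Reach G S p s t → Reach G S p t e →
      Reach G A q (s.restrict A) (t.restrict A) from H e h Relation.ReflTransGen.refl
  intro t ht
  induction ht with
  | refl => intro _; exact Relation.ReflTransGen.refl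
  | @tail t t' h1 h2 ih =>
    intro he
    have ih := ih (Relation.ReflTransGen.head h2 he)
    obtain ⟨⟨a, ha⟩, hp⟩ := h2
    rcases ha.restrict hA with h | ⟨b, hb⟩
    · rwa [h]
    · exact Relation.ReflTransGen.tail ih
        ⟨⟨b, hb⟩, hq t' (Relation.ReflTransGen.tail h1 ⟨⟨a, ha⟩, hp⟩) he⟩

lemma Searchable.subset {A S : Set V} (hA : A ⊆ S) {p : ℕ} (h : Searchable G S p) :
    Searchable G A p := by
  have := Reach.restrict hA (q := p) h (fun t ht _ =>
    (Set.encard_le_encard Set.inter_subset_left).trans (Reach.encard_le (by simp) ht))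
  simpa [Searchable, PState.restrict, Set.inter_eq_self_of_subset_right hA] using this

/-! ### Upper bounds -/

lemma searchable_empty (p : ℕ) : Searchable G ∅ p := Relation.ReflTransGen.refl

lemma Endable.searchable {S : Set V} {p : ℕ} {r : V} (hr : r ∈ S) (h : Endable G S p r) :
    Searchable G S p := by
  refine Relation.ReflTransGen.tail h ⟨⟨.remove r, ?_⟩, by simp⟩
  have := PStep.remove (G := G) (S := S) ⟨{r}, S \ {r}⟩ r rfl (fun u hu ha =>
    Or.inl ⟨hu, ha.ne'⟩)
  simpa [Set.insert_sdiff_singleton, Set.insert_eq_of_mem hr] using this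

lemma Searchable.union {A B : Set V} {p : ℕ} (hA : Searchable G A p) (hB : Searchable G B p)
    (hd : Disjoint A B) (hAB : ∀ a ∈ A, ∀ b ∈ B, ¬ G.Adj a b) : Searchable G (A ∪ B) p := by
  have h1 := Reach.frame (S := A ∪ B) (X := ∅) (Y := ∅) (q := p) Set.subset_union_left
    (consistent_init A) (by simp) (by simp) (by simp) hA
    (fun u hu _ w hw hwA ha => absurd ha (hAB u hu w (hw.resolve_left hwA)))
  have h2 := Reach.frame (S := A ∪ B) (X := ∅) (Y := A) (q := p) Set.subset_union_right
    (consistent_init B) (by simp) hd (by simp) hB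
    (fun u hu _ w hw hwB ha => absurd ha.symm (hAB w (hw.resolve_right hwB) u hu))
  simp only [Set.union_empty, Set.empty_union] at h1 h2
  rw [Set.union_comm B A] at h2
  exact h1.trans h2

lemma Searchable.biUnion {ι : Type*} {I : Set ι} (hI : I.Finite) {B : ι → Set V} {p : ℕ}
    (h : ∀ i ∈ I, Searchable G (B i) p)
    (hd : ∀ i ∈ I, ∀ j ∈ I, i ≠ j → Disjoint (B i) (B j) ∧ ∀ a ∈ B i, ∀ b ∈ B j, ¬ G.Adj a b) :
    Searchable G (⋃ i ∈ I, B i) p := by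
  induction I, hI using Set.Finite.induction_on with
  | empty => simpa using searchable_empty p
  | @insert i I hi hI ih =>
    rw [Set.biUnion_insert]
    refine (h i (by simp)).union (ih (fun j hj => h j (Or.inr hj))
      (fun j hj k hk => hd j (Or.inr hj) k (Or.inr hk))) ?_ ?_
    · rw [Set.disjoint_iUnion₂_right]
      exact fun j hj => (hd i (by simp) j (Or.inr hj) (fun e => hi (e ▸ hj))).1
    · intro a ha b hb
      obtain ⟨j, hj, hb⟩ := Set.mem_iUnion₂.1 hb
      exact (hd i (by simp) j (Or.inr hj) (fun e => hi (e ▸ hj))).2 a ha b hb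

/-- One additional agent sits on `x` from the beginning to the end, and the other nodes are
processed as if `x` were absent. -/
lemma endable_of_searchable_diff {S : Set V} {p : ℕ} {x : V} (hx : x ∈ S)
    (h : Searchable G (S \ {x}) p) : Endable G S (p + 1) x := by
  have h1 := Reach.frame (S := S) (X := {x}) (Y := ∅) (q := p + 1) Set.sdiff_subset
    (consistent_init _) (by simp) (by simp) (by simp) h
    (fun u hu _ w hw hwA ha => Or.inl (by
      by_contra hne; exact hwA ⟨hw, hne⟩))
  simp only [Set.union_empty, Set.empty_union] at h1
  refine Relation.ReflTransGen.head ⟨⟨.place x, ?_⟩, ?_⟩ h1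
  · have := PStep.place (G := G) (S := S) ⟨∅, ∅⟩ x hx (by simp) (by simp)
    simpa using this
  · simp

lemma endable_singleton (x : V) : Endable G {x} 1 x :=
  endable_of_searchable_diff rfl (by simpa using searchable_empty 0)

lemma exists_searchable [Finite V] (G : SimpleGraph V) (S : Set V) : ∃ p, Searchable G S p := by
  have hS := S.toFinite
  induction S, hS using Set.Finite.induction_on with
  | empty => exact ⟨0, searchable_empty 0⟩
  | @insert x S hx hS ih =>
    obtain ⟨p, hp⟩ := ih
    refine ⟨p + 1, (endable_of_searchable_diff (x := x) (by simp) ?_).searchable (by simp)⟩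
    simpa [Set.insert_sdiff_self_of_notMem hx] using hp

/-- The agent that ends at `c` moves on to the neighbour `r`, from which the remaining parts are
processed. -/
lemma Endable.extend {B D : Set V} {p : ℕ} {c r : V} (hB : Endable G B (p + 2) c) (hc : c ∈ B)
    (hD : Searchable G D (p + 1)) (hrB : r ∉ B) (hrD : r ∉ D) (hd : Disjoint B D)
    (hBD : ∀ a ∈ B, ∀ b ∈ D, ¬ G.Adj a b) (hBr : ∀ a ∈ B, G.Adj a r → a = c) :
    Endable G (insert r (B ∪ D)) (p + 2) r := by
  have h1 := Reach.frame (S := insert r (B ∪ D)) (X := ∅) (Y := ∅) (q := p + 2)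
    (fun x hx => Or.inr (Or.inl hx)) (consistent_init _) (by simp) (by simp) (by simp) hB
    (by
      intro u hu _ w hw hwB ha
      rcases hw with rfl | hw | hw
      · exact absurd (hBr u hu.1 ha) hu.2
      · exact absurd hw hwB
      · exact absurd ha (hBD u hu.1 w hw))
  have h2 := Reach.frame (S := insert r (B ∪ D)) (X := {r}) (Y := B) (q := p + 2)
    (fun x hx => Or.inr (Or.inr hx)) (consistent_init _) (by simpa using hrD) hd
    (by simp; norm_cast) hD
    (by
      intro u hu _ w hw hwD ha
      rcases hw with rfl | hw | hw
      · exact Or.inl rfl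
      · exact absurd ha.symm (hBD w hw u hu)
      · exact absurd hw hwD)
  simp only [Set.union_empty, Set.empty_union] at h1 h2
  have e : insert r (B ∪ D) \ {r} = D ∪ B := by
    rw [Set.insert_sdiff_self_of_notMem (by simp [hrB, hrD]), Set.union_comm]
  rw [Endable, e]
  refine h1.trans (Reach.trans ?_ h2)
  have hcr : c ≠ r := fun e => hrB (e ▸ hc)
  -- The agent on `r` has to be placed before the one on `c` is removed. At that moment two nodes
  -- are occupied, which explains the form `p + 2` of the bound.
  refine Relation.ReflTransGen.head (b := ⟨{r, c}, B \ {c}⟩) ⟨⟨.place r, ?_⟩, ?_⟩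
    (Relation.ReflTransGen.single ⟨⟨.remove c, ?_⟩, ?_⟩)
  · exact PStep.place (G := G) _ r (Or.inl rfl) (by simpa using hcr.symm) (by simp [hrB])
  · refine (Set.encard_insert_le _ _).trans ?_
    simp only [Set.encard_singleton]
    norm_cast; omega
  · have := PStep.remove (G := G) (S := insert r (B ∪ D)) ⟨{r, c}, B \ {c}⟩ c (by simp) (by
      intro u hu ha
      rcases hu with rfl | hu | hu
      · exact Or.inr (Or.inl rfl)
      · exact Or.inl ⟨hu, ha.ne'⟩
      · exact absurd ha (hBD c hc u hu))
    simp only [Set.insert_sdiff_singleton, Set.insert_eq_of_mem hc] at this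
    rwa [Set.insert_sdiff_of_notMem _ (by simpa using hcr.symm), sdiff_self, Set.bot_eq_empty,
      insert_empty_eq] at this
  · simp only [Set.encard_singleton]; norm_cast; omega

/-- Two strategies ending at adjacent nodes can be joined, the second one being reversed. -/
lemma Endable.join {B D : Set V} {p : ℕ} {c r : V} (hB : Endable G B (p + 2) c) (hc : c ∈ B)
    (hD : Endable G D (p + 2) r) (hr : r ∈ D) (hd : Disjoint B D)
    (hBD : ∀ a ∈ B, ∀ b ∈ D, G.Adj a b → a = c ∧ b = r) :
    Searchable G (B ∪ D) (p + 2) := by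
  have hrB : r ∉ B := fun h => Set.disjoint_left.1 hd h hr
  have hcD : c ∉ D := fun h => Set.disjoint_left.1 hd hc h
  have hcr : c ≠ r := fun e => hrB (e ▸ hc)
  have h1 := Reach.frame (S := B ∪ D) (X := ∅) (Y := ∅) (q := p + 2)
    Set.subset_union_left (consistent_init _) (by simp) (by simp) (by simp) hB
    (by
      intro u hu _ w hw hwB ha
      rcases hw with hw | hw
      · exact absurd hw hwB
      · exact absurd (hBD u hu.1 w hw ha).1 hu.2)
  -- Reversed, the strategy on `D` starts with a single agent on `r` and nothing processed, and ends
  -- with all of `D` processed.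
  have hrev := Reach.rev (consistent_init D) (by simp) hD
  have e1 : PState.rev D ⟨{r}, D \ {r}⟩ = ⟨{r}, ∅⟩ := by
    simp [PState.rev, Set.insert_eq_of_mem hr]
  have e2 : PState.rev D ⟨∅, ∅⟩ = ⟨∅, D⟩ := by simp [PState.rev]
  rw [e1, e2] at hrev
  -- The only node of `D` adjacent to the processed set `B` is `r`, which is occupied at the start:
  -- this is the second alternative in `Reach.frame`.
  have h2 := Reach.frame (S := B ∪ D) (X := ∅) (Y := B) (q := p + 2)
    Set.subset_union_right ⟨by simpa using hr, by simp, by simp, by simp⟩ (by simp) hd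
    (by simp) hrev
    (by
      intro u hu _ w hw hwD ha
      rcases hw with hw | hw
      · exact Or.inr ⟨hw, (hBD w hw u hu ha.symm).2⟩
      · exact absurd hw hwD)
  simp only [Set.union_empty, Set.empty_union] at h1 h2
  rw [Set.union_comm D B] at h2
  refine h1.trans (Reach.trans ?_ h2)
  refine Relation.ReflTransGen.head (b := ⟨{r, c}, B \ {c}⟩) ⟨⟨.place r, ?_⟩, ?_⟩
    (Relation.ReflTransGen.single ⟨⟨.remove c, ?_⟩, ?_⟩)
  · exact PStep.place (G := G) _ r (Or.inr hr) (by simpa using hcr.symm) (by simp [hrB])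
  · refine (Set.encard_insert_le _ _).trans ?_
    simp only [Set.encard_singleton]
    norm_cast; omega
  · have := PStep.remove (G := G) (S := B ∪ D) ⟨{r, c}, B \ {c}⟩ c (by simp) (by
      intro u hu ha
      rcases hu with hu | hu
      · exact Or.inl ⟨hu, ha.ne'⟩
      · exact Or.inr (Or.inl (hBD c hc u hu ha).2))
    simp only [Set.insert_sdiff_singleton, Set.insert_eq_of_mem hc] at this
    rwa [Set.insert_sdiff_of_notMem _ (by simpa using hcr.symm), sdiff_self, Set.bot_eq_empty,
      insert_empty_eq] at this
  · simp only [Set.encard_singleton]; norm_cast; omega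

/-- A node all of whose neighbours are the end `c` can be processed without an agent. -/
lemma Endable.insert_leaf {B : Set V} {p : ℕ} {c r : V} (hB : Endable G B (p + 1) c) (hc : c ∈ B)
    (hrB : r ∉ B) (hBr : ∀ a ∈ B, G.Adj a r → a = c) : Searchable G (insert r B) (p + 1) := by
  have hcr : c ≠ r := fun e => hrB (e ▸ hc)
  have h1 := Reach.frame (S := insert r B) (X := ∅) (Y := ∅) (q := p + 1)
    (fun x hx => Or.inr hx) (consistent_init _) (by simp) (by simp) (by simp) hB
    (by
      intro u hu _ w hw hwB ha
      rcases hw with rfl | hw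
      · exact absurd (hBr u hu.1 ha) hu.2
      · exact absurd hw hwB)
  simp only [Set.union_empty] at h1
  refine Endable.searchable (r := c) (Or.inr hc) (Relation.ReflTransGen.tail h1
    ⟨⟨.surround r, ?_⟩, ?_⟩)
  · have := PStep.surround (G := G) (S := insert r B) ⟨{c}, B \ {c}⟩ r (by simp)
      (by simpa using hcr.symm) (by simp [hrB]) (by
        intro u hu ha
        rcases hu with rfl | hu
        · exact absurd ha (G.irrefl)
        · exact hBr u hu ha.symm)
    rwa [Set.insert_sdiff_of_notMem _ (by simpa using hcr.symm)]
  · simp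

end Strategies

section LowerBounds

variable {V : Type*} {G : SimpleGraph V}

/-! ### Lower bounds -/

/-- `S` induces a connected subgraph (or is empty): no proper nonempty subset of `S` is closed
under adjacency in `S`. -/
def Conn (G : SimpleGraph V) (S : Set V) : Prop :=
  ∀ X ⊆ S, X.Nonempty → (∀ u ∈ X, ∀ w ∈ S, G.Adj u w → w ∈ X) → X = S

/-- Only occupied nodes separate processed from untouched ones. Without an agent in the connected
set `W`, one processed node of `W` therefore forces all the others. -/
lemma Consistent.all_processed {S W : Set V} {s : PState V} (hs : Consistent G S s) (hWS : W ⊆ S)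
    (hW : Conn G W) (ho : Disjoint s.occ W) {a : V} (ha : a ∈ W) (hp : a ∈ s.processed) :
    W ⊆ s.processed := by
  have := hW (W ∩ s.processed) Set.inter_subset_left ⟨a, ha, hp⟩ (by
    rintro u ⟨hu, hup⟩ w hw hadj
    refine ⟨hw, ?_⟩
    rcases hs.closed u hup w (hWS hw) hadj with h | h
    · exact h
    · exact absurd hw (Set.disjoint_left.1 ho h))
  exact this ▸ Set.inter_subset_right

lemma Conn.union_of_mem {A B : Set V} {x : V} (hA : Conn G A) (hB : Conn G B) (hxA : x ∈ A)
    (hxB : x ∈ B) : Conn G (A ∪ B) := by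
  intro X hX hne hcl
  have key : ∀ C D : Set V, C ∪ D = A ∪ B → Conn G C → Conn G D → x ∈ C → x ∈ D →
      (X ∩ C).Nonempty → X = A ∪ B := by
    intro C D hCD hC hD hxC hxD hXC
    have h1 : X ∩ C = C := hC _ Set.inter_subset_right hXC (fun u hu w hw ha =>
      ⟨hcl u hu.1 w (hCD ▸ Or.inl hw) ha, hw⟩)
    have hxX : x ∈ X := (h1.symm ▸ hxC : x ∈ X ∩ C).1
    have h2 : X ∩ D = D := hD _ Set.inter_subset_right ⟨x, hxX, hxD⟩ (fun u hu w hw ha =>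
      ⟨hcl u hu.1 w (hCD ▸ Or.inr hw) ha, hw⟩)
    refine hX.antisymm ?_
    rw [← hCD]
    rintro u (hu | hu)
    · exact (h1.symm ▸ hu : u ∈ X ∩ C).1
    · exact (h2.symm ▸ hu : u ∈ X ∩ D).1
  obtain ⟨y, hy⟩ := hne
  rcases hX hy with h | h
  · exact key A B rfl hA hB hxA hxB ⟨y, hy, h⟩
  · exact key B A (Set.union_comm _ _) hB hA hxB hxA ⟨y, hy, h⟩

/-- If `q + 1` agents are available and more than `q` of them are in `A`, no agent is left outside
`A`. -/
lemma subset_of_full {A O : Set V} {q : ℕ} (hO : O.encard ≤ (q + 1 : ℕ))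
    (h : ¬ (O ∩ A).encard ≤ q) : O ⊆ A ∧ (O ∩ A).Nonempty := by
  have hne : (O ∩ A).Nonempty := by
    rw [Set.nonempty_iff_ne_empty]; intro e; simp [e] at h
  refine ⟨?_, hne⟩
  have hfin : O.Finite := Set.finite_of_encard_le_coe hO
  have h1 : ((q + 1 : ℕ) : ℕ∞) ≤ (O ∩ A).encard := by
    push Not at h
    push_cast
    exact Order.add_one_le_of_lt h
  have := Set.Finite.eq_of_subset_of_encard_le (hfin.subset Set.inter_subset_left)
    Set.inter_subset_left (hO.trans h1)
  exact Set.inter_eq_left.1 this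

/-- At the time when all agents are in `B`, the sets `A` connected to it and away from it are
completely processed as soon as they have been touched. -/
lemma processed_of_touched {S W : Set V} {p : ℕ} {s t : PState V} (hs : Consistent G S s)
    (hst : Reach G S p s t) (hWS : W ⊆ S) (hW : Conn G W) (ho : Disjoint t.occ W) {a : V}
    (ha : a ∈ W) (h : a ∈ s.occ ∪ s.processed) : W ⊆ t.processed := by
  refine (hs.reach hst).all_processed hWS hW ho ha ?_
  rcases Reach.touched_mono hst h with h | h
  · exact absurd ha (Set.disjoint_left.1 ho h)
  · exact h

/-- A sequence of states, possibly with repetitions, that follows a strategy. -/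
lemma Reach.exists_seq {S : Set V} {p : ℕ} {s e : PState V} (h : Reach G S p s e) :
    ∃ (n : ℕ) (f : ℕ → PState V), f 0 = s ∧ f n = e ∧
      ∀ i, f (i + 1) = f i ∨ Move G S p (f i) (f (i + 1)) := by
  induction h using Relation.ReflTransGen.head_induction_on with
  | refl => exact ⟨0, fun _ => e, rfl, rfl, fun _ => Or.inl rfl⟩
  | @head s t hst _ ih =>
    obtain ⟨n, f, h0, hn, hf⟩ := ih
    refine ⟨n + 1, fun i => Nat.casesOn i s f, rfl, hn, ?_⟩
    rintro (_ | i)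
    · right; simpa [h0] using hst
    · exact hf i

lemma reach_of_seq {S : Set V} {p : ℕ} {f : ℕ → PState V}
    (hf : ∀ i, f (i + 1) = f i ∨ Move G S p (f i) (f (i + 1))) {i j : ℕ} (hij : i ≤ j) :
    Reach G S p (f i) (f j) := by
  induction j, hij using Nat.le_induction with
  | base => exact Relation.ReflTransGen.refl
  | succ j _ ih =>
    rcases hf j with h | h
    · rwa [h]
    · exact Relation.ReflTransGen.tail ih h

/-- If a strategy processes `A` completely and `A` has no `q`-process strategy, then at some time
more than `q` nodes of `A` are occupied. -/
lemma exists_full_of_seq {A S : Set V} (hA : A ⊆ S) {p q n : ℕ} {f : ℕ → PState V}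
    (hf : ∀ i, f (i + 1) = f i ∨ Move G S p (f i) (f (i + 1)))
    (hs : (f 0).restrict A = ⟨∅, ∅⟩) (he : (f n).restrict A = ⟨∅, A⟩)
    (hq : ¬ Searchable G A q) : ∃ i ≤ n, ¬ ((f i).occ ∩ A).encard ≤ q := by
  by_contra hcon
  push Not at hcon
  suffices H : ∀ i ≤ n, Reach G A q ((f 0).restrict A) ((f i).restrict A) by
    have := H n le_rfl
    rw [hs, he] at this
    exact hq this
  intro i
  induction i with
  | zero => intro _; exact Relation.ReflTransGen.refl
  | succ i ih =>
    intro hi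
    have ih := ih (by omega)
    rcases hf i with h | ⟨⟨a, ha⟩, _⟩
    · rwa [h]
    · rcases ha.restrict hA with h | ⟨b, hb⟩
      · rwa [h]
      · exact Relation.ReflTransGen.tail ih ⟨⟨b, hb⟩, hcon _ hi⟩

/-- Three branches without `q`-process strategy force `q + 2` agents. -/
lemma not_searchable_of_three {S A B C : Set V} {q : ℕ} {x : V} (hx : x ∈ S)
    (hAS : A ⊆ S) (hBS : B ⊆ S) (hCS : C ⊆ S)
    (hAB : Disjoint A B) (hAC : Disjoint A C) (hBC : Disjoint B C)
    (hxA : x ∉ A) (hxB : x ∉ B) (hxC : x ∉ C)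
    (cA : Conn G (insert x A)) (cB : Conn G (insert x B)) (cC : Conn G (insert x C))
    (hA : ¬ Searchable G A q) (hB : ¬ Searchable G B q) (hC : ¬ Searchable G C q) :
    ¬ Searchable G S (q + 1) := by
  intro h
  have hi := consistent_init (G := G) S
  obtain ⟨n, f, h0, hn, hf⟩ := Reach.exists_seq h
  have hcons : ∀ i, Consistent G S (f i) := fun i =>
    (h0.symm ▸ hi).reach (reach_of_seq hf (Nat.zero_le i))
  -- For each branch there is a time at which all agents are inside it.
  have full : ∀ A ⊆ S, ¬ Searchable G A q →
      ∃ i, (f i).occ ⊆ A ∧ ((f i).occ ∩ A).Nonempty := by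
    intro A hAS hA
    obtain ⟨i, _, hfull⟩ := exists_full_of_seq hAS hf (n := n) (by simp [h0, PState.restrict])
      (by simp [hn, PState.restrict, Set.inter_eq_self_of_subset_right hAS]) hA
    exact ⟨i, subset_of_full (Reach.encard_le (by simp [h0])
      (reach_of_seq hf (Nat.zero_le i))) hfull⟩
  -- The branch `B` that is full at the middle time leads to a contradiction. At that time the
  -- connected set formed by `x` and the two other branches carries no agent, and it was touched
  -- earlier in `A`, so it is completely processed. Yet an agent is on `C` later.
  have key : ∀ A B C : Set V, A ⊆ S → C ⊆ S → Conn G (insert x A) → Conn G (insert x C) →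
      x ∉ B → Disjoint B A → Disjoint B C → ∀ i j l, i ≤ j → j ≤ l →
      ((f i).occ ∩ A).Nonempty → (f j).occ ⊆ B → ((f l).occ ∩ C).Nonempty → False := by
    intro A B C hA hC cA cC hxB hBA hBC i j l hij hjl ⟨a, ha, haA⟩ hB ⟨c, hc, hcC⟩
    have hd : Disjoint B (insert x A ∪ insert x C) := by
      simp only [Set.disjoint_union_right, Set.disjoint_insert_right]
      exact ⟨⟨hxB, hBA⟩, hxB, hBC⟩
    have := processed_of_touched (hcons i) (reach_of_seq hf hij)
      (Set.union_subset (Set.insert_subset hx hA) (Set.insert_subset hx hC))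
      (cA.union_of_mem cC (Set.mem_insert _ _) (Set.mem_insert _ _)) (hd.mono_left hB)
      (Or.inl (Or.inr haA)) (Or.inl ha)
    exact (hcons l).disj c hc
      (Reach.processed_mono (reach_of_seq hf hjl) (this (Or.inr (Or.inr hcC))))
  obtain ⟨a, ha, ha'⟩ := full A hAS hA
  obtain ⟨b, hb, hb'⟩ := full B hBS hB
  obtain ⟨c, hc, hc'⟩ := full C hCS hC
  have kA := key B A C hBS hCS cB cC hxA hAB hAC
  have kA' := key C A B hCS hBS cC cB hxA hAC hAB
  have kB := key A B C hAS hCS cA cC hxB hAB.symm hBC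
  have kB' := key C B A hCS hAS cC cA hxB hBC hAB.symm
  have kC := key A C B hAS hBS cA cB hxC hAC.symm hBC.symm
  have kC' := key B C A hBS hAS cB cA hxC hBC.symm hAC.symm
  rcases le_total a b with h1 | h1 <;> rcases le_total b c with h2 | h2 <;>
    rcases le_total a c with h3 | h3
  · exact kB a b c h1 h2 ha' hb hc'
  · exact kB a b c h1 h2 ha' hb hc'
  · exact kC a c b h3 h2 ha' hc hb'
  · exact kA' c a b h3 h1 hc' ha hb'
  · exact kA b a c h1 h3 hb' ha hc'
  · exact kC' b c a h2 h3 hb' hc ha'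
  · exact kB' c b a h2 h1 hc' hb ha'
  · exact kB' c b a h2 h1 hc' hb ha'

/-- Two branches without `q`-process strategy force `q + 2` agents in a strategy ending at their
common neighbour. -/
lemma not_endable_of_two {S A B : Set V} {q : ℕ} {r : V} (hr : r ∈ S)
    (hAS : A ⊆ S) (hBS : B ⊆ S) (hAB : Disjoint A B) (hrA : r ∉ A) (hrB : r ∉ B)
    (cA : Conn G (insert r A)) (cB : Conn G (insert r B))
    (hA : ¬ Searchable G A q) (hB : ¬ Searchable G B q) : ¬ Endable G S (q + 1) r := by
  intro h
  have hi := consistent_init (G := G) S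
  obtain ⟨n, f, h0, hn, hf⟩ := Reach.exists_seq h
  have hcons : ∀ i, Consistent G S (f i) := fun i =>
    (h0.symm ▸ hi).reach (reach_of_seq hf (Nat.zero_le i))
  have full : ∀ A ⊆ S, r ∉ A → ¬ Searchable G A q →
      ∃ i ≤ n, (f i).occ ⊆ A ∧ ((f i).occ ∩ A).Nonempty := by
    intro A hAS hrA hA
    obtain ⟨i, hi, hfull⟩ := exists_full_of_seq hAS hf (n := n) (by simp [h0, PState.restrict])
      (by
        simp only [hn, PState.restrict, PState.mk.injEq]
        exact ⟨by simpa using hrA, Set.inter_eq_right.2 fun u hu =>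
          ⟨hAS hu, fun e => hrA (e ▸ hu)⟩⟩) hA
    exact ⟨i, hi, subset_of_full (Reach.encard_le (by simp [h0])
      (reach_of_seq hf (Nat.zero_le i))) hfull⟩
  -- At the later of the two times, `r` and the earlier branch carry no agent and have been touched,
  -- so `r` is already processed. This is incompatible with an agent on `r` at the end.
  have key : ∀ A B : Set V, A ⊆ S → Conn G (insert r A) → r ∉ B → Disjoint B A →
      ∀ i j, i ≤ j → j ≤ n → ((f i).occ ∩ A).Nonempty → (f j).occ ⊆ B → False := by
    intro A B hA cA hxB hBA i j hij hjn ⟨a, ha, haA⟩ hB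
    have hd : Disjoint B (insert r A) := by
      rw [Set.disjoint_insert_right]; exact ⟨hxB, hBA⟩
    have := processed_of_touched (hcons i) (reach_of_seq hf hij) (Set.insert_subset hr hA) cA
      (hd.mono_left hB) (Or.inr haA) (Or.inl ha)
    have h2 := Reach.processed_mono (reach_of_seq hf hjn) (this (Or.inl rfl))
    rw [hn] at h2
    exact h2.2 rfl
  obtain ⟨a, han, ha, ha'⟩ := full A hAS hrA hA
  obtain ⟨b, hbn, hb, hb'⟩ := full B hBS hrB hB
  rcases le_total a b with h | h
  · exact key A B hAS cA hrB hAB.symm a b h hbn ha' hb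
  · exact key B A hBS cB hrA hAB b a h han hb' ha

lemma Reach.preserves {S : Set V} {p : ℕ} {P : PState V → Prop} {s e : PState V}
    (h : Reach G S p s e) (hs : P s) (hc : Consistent G S s) (hp : s.occ.encard ≤ p)
    (hP : ∀ t t' a, Consistent G S t → t.occ.encard ≤ (p : ℕ∞) → t'.occ.encard ≤ (p : ℕ∞) →
      PStep G S t a t' → P t → P t') : P e := by
  induction h with
  | refl => exact hs
  | tail h1 h ih =>
    obtain ⟨⟨a, ha⟩, hq⟩ := h
    exact hP _ _ a (hc.reach h1) (Reach.encard_le hp h1) hq ha ih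

lemma not_searchable_zero {S : Set V} {u w : V} (hu : u ∈ S) (hw : w ∈ S) (ha : G.Adj u w) :
    ¬ Searchable G S 0 := by
  intro h
  have := Reach.preserves (P := fun s => u ∉ s.processed) h (by simp) (consistent_init S)
    (by simp) (by
      intro t t' a hc ht ht' hs hP
      have ht : t.occ = ∅ := by simpa using ht
      have ht' : t'.occ = ∅ := by simpa using ht'
      cases hs with
      | place v => exact hP
      | remove v ho => simp [ht] at ho
      | surround v hS ho hp hn =>
        rintro (rfl | h)
        · have := hn w hw ha
          simp [ht] at this
        · exact hP h)
  exact this hu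

lemma eq_of_mem_of_encard_le_one {O : Set V} (hO : O.encard ≤ (1 : ℕ)) {a b : V} (ha : a ∈ O)
    (hb : b ∈ O) : a = b :=
  Set.encard_le_one_iff.1 (by exact_mod_cast hO) a b ha hb

/-- A path with four nodes has no `1`-process strategy. -/
lemma not_searchable_one_of_path {S : Set V} {a b c d : V} (ha : a ∈ S) (hb : b ∈ S) (hc : c ∈ S)
    (hd : d ∈ S) (hab : G.Adj a b) (hbc : G.Adj b c) (hcd : G.Adj c d) (hac : a ≠ c)
    (hbd : b ≠ d) : ¬ Searchable G S 1 := by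
  intro h
  -- The first of `b` and `c` to be processed would need two agents: for a removal, one on it and
  -- one on the other; for `surround`, one on each of its two neighbours on the path.
  have := Reach.preserves (P := fun s => b ∉ s.processed ∧ c ∉ s.processed) h (by simp)
    (consistent_init S) (by simp) (by
      intro t t' x hcon ht ht' hs hP
      have h1 := fun {x y} => eq_of_mem_of_encard_le_one (a := x) (b := y) ht
      cases hs with
      | place v => exact hP
      | remove v ho hn =>
        constructor
        · rintro (rfl | h)
          · rcases hn c hc hbc with h | h
            · exact hP.2 h
            · exact hbc.ne (h1 ho h)
          · exact hP.1 h
        · rintro (rfl | h)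
          · rcases hn b hb hbc.symm with h | h
            · exact hP.1 h
            · exact hbc.ne (h1 h ho)
          · exact hP.2 h
      | surround v hS ho hp hn =>
        constructor
        · rintro (rfl | h)
          · exact hac (h1 (hn a ha hab.symm) (hn c hc hbc))
          · exact hP.1 h
        · rintro (rfl | h)
          · exact hbd (h1 (hn b hb hbc.symm) (hn d hd hcd))
          · exact hP.2 h)
  exact this.1 hb

/-- A strategy with one agent cannot end at an end node of a path with three nodes. -/
lemma not_endable_one_of_path {S : Set V} {r c d : V} (hr : r ∈ S) (hc : c ∈ S)
    (hd : d ∈ S) (hrc : G.Adj r c) (hcd : G.Adj c d) (hrd : r ≠ d) : ¬ Endable G S 1 r := by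
  intro h
  -- With one agent, `c` can only be processed by a removal, since surrounding it would require
  -- agents on both `r` and `d`. At that removal `r` is not occupied, hence already processed.
  have := Reach.preserves (P := fun s => c ∈ s.processed → r ∈ s.processed) h (by simp)
    (consistent_init S) (by simp) (by
      intro t t' x hcon ht ht' hs hP
      have h1 := fun {x y} => eq_of_mem_of_encard_le_one (a := x) (b := y) ht
      cases hs with
      | place v => exact hP
      | remove v ho hn =>
        rintro (rfl | h)
        · rcases hn r hr hrc.symm with h | h
          · exact Or.inr h
          · exact absurd (h1 h ho) hrc.ne
        · exact Or.inr (hP h)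
      | surround v hS ho hp hn =>
        rintro (rfl | h)
        · exact absurd (h1 (hn r hr hrc.symm) (hn d hd hcd)) hrd
        · exact Or.inr (hP h))
  exact (this ⟨hc, hrc.ne'⟩).2 rfl

end LowerBounds

section Numbers

variable {V : Type*} {G : SimpleGraph V}

/-! ### `pn` and `pnPlus` -/

/-- There is a `p`-process strategy in which `r` is the last node to have an agent. -/
def Finishable (G : SimpleGraph V) (S : Set V) (p : ℕ) (r : V) : Prop :=
  ∃ l, IsStrategy G S p l ∧ FinishesAt l r

lemma Finishable.searchable {S : Set V} {p : ℕ} {r : V} (h : Finishable G S p r) :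
    Searchable G S p := by
  obtain ⟨l, hl, _⟩ := h
  exact searchable_iff.2 ⟨l, hl⟩

lemma PRun.mono {S : Set V} {p q : ℕ} (hpq : p ≤ q) {s s' : PState V} {l : List (Action V)}
    (h : PRun G S p s l s') : PRun G S q s l s' := by
  induction h with
  | nil s => exact PRun.nil s
  | cons s s' s'' a l ha hp hl ih =>
    exact PRun.cons _ _ _ _ _ ha (hp.trans (by exact_mod_cast hpq)) ih

lemma Finishable.mono {S : Set V} {p q : ℕ} (hpq : p ≤ q) {r : V} (h : Finishable G S p r) :
    Finishable G S q r := by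
  obtain ⟨l, hl, hf⟩ := h
  exact ⟨l, PRun.mono hpq hl, hf⟩

lemma Endable.finishable {S : Set V} {p : ℕ} {r : V} (hr : r ∈ S) (h : Endable G S p r) :
    Finishable G S p r := by
  obtain ⟨l, hl⟩ := h.exists_run
  refine ⟨l ++ [.remove r], hl.append (PRun.cons _ ⟨∅, S⟩ _ _ _ ?_ (by simp) (PRun.nil _)), ?_⟩
  · have := PStep.remove (G := G) (S := S) ⟨{r}, S \ {r}⟩ r rfl (fun u hu ha =>
      Or.inl ⟨hu, ha.ne'⟩)
    simpa [Set.insert_sdiff_singleton, Set.insert_eq_of_mem hr] using this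
  · intro v hv
    simpa [Action.vacated, eq_comm] using hv

lemma PRun.occ_subset_of_no_removal {S : Set V} {p : ℕ} {s s' : PState V}
    {l : List (Action V)} (h : PRun G S p s l s') (hl : l.filterMap Action.vacated = []) :
    s.occ ⊆ s'.occ := by
  induction h with
  | nil s => exact subset_rfl
  | cons s s' s'' a l ha hp _ ih =>
    cases ha with
    | place v =>
      exact (Set.subset_insert _ _).trans (ih (by simpa [Action.vacated] using hl))
    | remove v => simp [Action.vacated] at hl
    | surround v => exact ih (by simpa [Action.vacated] using hl)

/-- Without removals and with no agent at the end, no agent is ever present. Every action is then a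
`surround` move without an agent anywhere, and it concerns a node without neighbours. -/
lemma PRun.isolated_of_no_removal {S : Set V} {p : ℕ} {s s' : PState V}
    {l : List (Action V)} (h : PRun G S p s l s') (hl : l.filterMap Action.vacated = [])
    (he : s'.occ = ∅) :
    ∀ u ∈ s'.processed, u ∈ s.processed ∨ (u ∈ S ∧ ∀ w ∈ S, ¬ G.Adj u w) := by
  induction h with
  | nil s => intro u hu; exact Or.inl hu
  | cons s s' s'' a l ha hp hrun ih =>
    cases ha with
    | place v =>
      have := hrun.occ_subset_of_no_removal (by simpa [Action.vacated] using hl)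
        (Set.mem_insert v s.occ)
      simp [he] at this
    | remove v => simp [Action.vacated] at hl
    | surround v hS ho hp' hn =>
      have hl' : l.filterMap Action.vacated = [] := by simpa [Action.vacated] using hl
      have hocc := hrun.occ_subset_of_no_removal hl'
      intro u hu
      rcases ih hl' he u hu with (rfl | h) | h
      · right
        refine ⟨hS, fun w hw ha => ?_⟩
        have := hocc (hn w hw ha)
        simp [he] at this
      · exact Or.inl h
      · exact Or.inr h

lemma Conn.eq_singleton {S : Set V} (hS : Conn G S) {u : V} (hu : u ∈ S)
    (h : ∀ w ∈ S, ¬ G.Adj u w) : S = {u} :=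
  (hS {u} (by simpa using hu) (by simp) (by
    rintro x rfl w hw ha; exact absurd ha (h w hw))).symm

/-- After the last removal only isolated nodes can still be processed. In a connected set with more
than one node there are none, so just before this removal `r` is the only node left. The bound `p +
1` is needed for a single node, which can be processed without agents. -/
lemma Finishable.endable {S : Set V} {p : ℕ} {r : V} (hS : Conn G S) (hr : r ∈ S)
    (h : Finishable G S (p + 1) r) : Endable G S (p + 1) r := by
  obtain ⟨l, hl, hf⟩ := h
  rcases List.eq_nil_or_concat (l.filterMap Action.vacated) with hnil | ⟨xs, x, hx⟩
  · rcases hl.isolated_of_no_removal hnil rfl r hr with h | h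
    · exact absurd h (by simp)
    · have := hS.eq_singleton hr h.2
      subst this
      exact (endable_singleton r).mono (by omega)
  · have hxr : x = r := hf x (by rw [hx]; simp)
    subst hxr
    obtain ⟨l1, l2, rfl, h1, h2⟩ := List.filterMap_eq_append_iff.1 (hx.trans (List.concat_eq_append ..))
    obtain ⟨l3, a, l4, rfl, h3, h4, h5⟩ := List.filterMap_eq_cons_iff.1 h2
    have ha : a = .remove x := by
      cases a <;> simp_all [Action.vacated]
    subst ha
    have e : l1 ++ (l3 ++ Action.remove x :: l4) = (l1 ++ l3) ++ (Action.remove x :: l4) := by simp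
    rw [IsStrategy, e] at hl
    obtain ⟨s, hs1, hs2⟩ := hl.of_append
    have hreach := hs1.reach
    have hc := (consistent_init S).reach hreach
    cases hs2 with
    | cons _ s' _ _ _ hstep hp hrun =>
      cases hstep with
      | remove v ho hn =>
        have hocc : s.occ = {x} := by
          have := hrun.occ_subset_of_no_removal h5
          simp only [Set.subset_empty_iff] at this
          exact (Set.sdiff_eq_empty.1 this).antisymm (by simpa using ho)
        have hproc : s.processed = S \ {x} := by
          refine Set.Subset.antisymm (fun u hu => ⟨hc.processed_sub hu, fun e =>
            hc.disj x ho (e ▸ hu)⟩) ?_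
          rintro u ⟨hu, hux⟩
          rcases hrun.isolated_of_no_removal h5 rfl u hu with (h | h) | h
          · exact absurd h hux
          · exact h
          · have := hS.eq_singleton hu h.2
            rw [this] at hr
            exact absurd hr.symm hux
        have : s = ⟨s.occ, s.processed⟩ := rfl
        rw [hocc, hproc] at this
        rw [this] at hreach
        exact hreach

lemma pn_le {S : Set V} {p : ℕ} (h : Searchable G S p) : pn G S ≤ p :=
  Nat.sInf_le (searchable_iff.1 h)

lemma pn_spec [Finite V] (S : Set V) : Searchable G S (pn G S) := by
  obtain ⟨p, hp⟩ := exists_searchable G S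
  exact searchable_iff.2 (Nat.sInf_mem (s := {p | ∃ l, IsStrategy G S p l})
    ⟨p, searchable_iff.1 hp⟩)

lemma pn_le_iff [Finite V] {S : Set V} {p : ℕ} : pn G S ≤ p ↔ Searchable G S p :=
  ⟨fun h => (pn_spec S).mono h, pn_le⟩

lemma pn_mono [Finite V] {A S : Set V} (hA : A ⊆ S) : pn G A ≤ pn G S :=
  pn_le ((pn_spec S).subset hA)

lemma endable_pn_succ [Finite V] {S : Set V} {r : V} (hr : r ∈ S) :
    Endable G S (pn G S + 1) r :=
  endable_of_searchable_diff hr ((pn_spec S).subset Set.sdiff_subset)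

lemma pnPlus_le {S : Set V} {p : ℕ} {r : V} (h : Finishable G S p r) : pnPlus G S r ≤ p :=
  Nat.sInf_le h

lemma pnPlus_spec [Finite V] {S : Set V} {r : V} (hr : r ∈ S) :
    Finishable G S (pnPlus G S r) r :=
  Nat.sInf_mem (s := {p | ∃ l, IsStrategy G S p l ∧ FinishesAt l r})
    ⟨_, (endable_pn_succ hr).finishable hr⟩

lemma pn_le_pnPlus [Finite V] {S : Set V} {r : V} (hr : r ∈ S) : pn G S ≤ pnPlus G S r :=
  pn_le (pnPlus_spec hr).searchable

lemma pnPlus_le_succ [Finite V] {S : Set V} {r : V} (hr : r ∈ S) :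
    pnPlus G S r ≤ pn G S + 1 := pnPlus_le ((endable_pn_succ hr).finishable hr)

lemma pn_eq_of {S : Set V} [Finite V] {p : ℕ} (h : Searchable G S (p + 1))
    (h' : ¬ Searchable G S p) : pn G S = p + 1 :=
  le_antisymm (pn_le h) (by
    by_contra hcon
    exact h' (pn_le_iff.1 (by omega)))

lemma pnPlus_eq_succ [Finite V] {S : Set V} (hS : Conn G S) {r : V} (hr : r ∈ S) {p : ℕ}
    (hpn : pn G S = p + 1) (h : ¬ Endable G S (p + 1) r) : pnPlus G S r = p + 2 := by
  refine le_antisymm ((pnPlus_le_succ hr).trans (by omega)) ?_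
  by_contra hcon
  exact h (((pnPlus_spec hr).mono (by omega)).endable hS hr)

lemma pnPlus_eq_of_endable [Finite V] {S : Set V} {r : V} (hr : r ∈ S) {p : ℕ}
    (hpn : pn G S = p) (h : Endable G S p r) : pnPlus G S r = p :=
  le_antisymm (pnPlus_le (h.finishable hr)) (hpn ▸ pn_le_pnPlus hr)

lemma stable_of_endable {S : Set V} {r : V} (hr : r ∈ S) (h : Endable G S (pn G S) r) :
    Stable G S r := Or.inl (h.finishable hr)

lemma stable_of_endable_two {S : Set V} {r : V} (hr : r ∈ S) (h : Endable G S 2 r) :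
    Stable G S r := Or.inr (h.finishable hr)

/-- When the process number is at least `2`, the two-agent clause of `Stable` implies the other one,
and one obstruction excludes both. -/
lemma not_stable {S : Set V} (hS : Conn G S) {r : V} (hr : r ∈ S) {p : ℕ}
    (hpn : pn G S = p + 2) (h : ¬ Endable G S (p + 2) r) : ¬ Stable G S r := by
  rintro (h' | h')
  · rw [hpn] at h'
    exact h (Finishable.endable hS hr h')
  · exact h ((Finishable.endable (p := 1) hS hr h').mono (by omega))

lemma finishable_singleton_zero (r : V) : Finishable G {r} 0 r := by
  refine ⟨[.surround r], PRun.cons _ ⟨∅, {r}⟩ _ _ _ ?_ (by simp) (PRun.nil _), ?_⟩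
  · have := PStep.surround (G := G) (S := {r}) ⟨∅, ∅⟩ r rfl (by simp) (by simp)
      (by rintro u rfl ha; exact absurd ha (G.irrefl))
    simpa using this
  · intro v hv
    simp [Action.vacated] at hv

lemma pn_singleton (r : V) : pn G {r} = 0 :=
  Nat.le_zero.1 (pn_le (finishable_singleton_zero r).searchable)

lemma pnPlus_singleton (r : V) : pnPlus G {r} r = 0 :=
  Nat.le_zero.1 (pnPlus_le (finishable_singleton_zero r))

end Numbers

section Rooted

variable {V : Type*} {G : SimpleGraph V} {father : V → Option V} {τ : V → ℕ}

/-! ### Rooted trees -/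

/-- The edges of `G` join the nodes to their fathers, and `τ` increases towards the root. -/
structure Rooted (G : SimpleGraph V) (father : V → Option V) (τ : V → ℕ) : Prop where
  adj_iff : ∀ u v, G.Adj u v ↔ father u = some v ∨ father v = some u
  lt : ∀ u v, father u = some v → τ u < τ v

/-- The descendants of `v`. -/
def Desc (father : V → Option V) (v : V) : Set V :=
  {u | Relation.ReflTransGen (fun a b => father a = some b) u v}

lemma self_mem_desc (v : V) : v ∈ Desc father v := Relation.ReflTransGen.refl

lemma mem_desc_of_father {u w v : V} (h : father u = some w) (hw : w ∈ Desc father v) :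
    u ∈ Desc father v := Relation.ReflTransGen.head h hw

lemma child_mem_desc {c v : V} (h : father c = some v) : c ∈ Desc father v :=
  mem_desc_of_father h (self_mem_desc v)

lemma mem_desc_iff {u v : V} :
    u ∈ Desc father v ↔ u = v ∨ ∃ c, father c = some v ∧ u ∈ Desc father c := by
  constructor
  · intro h
    rcases Relation.ReflTransGen.cases_tail h with h | ⟨c, h1, h2⟩
    · exact Or.inl h.symm
    · exact Or.inr ⟨c, h2, h1⟩
  · rintro (rfl | ⟨c, h1, h2⟩)
    · exact self_mem_desc _
    · exact Relation.ReflTransGen.tail h2 h1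

lemma mem_desc_iff' {u v : V} :
    u ∈ Desc father v ↔ u = v ∨ ∃ f, father u = some f ∧ f ∈ Desc father v := by
  constructor
  · intro h
    rcases Relation.ReflTransGen.cases_head h with h | ⟨c, h1, h2⟩
    · exact Or.inl h
    · exact Or.inr ⟨c, h1, h2⟩
  · rintro (rfl | ⟨c, h1, h2⟩)
    · exact self_mem_desc _
    · exact mem_desc_of_father h1 h2

lemma desc_subset {u v : V} (h : u ∈ Desc father v) : Desc father u ⊆ Desc father v :=
  fun _ hw => Relation.ReflTransGen.trans hw h

lemma desc_subset_of_child {c v : V} (h : father c = some v) : Desc father c ⊆ Desc father v :=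
  desc_subset (child_mem_desc h)

lemma desc_total {u a b : V} (ha : u ∈ Desc father a) (hb : u ∈ Desc father b) :
    a ∈ Desc father b ∨ b ∈ Desc father a :=
  Relation.ReflTransGen.total_of_right_unique
    (fun _ _ _ h h' => Option.some.inj (h.symm.trans h')) ha hb

namespace Rooted

variable (h : Rooted G father τ)
include h

lemma le_of_mem_desc {u v : V} (hu : u ∈ Desc father v) : τ u ≤ τ v := by
  induction hu with
  | refl => exact le_rfl
  | tail _ h1 ih => exact ih.trans (h.lt _ _ h1).le

lemma notMem_desc_child {c v : V} (hc : father c = some v) : v ∉ Desc father c := fun hv =>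
  absurd (h.le_of_mem_desc hv) (not_le.2 (h.lt _ _ hc))

lemma disjoint_desc {c c' v : V} (hc : father c = some v) (hc' : father c' = some v)
    (hne : c ≠ c') : Disjoint (Desc father c) (Desc father c') := by
  have key : ∀ c c', father c = some v → father c' = some v → c ≠ c' → c ∉ Desc father c' := by
    intro c c' hc hc' hne hmem
    rcases mem_desc_iff'.1 hmem with h1 | ⟨f, hf, hf'⟩
    · exact hne h1
    · obtain rfl : v = f := Option.some.inj (hc.symm.trans hf)
      exact h.notMem_desc_child hc' hf'
  rw [Set.disjoint_left]
  intro u hu hu'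
  rcases desc_total hu hu' with h1 | h1
  · exact key c c' hc hc' hne h1
  · exact key c' c hc' hc hne.symm h1

lemma eq_of_mem_desc {u c c' v : V} (hc : father c = some v) (hc' : father c' = some v)
    (hu : u ∈ Desc father c) (hu' : u ∈ Desc father c') : c = c' := by
  by_contra hne
  exact Set.disjoint_left.1 (h.disjoint_desc hc hc' hne) hu hu'

/-- All separation properties of branches come from this single exit edge of a set of descendants.
-/
lemma eq_of_adj_of_notMem {u w c : V} (hu : u ∈ Desc father c) (hw : w ∉ Desc father c)
    (ha : G.Adj u w) : u = c ∧ father c = some w := by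
  rcases (h.adj_iff u w).1 ha with h1 | h1
  · rcases mem_desc_iff'.1 hu with rfl | ⟨f, hf, hf'⟩
    · exact ⟨rfl, h1⟩
    · obtain rfl : w = f := Option.some.inj (h1.symm.trans hf)
      exact absurd hf' hw
  · exact absurd (mem_desc_of_father h1 hu) hw

lemma not_adj_of_children {a b c c' v : V} (hc : father c = some v) (hc' : father c' = some v)
    (hne : c ≠ c') (ha : a ∈ Desc father c) (hb : b ∈ Desc father c') : ¬ G.Adj a b := by
  intro hadj
  have hb' : b ∉ Desc father c := fun hb' =>
    Set.disjoint_left.1 (h.disjoint_desc hc hc' hne) hb' hb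
  obtain ⟨rfl, hf⟩ := h.eq_of_adj_of_notMem ha hb' hadj
  obtain rfl : v = b := Option.some.inj (hc.symm.trans hf)
  exact h.notMem_desc_child hc' hb

lemma subtree_eq (v : V) : subtree G father v = Desc father v := by
  ext u
  constructor
  · rintro ⟨p⟩
    suffices H : ∀ x y : V, (G.deleteEdges {e | ∃ w ∈ father v, e = s(v, w)}).Walk x y →
        x ∈ Desc father v → y ∈ Desc father v from H v u p (self_mem_desc v)
    intro x y p
    induction p with
    | nil => exact id
    | @cons x y z ha _ ih =>
      intro hx
      apply ih
      rw [SimpleGraph.deleteEdges_adj] at ha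
      by_contra hy
      obtain ⟨rfl, hf⟩ := h.eq_of_adj_of_notMem hx hy ha.1
      exact ha.2 ⟨y, hf, rfl⟩
  · intro hu
    refine SimpleGraph.Reachable.symm ?_
    induction hu using Relation.ReflTransGen.head_induction_on with
    | refl => exact SimpleGraph.Reachable.refl _
    | @head a b hab hb ih =>
      refine SimpleGraph.Reachable.trans (SimpleGraph.Adj.reachable ?_) ih
      rw [SimpleGraph.deleteEdges_adj]
      refine ⟨(h.adj_iff a b).2 (Or.inl hab), ?_⟩
      rintro ⟨w, hw, he⟩
      have hbv := h.le_of_mem_desc hb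
      have hlt := h.lt _ _ hab
      have hlt' := h.lt v w hw
      rcases Sym2.eq_iff.1 he with ⟨rfl, rfl⟩ | ⟨rfl, rfl⟩
      · omega
      · omega

end Rooted

/-- `S` is a set of descendants of `v` that contains, with each node but `v`, its father. -/
structure AncClosed (father : V → Option V) (v : V) (S : Set V) : Prop where
  root : v ∈ S
  sub : S ⊆ Desc father v
  closed : ∀ u ∈ S, u ≠ v → ∃ f ∈ S, father u = some f

namespace Rooted

variable (h : Rooted G father τ)
include h

omit h in
lemma _root_.ProcNum.AncClosed.reach {v : V} {S : Set V} (hS : AncClosed father v S)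
    {P : V → Prop} (hP : ∀ u ∈ S, ∀ f ∈ S, father u = some f → (P u ↔ P f)) {u : V}
    (hu : u ∈ S) : P u ↔ P v := by
  have := hS.sub hu
  induction this using Relation.ReflTransGen.head_induction_on with
  | refl => rfl
  | @head a b hab hb ih =>
    by_cases hav : a = v
    · rw [hav]
    · obtain ⟨f, hf, hf'⟩ := hS.closed a hu hav
      obtain rfl : f = b := Option.some.inj (hf'.symm.trans hab)
      exact (hP a hu f hf hab).trans (ih hf)

lemma conn {v : V} {S : Set V} (hS : AncClosed father v S) : Conn G S := by
  intro X hX ⟨x, hx⟩ hcl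
  have key : ∀ u ∈ S, (u ∈ X ↔ v ∈ X) := fun u hu => hS.reach (P := fun u => u ∈ X)
    (fun u hu f hf huf => ⟨fun hu' => hcl u hu' f hf ((h.adj_iff _ _).2 (Or.inl huf)),
      fun hf' => hcl f hf' u hu ((h.adj_iff _ _).2 (Or.inr huf))⟩) hu
  exact hX.antisymm fun u hu => (key u hu).2 ((key x (hX hx)).1 hx)

lemma connected {v : V} {S : Set V} (hS : AncClosed father v S) : (G.induce S).Connected := by
  have key : ∀ u (hu : u ∈ S), (G.induce S).Reachable ⟨u, hu⟩ ⟨v, hS.root⟩ := by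
    intro u hu
    refine ((hS.reach (P := fun u => ∀ hu : u ∈ S, (G.induce S).Reachable ⟨u, hu⟩ ⟨v, hS.root⟩)
      ?_ hu).2 fun _ => SimpleGraph.Reachable.refl _) hu
    intro u hu f hf huf
    have hadj : (G.induce S).Adj ⟨u, hu⟩ ⟨f, hf⟩ := (h.adj_iff _ _).2 (Or.inl huf)
    exact ⟨fun h1 _ => hadj.symm.reachable.trans (h1 hu), fun h1 _ => hadj.reachable.trans (h1 hf)⟩
  have : Nonempty S := ⟨⟨v, hS.root⟩⟩
  exact ⟨fun a b => (key a a.2).trans (key b b.2).symm⟩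

/-! ### Strategies along the children of a node -/

variable [Finite V]

/-- Without `v` the branches at its children are not linked, so they can be processed one after the
other with the same agents. -/
lemma searchable_of_children {S : Set V} {v : V} {p : ℕ} (hS : S ⊆ Desc father v) (hv : v ∉ S)
    (hc : ∀ c, father c = some v → Searchable G (S ∩ Desc father c) p) : Searchable G S p := by
  have e : S = ⋃ c ∈ {c | father c = some v}, S ∩ Desc father c := by
    ext u
    simp only [Set.mem_iUnion, Set.mem_inter_iff, Set.mem_ofPred_eq]
    constructor
    · intro hu
      rcases mem_desc_iff.1 (hS hu) with rfl | ⟨c, hc, huc⟩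
      · exact absurd hu hv
      · exact ⟨c, hc, hu, huc⟩
    · rintro ⟨c, _, hu, _⟩; exact hu
  rw [e]
  refine Searchable.biUnion (Set.toFinite _) hc ?_
  intro c hc c' hc' hne
  exact ⟨(h.disjoint_desc hc hc' hne).mono Set.inter_subset_right Set.inter_subset_right,
    fun a ha b hb => h.not_adj_of_children hc hc' hne ha.2 hb.2⟩

lemma searchable_diff {S : Set V} {v : V} {p : ℕ}
    (hc : ∀ c, father c = some v → Searchable G (S ∩ Desc father c) p)
    (ho : Searchable G (S \ Desc father v) p) : Searchable G (S \ {v}) p := by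
  have e : S \ {v} = ((S ∩ Desc father v) \ {v}) ∪ (S \ Desc father v) := by
    ext u
    by_cases hu : u ∈ Desc father v
    · simp [hu]
    · simp only [Set.mem_sdiff, Set.mem_singleton_iff, Set.mem_union, Set.mem_inter_iff, hu,
        and_false, false_and, not_false_eq_true, and_true, false_or, and_iff_left_iff_imp]
      rintro _ rfl
      exact hu (self_mem_desc u)
  rw [e]
  refine Searchable.union ?_ ho ?_ ?_
  · refine h.searchable_of_children (v := v) (fun u hu => hu.1.2) (by simp) ?_
    intro c hcv
    refine (hc c hcv).subset ?_
    exact fun u hu => ⟨hu.1.1.1, hu.2⟩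
  · rw [Set.disjoint_left]; rintro u hu hu'; exact hu'.2 hu.1.2
  · intro a ha b hb hadj
    exact ha.2 (h.eq_of_adj_of_notMem ha.1.2 hb.2 hadj).1

lemma endable_of_children {S : Set V} {v : V} {p : ℕ} (hv : v ∈ S) (hS : S ⊆ Desc father v)
    (hc : ∀ c, father c = some v → Searchable G (S ∩ Desc father c) p) :
    Endable G S (p + 1) v :=
  endable_of_searchable_diff hv (h.searchable_of_children (v := v)
    (Set.sdiff_subset.trans hS) (by simp) fun c hcv =>
      (hc c hcv).subset (Set.inter_subset_inter_left _ Set.sdiff_subset))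

-- One child is allowed to need as many agents as the whole tree: its branch is processed first and
-- ends at `c`, the agent moves on to `v`, and the remaining branches have one agent fewer at their
-- disposal.
omit [Finite V] in
lemma endable_of_child {S : Set V} {v c : V} {p : ℕ} (hv : v ∈ S) (hc : father c = some v)
    (hcS : c ∈ S) (hE : Endable G (S ∩ Desc father c) (p + 2) c)
    (hD : Searchable G ((S \ Desc father c) \ {v}) (p + 1)) : Endable G S (p + 2) v := by
  have hvc := h.notMem_desc_child hc
  have := Endable.extend (r := v) hE ⟨hcS, self_mem_desc c⟩ hD (fun hv => hvc hv.2) (by simp)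
    (Set.disjoint_left.2 fun u hu hu' => hu'.1.2 hu.2)
    (fun a ha b hb hadj => by
      obtain ⟨_, h2⟩ := h.eq_of_adj_of_notMem ha.2 hb.1.2 hadj
      exact hb.2 (Option.some.inj (h2.symm.trans hc)))
    (fun a ha hadj => (h.eq_of_adj_of_notMem ha.2 hvc hadj).1)
  convert this using 1
  ext u
  by_cases hu : u ∈ Desc father c
  · simp only [Set.mem_insert_iff, Set.mem_union, Set.mem_inter_iff, Set.mem_sdiff, hu, and_true,
      not_true_eq_false, and_false, false_and, or_false]
    refine ⟨Or.inr, ?_⟩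
    rintro (rfl | h1)
    · exact hv
    · exact h1
  · simp only [Set.mem_insert_iff, Set.mem_union, Set.mem_inter_iff, Set.mem_sdiff, hu, and_false,
      not_false_eq_true, and_true, false_or, Set.mem_singleton_iff]
    by_cases huv : u = v
    · simp [huv, hv]
    · simp [huv]

/-- The branch of `c` and everything else outside the branch of `c'` are processed so as to end at
`v`; the strategy for `c'` is joined to this across the edge between `c'` and `v`. `S` may extend
beyond the descendants of `v`, because this is applied to an unstable tree in the middle of a
decomposition. -/
lemma searchable_of_two {S : Set V} {v c c' : V} {p : ℕ} (hv : v ∈ S) (hc : father c = some v)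
    (hc' : father c' = some v) (hne : c ≠ c') (hcS : c ∈ S) (hcS' : c' ∈ S)
    (hE : Endable G (S ∩ Desc father c) (p + 2) c)
    (hE' : Endable G (S ∩ Desc father c') (p + 2) c')
    (hD : ∀ d, father d = some v → d ≠ c → d ≠ c' → Searchable G (S ∩ Desc father d) (p + 1))
    (ho : Searchable G (S \ Desc father v) (p + 1)) : Searchable G S (p + 2) := by
  have hvc := h.notMem_desc_child hc
  have hvc' := h.notMem_desc_child hc'
  have hdis := h.disjoint_desc hc hc' hne
  have hcc' : c ∉ Desc father c' := fun h1 => Set.disjoint_left.1 hdis (self_mem_desc c) h1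
  have e : (S \ Desc father c') ∩ Desc father c = S ∩ Desc father c := by
    ext u
    simp only [Set.mem_inter_iff, Set.mem_sdiff]
    exact ⟨fun hu => ⟨hu.1.1, hu.2⟩, fun hu => ⟨⟨hu.1, Set.disjoint_left.1 hdis hu.2⟩, hu.2⟩⟩
  have h1 : Endable G (S \ Desc father c') (p + 2) v := by
    refine h.endable_of_child ⟨hv, hvc'⟩ hc ⟨hcS, hcc'⟩ (by rwa [e]) ?_
    refine h.searchable_diff ?_ ?_
    swap
    · refine ho.subset ?_
      exact fun u hu => ⟨hu.1.1.1, hu.2⟩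
    intro d hd
    by_cases hdc : d = c
    · subst hdc
      convert searchable_empty (G := G) (p + 1)
      ext u; simp only [Set.mem_inter_iff, Set.mem_sdiff, Set.mem_empty_iff_false]; tauto
    · by_cases hdc' : d = c'
      · subst hdc'
        convert searchable_empty (G := G) (p + 1)
        ext u; simp only [Set.mem_inter_iff, Set.mem_sdiff, Set.mem_empty_iff_false]; tauto
      · refine (hD d hd hdc hdc').subset ?_
        exact fun u hu => ⟨hu.1.1.1, hu.2⟩
  have h2 := Endable.join hE' ⟨hcS', self_mem_desc c'⟩ h1 ⟨hv, hvc'⟩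
    (Set.disjoint_left.2 fun u hu hu' => hu'.2 hu.2)
    (fun a ha b hb hadj => by
      obtain ⟨h1, h2⟩ := h.eq_of_adj_of_notMem ha.2 hb.2 hadj
      exact ⟨h1, Option.some.inj (h2.symm.trans hc')⟩)
  convert h2 using 1
  ext u
  simp only [Set.mem_union, Set.mem_inter_iff, Set.mem_sdiff]
  tauto

/-! ### The process number is logarithmic -/

/-- Only the largest branch may need as many agents as the tree at `v`. The strategy ends at its
root first, and each other branch has at most half as many nodes as the tree, so it needs one agent
fewer. -/
lemma endable_log (v : V) :
    Endable G (Desc father v) (Nat.log 2 (Desc father v).ncard + 2) v := by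
  suffices H : ∀ n v, τ v = n →
      Endable G (Desc father v) (Nat.log 2 (Desc father v).ncard + 2) v from H _ v rfl
  intro n
  induction n using Nat.strong_induction_on with
  | _ n ih =>
  rintro v rfl
  have hsub : ∀ {c}, father c = some v → Desc father v ∩ Desc father c = Desc father c :=
    fun hc => Set.inter_eq_self_of_subset_right (desc_subset_of_child hc)
  have IH : ∀ c, father c = some v →
      Endable G (Desc father c) (Nat.log 2 (Desc father c).ncard + 2) c :=
    fun c hc => ih _ (h.lt _ _ hc) c rfl
  by_cases hne : ∃ c, father c = some v
  · obtain ⟨c, hc, hmax⟩ := (Set.toFinite {c | father c = some v}).exists_maximalFor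
      (fun c => (Desc father c).ncard) _ hne
    have hmax : ∀ d, father d = some v → (Desc father d).ncard ≤ (Desc father c).ncard := by
      intro d hd
      by_contra hcon
      exact hcon (hmax hd (by simp only; omega))
    refine h.endable_of_child (self_mem_desc v) hc (child_mem_desc hc) ?_ ?_
    · rw [hsub hc]
      refine (IH c hc).mono ?_
      have := Nat.log_mono_right (b := 2) (Set.ncard_le_ncard (desc_subset_of_child hc)
        (Set.toFinite _))
      omega
    · refine h.searchable_of_children (v := v) (fun u hu => hu.1.1) (by simp) ?_
      intro d hd
      by_cases hdc : d = c
      · subst hdc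
        convert searchable_empty (G := G) _
        ext u; simp only [Set.mem_inter_iff, Set.mem_sdiff, Set.mem_empty_iff_false]; tauto
      · have h1 : (Desc father d).ncard + (Desc father c).ncard ≤ (Desc father v).ncard := by
          rw [← Set.ncard_union_eq (h.disjoint_desc hd hc hdc) (Set.toFinite _) (Set.toFinite _)]
          exact Set.ncard_le_ncard (Set.union_subset (desc_subset_of_child hd)
            (desc_subset_of_child hc)) (Set.toFinite _)
        have h2 := hmax d hd
        have h3 : 0 < (Desc father d).ncard :=
          (Set.ncard_pos (Set.toFinite _)).2 ⟨d, self_mem_desc d⟩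
        -- The branches of `d` and `c` are disjoint and that of `c` is at least as large, so
        -- doubling the branch of `d` does not exceed the tree at `v`.
        have h4 : Nat.log 2 (Desc father d).ncard + 1 ≤ Nat.log 2 (Desc father v).ncard := by
          rw [← Nat.log_mul_base (by norm_num) h3.ne']
          exact Nat.log_mono_right (by omega)
        exact (((IH d hd).searchable (self_mem_desc d)).mono (by omega)).subset
          Set.inter_subset_right
  · push Not at hne
    exact (h.endable_of_children (p := 0) (self_mem_desc v) subset_rfl
      (fun c hc => absurd hc (hne c))).mono (by omega)

lemma pn_le_log {v : V} {A : Set V} (hA : A ⊆ Desc father v) :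
    pn G A ≤ Nat.log 2 (Nat.card V) + 2 := by
  refine (pn_mono hA).trans ((pn_le ((h.endable_log v).searchable (self_mem_desc v))).trans ?_)
  have := Nat.log_mono_right (b := 2) (Set.ncard_le_card (Desc father v))
  omega

end Rooted

/-! ### The associated-trees -/

section Assoc

variable (father) (m : V → ℕ) (unst : V → Prop)

/-- `InRoots v w`: `w` is the root of an associated-tree of the decomposition at `v`. Here `m w` is
the process number of the associated-tree of `w` and `unst w` tells that it is unstable. -/
inductive InRoots : V → V → Prop
  | self (v : V) : InRoots v v
  | up {v c w : V} (hc : father c = some v) (hw : InRoots c w) (hu : unst w) (hm : m v < m w) :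
      InRoots v w

/-- `InAssoc v u`: the associated-tree of `v` contains `u`. -/
inductive InAssoc : V → V → Prop
  | self (v : V) : InAssoc v v
  | up {v c x u : V} (hc : father c = some v) (hx : InRoots father m unst c x)
      (hm : unst x → m x ≤ m v) (hu : InAssoc x u) : InAssoc v u

/-- The roots of the associated-trees of the decomposition at `v`. -/
def roots (v : V) : Set V := {w | InRoots father m unst v w}

/-- The associated-tree of `v`. -/
def assoc (v : V) : Set V := {u | InAssoc father m unst v u}

/-- The part of the decomposition at `c` that consists of the stable associated-tree and the
unstable ones of process number at most `i`. -/
def lower (c : V) (i : ℕ) : Set V :=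
  {u | ∃ x ∈ roots father m unst c, (unst x → m x ≤ i) ∧ u ∈ assoc father m unst x}

/-- `v` and the lower parts of the decompositions at its children. -/
def joined (v : V) (i : ℕ) : Set V :=
  {u | u = v ∨ ∃ c, father c = some v ∧ u ∈ lower father m unst c i}

end Assoc

variable {m : V → ℕ} {unst : V → Prop}

lemma mem_roots_iff {v w : V} : w ∈ roots father m unst v ↔
    w = v ∨ ∃ c, father c = some v ∧ w ∈ roots father m unst c ∧ unst w ∧ m v < m w := by
  constructor
  · rintro (_ | ⟨hc, hw, hu, hm⟩)
    · exact Or.inl rfl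
    · exact Or.inr ⟨_, hc, hw, hu, hm⟩
  · rintro (rfl | ⟨c, hc, hw, hu, hm⟩)
    · exact InRoots.self _
    · exact InRoots.up hc hw hu hm

lemma assoc_eq_joined (v : V) : assoc father m unst v = joined father m unst v (m v) := by
  ext u
  constructor
  · rintro (_ | ⟨hc, hx, hm, hu⟩)
    · exact Or.inl rfl
    · exact Or.inr ⟨_, hc, _, hx, hm, hu⟩
  · rintro (rfl | ⟨c, hc, x, hx, hm, hu⟩)
    · exact InAssoc.self _
    · exact InAssoc.up hc hx hm hu

lemma mem_roots_self (v : V) : v ∈ roots father m unst v := InRoots.self v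

lemma mem_assoc_self (v : V) : v ∈ assoc father m unst v := InAssoc.self v

lemma unst_of_mem_roots {v w : V} (hw : w ∈ roots father m unst v) (hne : w ≠ v) :
    unst w ∧ m v < m w := by
  rcases mem_roots_iff.1 hw with h | ⟨_, _, _, h1, h2⟩
  · exact absurd h hne
  · exact ⟨h1, h2⟩

lemma roots_subset_desc (v : V) : roots father m unst v ⊆ Desc father v := by
  intro w hw
  induction hw with
  | self v => exact self_mem_desc v
  | up hc _ _ _ ih => exact desc_subset_of_child hc ih

lemma assoc_subset_desc (v : V) : assoc father m unst v ⊆ Desc father v := by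
  intro w hw
  induction hw with
  | self v => exact self_mem_desc v
  | up hc hx _ _ ih =>
    exact desc_subset_of_child hc (desc_subset (roots_subset_desc _ hx) ih)

lemma lower_subset_desc (c : V) (i : ℕ) : lower father m unst c i ⊆ Desc father c := by
  rintro u ⟨x, hx, _, hu⟩
  exact desc_subset (roots_subset_desc _ hx) (assoc_subset_desc _ hu)

lemma joined_subset_desc (v : V) (i : ℕ) : joined father m unst v i ⊆ Desc father v := by
  rintro u (rfl | ⟨c, hc, hu⟩)
  · exact self_mem_desc _
  · exact desc_subset_of_child hc (lower_subset_desc _ _ hu)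

lemma lower_mono {c : V} {i j : ℕ} (hij : i ≤ j) :
    lower father m unst c i ⊆ lower father m unst c j := by
  rintro u ⟨x, hx, hm, hu⟩
  exact ⟨x, hx, fun h => (hm h).trans hij, hu⟩

lemma joined_mono {v : V} {i j : ℕ} (hij : i ≤ j) :
    joined father m unst v i ⊆ joined father m unst v j := by
  rintro u (rfl | ⟨c, hc, hu⟩)
  · exact Or.inl rfl
  · exact Or.inr ⟨c, hc, lower_mono hij hu⟩

lemma assoc_subset_lower {c x : V} {i : ℕ} (hx : x ∈ roots father m unst c)
    (hm : unst x → m x ≤ i) : assoc father m unst x ⊆ lower father m unst c i :=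
  fun _ hu => ⟨x, hx, hm, hu⟩

lemma assoc_subset_joined {v c x : V} {i : ℕ} (hc : father c = some v)
    (hx : x ∈ roots father m unst c) (hm : unst x → m x ≤ i) :
    assoc father m unst x ⊆ joined father m unst v i :=
  fun _ hu => Or.inr ⟨c, hc, x, hx, hm, hu⟩

lemma lower_eq_of_forall {c : V} {i j : ℕ} (hij : i ≤ j)
    (hno : ∀ x ∈ roots father m unst c, unst x → m x ≤ j → m x ≤ i) :
    lower father m unst c j = lower father m unst c i := by
  refine Set.Subset.antisymm ?_ (lower_mono hij)
  rintro u ⟨x, hx, hm, hu⟩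
  exact ⟨x, hx, fun h => hno x hx h (hm h), hu⟩

/-- A stable associated-tree is the lower part of the decomposition up to its level. -/
lemma lower_eq_assoc {c : V} {i : ℕ} (hc : ¬ unst c) (hi : i ≤ m c) :
    lower father m unst c i = assoc father m unst c := by
  refine Set.Subset.antisymm ?_ (assoc_subset_lower (mem_roots_self c) fun h => absurd h hc)
  rintro u ⟨x, hx, hm, hu⟩
  by_cases hxc : x = c
  · exact hxc ▸ hu
  · obtain ⟨h1, h2⟩ := unst_of_mem_roots hx hxc
    exact absurd (hm h1) (by omega)

lemma lower_eq_empty {c : V} {i : ℕ} (hc : unst c) (hi : i < m c) :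
    lower father m unst c i = ∅ := by
  rw [Set.eq_empty_iff_forall_notMem]
  rintro u ⟨x, hx, hm, hu⟩
  by_cases hxc : x = c
  · subst hxc; exact absurd (hm hc) (by omega)
  · obtain ⟨h1, h2⟩ := unst_of_mem_roots hx hxc
    exact absurd (hm h1) (by omega)

/-- Each associated-tree of a child's decomposition is either absorbed by the tree of `v` or kept;
the conditions in `InAssoc` and `InRoots` are complementary. -/
lemma iUnion_assoc_eq_desc (v : V) :
    ⋃ w ∈ roots father m unst v, assoc father m unst w = Desc father v := by
  refine Set.Subset.antisymm (Set.iUnion₂_subset fun w hw =>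
    (assoc_subset_desc w).trans (desc_subset (roots_subset_desc v hw))) ?_
  intro u hu
  induction hu with
  | refl => exact Set.mem_biUnion (mem_roots_self _) (mem_assoc_self _)
  | @tail c v hc hcv ih =>
    obtain ⟨x, hx, hux⟩ := Set.mem_iUnion₂.1 ih
    by_cases hm : unst x ∧ m v < m x
    · exact Set.mem_biUnion (InRoots.up hcv hx hm.1 hm.2) hux
    · exact Set.mem_biUnion (mem_roots_self v)
        (InAssoc.up hcv hx (fun h1 => by by_contra h2; exact hm ⟨h1, by omega⟩) hux)

lemma exists_root_of_mem_desc {u v : V} (hu : u ∈ Desc father v) :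
    ∃ x ∈ roots father m unst v, u ∈ assoc father m unst x := by
  rw [← iUnion_assoc_eq_desc (m := m) (unst := unst)] at hu
  simpa using hu

namespace Rooted

variable (h : Rooted G father τ)
include h

lemma eq_of_mem_assoc {v w w' u : V} (hw : w ∈ roots father m unst v)
    (hw' : w' ∈ roots father m unst v) (hu : u ∈ assoc father m unst w)
    (hu' : u ∈ assoc father m unst w') : w = w' := by
  suffices H : ∀ n v, τ v = n → ∀ w ∈ roots father m unst v, ∀ w' ∈ roots father m unst v,
      ∀ u ∈ assoc father m unst w, u ∈ assoc father m unst w' → w = w' from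
    H _ v rfl w hw w' hw' u hu hu'
  intro n
  induction n using Nat.strong_induction_on with
  | _ n ih =>
  rintro v rfl
  have key : ∀ c w u, father c = some v → w ∈ roots father m unst c → unst w → m v < m w →
      u ∈ assoc father m unst v → u ∈ assoc father m unst w → False := by
    intro c w u hc hw hunst hm hu hu'
    have huc : u ∈ Desc father c := desc_subset (roots_subset_desc _ hw) (assoc_subset_desc _ hu')
    rw [assoc_eq_joined] at hu
    rcases hu with rfl | ⟨c', hc', x, hx, hmx, hux⟩
    · exact h.notMem_desc_child hc huc
    · obtain rfl := h.eq_of_mem_desc hc hc' huc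
        (desc_subset (roots_subset_desc _ hx) (assoc_subset_desc _ hux))
      obtain rfl := ih _ (h.lt _ _ hc) c rfl w hw x hx u hu' hux
      exact absurd (hmx hunst) (by omega)
  intro w hw w' hw' u hu hu'
  rcases mem_roots_iff.1 hw with rfl | ⟨c, hc, hwc, hun, hm⟩
  · rcases mem_roots_iff.1 hw' with rfl | ⟨c, hc, hwc, hun, hm⟩
    · rfl
    · exact (key c w' u hc hwc hun hm hu hu').elim
  · rcases mem_roots_iff.1 hw' with rfl | ⟨c', hc', hwc', _, _⟩
    · exact (key c w u hc hwc hun hm hu' hu).elim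
    · obtain rfl := h.eq_of_mem_desc hc hc'
        (desc_subset (roots_subset_desc _ hwc) (assoc_subset_desc _ hu))
        (desc_subset (roots_subset_desc _ hwc') (assoc_subset_desc _ hu'))
      exact ih _ (h.lt _ _ hc) c rfl w hwc w' hwc' u hu hu'

/-- A tree is kept at `v` only if it is unstable and its level exceeds that of `v`. This settles the
case `x = v`; the other cases take place inside the decomposition of one child. -/
lemma increasing {v x w f : V} (hx : x ∈ roots father m unst v) (hw : w ∈ roots father m unst v)
    (hf : father w = some f) (hfx : f ∈ assoc father m unst x) : unst w ∧ m x < m w := by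
  suffices H : ∀ n v, τ v = n → ∀ x ∈ roots father m unst v, ∀ w ∈ roots father m unst v,
      ∀ f, father w = some f → f ∈ assoc father m unst x → unst w ∧ m x < m w from
    H _ v rfl x hx w hw f hf hfx
  intro n
  induction n using Nat.strong_induction_on with
  | _ n ih =>
  rintro v rfl x hx w hw f hf hfx
  rcases mem_roots_iff.1 hw with rfl | ⟨c, hc, hwc, hun, hm⟩
  · have h1 := h.le_of_mem_desc (desc_subset (roots_subset_desc _ hx) (assoc_subset_desc _ hfx))
    have h2 := h.lt _ _ hf
    omega
  · rcases mem_roots_iff.1 hx with rfl | ⟨c', hc', hxc, _, _⟩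
    · exact ⟨hun, hm⟩
    · have hfc' : f ∈ Desc father c' :=
        desc_subset (roots_subset_desc _ hxc) (assoc_subset_desc _ hfx)
      rcases mem_desc_iff'.1 (roots_subset_desc _ hwc) with rfl | ⟨f', hf1, hf2⟩
      · obtain rfl : v = f := Option.some.inj (hc.symm.trans hf)
        exact absurd hfc' (h.notMem_desc_child hc')
      · obtain rfl : f' = f := Option.some.inj (hf1.symm.trans hf)
        obtain rfl := h.eq_of_mem_desc hc hc' hf2 hfc'
        exact ih _ (h.lt _ _ hc) c rfl x hxc w hwc f' hf hfx

/-- By `increasing`, the father of the root of an associated-tree lies in a tree of smaller level,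
so cutting a decomposition at a level loses no fathers. The hypothesis `ih` is limited to earlier
nodes because the lemma serves in the induction that proves `assoc_ancClosed`. -/
lemma lower_closed_of {c u : V} {i : ℕ}
    (ih : ∀ x, τ x ≤ τ c → AncClosed father x (assoc father m unst x))
    (hu : u ∈ lower father m unst c i) (hne : u ≠ c) :
    ∃ f ∈ lower father m unst c i, father u = some f := by
  obtain ⟨x, hx, hm, hux⟩ := hu
  by_cases hux' : u = x
  · subst hux'
    obtain ⟨hun, _⟩ := unst_of_mem_roots hx hne
    rcases mem_desc_iff'.1 (roots_subset_desc _ hx) with h1 | ⟨f, hf, hfc⟩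
    · exact absurd h1 hne
    · obtain ⟨y, hy, hfy⟩ := exists_root_of_mem_desc (m := m) (unst := unst) hfc
      have := (h.increasing hy hx hf hfy).2
      exact ⟨f, ⟨y, hy, fun _ => this.le.trans (hm hun), hfy⟩, hf⟩
  · obtain ⟨f, hf, hf'⟩ := (ih x (h.le_of_mem_desc (roots_subset_desc _ hx))).closed u hux hux'
    exact ⟨f, ⟨x, hx, hm, hf⟩, hf'⟩

omit h in
lemma root_mem_lower {c u : V} {i : ℕ} (hu : u ∈ lower father m unst c i) :
    c ∈ lower father m unst c i := by
  by_cases hc : unst c ∧ i < m c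
  · rw [lower_eq_empty hc.1 hc.2] at hu
    exact absurd hu (Set.notMem_empty u)
  · exact ⟨c, mem_roots_self c, fun h1 => by by_contra h2; exact hc ⟨h1, by omega⟩,
      mem_assoc_self c⟩

lemma joined_ancClosed_of {v : V} {i : ℕ}
    (ih : ∀ x, τ x < τ v → AncClosed father x (assoc father m unst x)) :
    AncClosed father v (joined father m unst v i) where
  root := Or.inl rfl
  sub := joined_subset_desc v i
  closed := by
    rintro u (rfl | ⟨c, hc, hu⟩) hne
    · exact absurd rfl hne
    · by_cases huc : u = c
      · subst huc; exact ⟨v, Or.inl rfl, hc⟩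
      · obtain ⟨f, hf, hf'⟩ := h.lower_closed_of
          (fun x hx => ih x (hx.trans_lt (h.lt _ _ hc))) hu huc
        exact ⟨f, Or.inr ⟨c, hc, hf⟩, hf'⟩

lemma assoc_ancClosed (v : V) : AncClosed father v (assoc father m unst v) := by
  suffices H : ∀ n v, τ v = n → AncClosed father v (assoc father m unst v) from H _ v rfl
  intro n
  induction n using Nat.strong_induction_on with
  | _ n ih =>
  rintro v rfl
  rw [assoc_eq_joined]
  exact h.joined_ancClosed_of fun x hx => ih _ hx x rfl

lemma joined_ancClosed (v : V) (i : ℕ) : AncClosed father v (joined father m unst v i) :=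
  h.joined_ancClosed_of fun x _ => h.assoc_ancClosed x

lemma lower_ancClosed {c u : V} {i : ℕ} (hu : u ∈ lower father m unst c i) :
    AncClosed father c (lower father m unst c i) where
  root := root_mem_lower hu
  sub := lower_subset_desc c i
  closed := fun _ hw hne => h.lower_closed_of (fun x _ => h.assoc_ancClosed x) hw hne

lemma joined_inter_desc {v c : V} (hc : father c = some v) (i : ℕ) :
    joined father m unst v i ∩ Desc father c = lower father m unst c i := by
  ext u
  constructor
  · rintro ⟨rfl | ⟨c', hc', hu⟩, huc⟩
    · exact absurd huc (h.notMem_desc_child hc)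
    · obtain rfl := h.eq_of_mem_desc hc hc' huc (lower_subset_desc _ _ hu)
      exact hu
  · intro hu
    exact ⟨Or.inr ⟨c, hc, hu⟩, lower_subset_desc _ _ hu⟩

end Rooted

end Rooted

/-! ### Tables and their operations -/

@[simp] lemma Timed.bind_val {α β : Type} (x : Timed α) (f : α → Timed β) :
    (x >>= f).val = (f x.val).val := rfl

@[simp] lemma Timed.bind_ops {α β : Type} (x : Timed α) (f : α → Timed β) :
    (x >>= f).ops = x.ops + (f x.val).ops := rfl

@[simp] lemma Timed.pure_val {α : Type} (a : α) : (pure a : Timed α).val = a := rfl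

@[simp] lemma Timed.pure_ops {α : Type} (a : α) : (pure a : Timed α).ops = 0 := rfl

@[simp] lemma op_val {α : Type} (a : α) : (op a).val = a := rfl

@[simp] lemma op_ops {α : Type} (a : α) : (op a).ops = 1 := rfl

@[simp] lemma cell_zero (t : List ℕ) : cell t 0 = 0 := rfl

lemma cell_of_length_lt {t : List ℕ} {i : ℕ} (h : t.length < i) : cell t i = 0 := by
  unfold cell
  split_ifs
  · rfl
  · rw [List.getD_eq_default _ _ (by omega)]

lemma cell_set {t : List ℕ} {i x : ℕ} (hi : 1 ≤ i) (j : ℕ) :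
    cell (t.set (i - 1) x) j = if j = i ∧ i ≤ t.length then x else cell t j := by
  unfold cell
  by_cases hj : j = 0
  · subst hj; simp; omega
  · simp only [hj, if_false, List.getD_eq_getElem?_getD, List.getElem?_set]
    by_cases hji : j = i
    · subst hji
      by_cases hl : j ≤ t.length
      · simp [hl, show j - 1 < t.length by omega]
      · simp [hl, show ¬ (j - 1 < t.length) by omega]
    · simp [hji, show i - 1 ≠ j - 1 by omega]

lemma cell_append_zero (t : List ℕ) (i : ℕ) : cell (t ++ [0]) i = cell t i := by
  unfold cell
  by_cases hi : i = 0
  · simp [hi]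
  · simp only [hi, if_false, List.getD_eq_getElem?_getD, List.getElem?_append]
    split_ifs with h
    · rfl
    · rw [List.getElem?_eq_none (l := t) (by omega)]
      rcases Nat.eq_zero_or_pos (i - 1 - t.length) with h0 | h0
      · simp [h0]
      · rw [List.getElem?_eq_none (by simp; omega)]

lemma extendBy_spec (k : ℕ) : ∀ t : List ℕ, (extendBy t k).val.length = t.length + k ∧
    (∀ i, cell (extendBy t k).val i = cell t i) ∧ (extendBy t k).ops = k := by
  induction k with
  | zero => intro t; simp [extendBy]
  | succ k ih =>
    intro t
    obtain ⟨h1, h2, h3⟩ := ih (t ++ [0])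
    refine ⟨?_, ?_, ?_⟩
    · simp [extendBy, h1]; omega
    · intro i; simp [extendBy, h2, cell_append_zero]
    · simp [extendBy, h3]; omega

lemma extendTo_spec (t : List ℕ) (L : ℕ) : (extendTo t L).val.length = max t.length L ∧
    (∀ i, cell (extendTo t L).val i = cell t i) ∧ (extendTo t L).ops = 1 + (L - t.length) := by
  obtain ⟨h1, h2, h3⟩ := extendBy_spec (L - t.length) t
  refine ⟨?_, ?_, ?_⟩
  · simp [extendTo, h1]; omega
  · intro i; simp [extendTo, h2]
  · simp [extendTo, h3]

lemma clear_spec (m : ℕ) : ∀ t : List ℕ, (clear t m).val.length = t.length ∧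
    (∀ i, cell (clear t m).val i = if i ≤ m then 0 else cell t i) ∧ (clear t m).ops = m := by
  induction m with
  | zero =>
    intro t
    refine ⟨by simp [clear], ?_, by simp [clear]⟩
    intro i
    by_cases hi : i = 0
    · simp [clear, hi]
    · simp [clear, hi]
  | succ m ih =>
    intro t
    obtain ⟨h1, h2, h3⟩ := ih (t.set m 0)
    refine ⟨by simp [clear, write, h1], ?_, by simp [clear, write, h3]; omega⟩
    intro i
    have := cell_set (t := t) (x := 0) (Nat.le_add_left 1 m) i
    simp only [Nat.add_sub_cancel] at this
    simp only [clear, write, Timed.bind_val, op_val, Nat.add_sub_cancel, h2, this]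
    by_cases hi : i ≤ m
    · simp [hi, show i ≤ m + 1 by omega]
    · by_cases hi' : i = m + 1
      · subst hi'
        by_cases hl : m + 1 ≤ t.length
        · simp [hl]
        · simp [cell_of_length_lt (t := t) (i := m + 1) (by omega)]
      · simp [hi, hi', show ¬ (i ≤ m + 1) by omega]

lemma addCells_spec (u : List ℕ) (k : ℕ) : ∀ t : List ℕ, k ≤ t.length →
    (addCells u t k).val.length = t.length ∧
    (∀ i, cell (addCells u t k).val i = if i ≤ k then cell t i + cell u i else cell t i) ∧
    (addCells u t k).ops = 4 * k := by
  induction k with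
  | zero =>
    intro t _
    refine ⟨by simp [addCells], ?_, by simp [addCells]⟩
    intro i
    by_cases hi : i = 0
    · simp [addCells, hi]
    · simp [addCells, hi]
  | succ k ih =>
    intro t hk
    obtain ⟨h1, h2, h3⟩ := ih (t.set k (cell t (k + 1) + cell u (k + 1))) (by simp; omega)
    refine ⟨by simp [addCells, write, h1], ?_, by simp [addCells, write, h3]; omega⟩
    intro i
    have := cell_set (t := t) (x := cell t (k + 1) + cell u (k + 1)) (Nat.le_add_left 1 k) i
    simp only [Nat.add_sub_cancel] at this
    simp only [addCells, write, Timed.bind_val, op_val, Nat.add_sub_cancel, h2, this]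
    by_cases hi : i ≤ k
    · simp [hi, show i ≤ k + 1 by omega, show i ≠ k + 1 by omega]
    · by_cases hi' : i = k + 1
      · subst hi'; simp [hk]
      · simp [hi, hi', show ¬ (i ≤ k + 1) by omega]

lemma lastBig_spec (t : List ℕ) (i : ℕ) :
    (∀ k, (lastBig t i).val = some k →
      k ≤ i ∧ 1 < cell t k ∧ ∀ j, k < j → j ≤ i → cell t j ≤ 1) ∧
    ((lastBig t i).val = none → ∀ j ≤ i, cell t j ≤ 1) ∧ (lastBig t i).ops ≤ 2 * i := by
  induction i with
  | zero => simp [lastBig]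
  | succ i ih =>
    obtain ⟨h1, h2, h3⟩ := ih
    by_cases hc : 1 < cell t (i + 1)
    · simp only [lastBig, Timed.bind_val, op_val, hc, decide_true, if_true, Timed.pure_val,
        Option.some.injEq, Timed.bind_ops, op_ops, Timed.pure_ops]
      refine ⟨?_, by simp, by omega⟩
      rintro k rfl
      exact ⟨le_rfl, hc, fun j hj hj' => by omega⟩
    · simp only [lastBig, Timed.bind_val, op_val, hc, decide_false, Bool.false_eq_true, if_false,
        Timed.bind_ops, op_ops]
      refine ⟨?_, ?_, by omega⟩
      · intro k hk
        obtain ⟨a, b, c⟩ := h1 k hk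
        refine ⟨by omega, b, fun j hj hj' => ?_⟩
        by_cases hji : j = i + 1
        · subst hji; omega
        · exact c j hj (by omega)
      · intro hn j hj
        by_cases hji : j = i + 1
        · subst hji; omega
        · exact h2 hn j (by omega)

lemma firstZero_spec (t : List ℕ) (fuel : ℕ) : ∀ i, i ≤ (firstZero t fuel i).val ∧
    (firstZero t fuel i).val ≤ i + fuel ∧
    (∀ j, i ≤ j → j < (firstZero t fuel i).val → cell t j ≠ 0) ∧
    ((firstZero t fuel i).val < i + fuel → cell t (firstZero t fuel i).val = 0) ∧
    (firstZero t fuel i).ops ≤ 2 * fuel := by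
  induction fuel with
  | zero => intro i; simp [firstZero]; omega
  | succ fuel ih =>
    intro i
    obtain ⟨h1, h2, h3, h4, h5⟩ := ih (i + 1)
    by_cases hc : cell t i = 0
    · simp only [firstZero, Timed.bind_val, op_val, hc, decide_true, if_true, Timed.pure_val,
        Timed.bind_ops, op_ops, Timed.pure_ops]
      exact ⟨le_rfl, by omega, fun j hj hj' => by omega, fun _ => trivial, by omega⟩
    · simp only [firstZero, Timed.bind_val, op_val, hc, decide_false, Bool.false_eq_true, if_false,
        Timed.bind_ops, op_ops]
      refine ⟨by omega, by omega, ?_, fun h => h4 (by omega), by omega⟩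
      intro j hj hj'
      by_cases hji : j = i
      · subst hji; exact hc
      · exact h3 j (by omega) hj'

/-- The sum of the cells `i` of the received tables. -/
def tsum (msgs : List HD) (i : ℕ) : ℕ := (msgs.map fun h => cell h.table i).sum

/-- The greatest length of the received tables. -/
def tlen (msgs : List HD) : ℕ := (msgs.map fun h => h.table.length).foldr max 0

/-- The number of received vectors with first entry `a`. -/
def cnt (msgs : List HD) (a : ℤ) : ℕ := msgs.countP fun h => h.vect.1 = a

/-- The received vectors different from `(-1, -1)`. -/
def active (msgs : List HD) : List Vect :=
  (msgs.map HD.vect).filter fun y => decide (y ≠ (-1, -1))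

lemma le_tlen {msgs : List HD} {h : HD} (hh : h ∈ msgs) : h.table.length ≤ tlen msgs := by
  induction msgs with
  | nil => simp at hh
  | cons g l ih =>
    rcases List.mem_cons.1 hh with rfl | hh
    · simp [tlen]
    · exact (ih hh).trans (by simp [tlen])

lemma tlen_le {msgs : List HD} {L : ℕ} (hL : ∀ h ∈ msgs, h.table.length ≤ L) : tlen msgs ≤ L := by
  induction msgs with
  | nil => simp [tlen]
  | cons g l ih =>
    have h1 := ih fun h hh => hL h (List.mem_cons_of_mem _ hh)
    have h2 := hL g (by simp)
    simp only [tlen, List.map_cons, List.foldr_cons]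
    exact max_le h2 h1

lemma sumTables_spec (msgs : List HD) : (sumTables msgs).val.length = tlen msgs ∧
    (∀ i, cell (sumTables msgs).val i = tsum msgs i) ∧
    ∀ L, (∀ h ∈ msgs, h.table.length ≤ L) →
      (sumTables msgs).ops ≤ 1 + msgs.length * (1 + 5 * L) := by
  induction msgs with
  | nil =>
    refine ⟨by simp [sumTables, tlen], fun i => ?_, by simp [sumTables]⟩
    unfold cell; simp [sumTables, tsum]
  | cons h l ih =>
    obtain ⟨h1, h2, h3⟩ := ih
    obtain ⟨e1, e2, e3⟩ := extendTo_spec (sumTables l).val h.table.length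
    obtain ⟨a1, a2, a3⟩ := addCells_spec h.table h.table.length
      (extendTo (sumTables l).val h.table.length).val (by rw [e1]; exact le_max_right _ _)
    refine ⟨?_, ?_, ?_⟩
    · simp only [sumTables, Timed.bind_val, a1, e1, h1, tlen, List.map_cons, List.foldr_cons]
      rw [max_comm]
    · intro i
      simp only [sumTables, Timed.bind_val, a2, e2, h2, tsum, List.map_cons, List.sum_cons]
      split_ifs with hi
      · rw [add_comm]
      · rw [cell_of_length_lt (t := h.table) (by omega), zero_add]
    · intro L hL
      have := h3 L fun g hg => hL g (List.mem_cons_of_mem _ hg)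
      have hh := hL h (by simp)
      simp only [sumTables, Timed.bind_ops, e3, a3, List.length_cons]
      rw [add_mul]
      omega

lemma activeVects_spec (msgs : List HD) : (activeVects msgs).val = active msgs ∧
    (activeVects msgs).ops ≤ 1 + 2 * msgs.length := by
  induction msgs with
  | nil => simp [activeVects, active]
  | cons h l ih =>
    obtain ⟨h1, h2⟩ := ih
    by_cases hc : h.vect = (-1, -1)
    · simp [activeVects, hc, h1, active]; omega
    · simp [activeVects, hc, h1, active]; omega

lemma maxVects_spec (msgs : List HD) : (maxVects msgs).ops ≤ 1 + 3 * msgs.length ∧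
    ((msgs = [] ∧ (maxVects msgs).val = []) ∨ ∃ μ : ℤ, (∀ h ∈ msgs, h.vect.1 ≤ μ) ∧
      (∀ y ∈ (maxVects msgs).val, y.1 = μ) ∧ (maxVects msgs).val.length = cnt msgs μ ∧
      0 < cnt msgs μ) := by
  induction msgs with
  | nil => simp [maxVects]
  | cons h l ih =>
    obtain ⟨h1, h2⟩ := ih
    rcases h2 with ⟨rfl, h2⟩ | ⟨μ, hμ, hy, hlen, hpos⟩
    · refine ⟨by simp [maxVects, op, pure], Or.inr ⟨h.vect.1, by simp, ?_⟩⟩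
      simp [maxVects, op, cnt]
    · obtain ⟨y, M, hM⟩ := List.exists_cons_of_length_pos (hlen ▸ hpos)
      have hyμ : y.1 = μ := hy y (by simp [hM])
      have hcons : ∀ a, cnt (h :: l) a = cnt l a + if h.vect.1 = a then 1 else 0 := by
        intro a; simp [cnt, List.countP_cons]
      rcases lt_trichotomy μ h.vect.1 with hlt | heq | hgt
      · have hc0 : cnt l h.vect.1 = 0 := by
          rw [cnt, List.countP_eq_zero]
          intro g hg
          have := hμ g hg
          simp only [decide_eq_true_eq]; omega
        have hval : maxVects (h :: l) = ⟨[h.vect], (maxVects l).ops + 2⟩ := by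
          simp only [maxVects, bind, hM, op, hyμ, hlt, decide_true, if_true]
        rw [hval]
        refine ⟨by simp; omega, Or.inr ⟨h.vect.1, ?_, by simp, by simp [hcons, hc0],
          by simp [hcons]⟩⟩
        intro g hg
        rcases List.mem_cons.1 hg with rfl | hg
        · exact le_rfl
        · exact (hμ g hg).trans hlt.le
      · have hval : maxVects (h :: l) = ⟨h.vect :: (maxVects l).val, (maxVects l).ops + 3⟩ := by
          simp only [maxVects, bind, hM, op, hyμ, ← heq, lt_irrefl, decide_true, decide_false,
            if_true, Bool.false_eq_true, if_false]
        rw [hval]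
        refine ⟨by simp; omega, Or.inr ⟨μ, ?_, ?_, by simp [hcons, heq, hlen], by
          rw [hcons]; omega⟩⟩
        · intro g hg
          rcases List.mem_cons.1 hg with rfl | hg
          · exact heq.ge
          · exact hμ g hg
        · intro z hz
          rcases List.mem_cons.1 hz with rfl | hz
          · exact heq.symm
          · exact hy z hz
      · have hval : maxVects (h :: l) = ⟨(maxVects l).val, (maxVects l).ops + 2⟩ := by
          simp only [maxVects, bind, hM, op, hyμ, not_lt.2 hgt.le, hgt.ne', decide_false,
            Bool.false_eq_true, if_false, pure]
        rw [hval]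
        refine ⟨by simp; omega, Or.inr ⟨μ, ?_, hy, by simp [hcons, hgt.ne, hlen], by
          rw [hcons]; omega⟩⟩
        intro g hg
        rcases List.mem_cons.1 hg with rfl | hg
        · exact hgt.le
        · exact hμ g hg

lemma skipOnes_spec (t : List ℕ) (i : ℕ) : (skipOnes t i).val ≤ i ∧
    cell t (skipOnes t i).val ≠ 1 ∧ (skipOnes t i).ops ≤ 2 * i := by
  induction i with
  | zero => simp [skipOnes]
  | succ i ih =>
    obtain ⟨h1, h2, h3⟩ := ih
    by_cases hc : cell t (i + 1) = 1
    · simp only [skipOnes, Timed.bind_val, op_val, hc, decide_true, if_true, Timed.bind_ops,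
        op_ops]
      exact ⟨by omega, h2, by omega⟩
    · simp only [skipOnes, Timed.bind_val, op_val, hc, decide_false, Bool.false_eq_true, if_false,
        Timed.bind_ops, op_ops, Timed.pure_val, Timed.pure_ops]
      exact ⟨by omega, hc, by omega⟩

/-- The search skips cells equal to `1`. When no cell exceeds `1` it stops at a zero cell, possibly
the virtual one, and the second alternative of `readPN` never occurs. -/
lemma readPN_val {h : HD} (ht : ∀ i, cell h.table i ≤ 1) :
    (readPN h).val = (h.table.length : ℤ) := by
  obtain ⟨_, h2, _⟩ := skipOnes_spec h.table h.table.length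
  have h0 : cell h.table (skipOnes h.table h.table.length).val = 0 := by
    have := ht (skipOnes h.table h.table.length).val
    omega
  simp [readPN, h0]

lemma readPN_ops (h : HD) : (readPN h).ops ≤ 2 * h.table.length + 3 := by
  obtain ⟨_, _, h3⟩ := skipOnes_spec h.table h.table.length
  by_cases hc : cell h.table (skipOnes h.table h.table.length).val = 0
  · simp [readPN, hc]; omega
  · simp [readPN, hc]; omega

lemma prepare_ops {msgs : List HD} {L : ℕ} (hL : ∀ h ∈ msgs, h.table.length ≤ L) :
    (prepare msgs).ops ≤ 3 + msgs.length * (6 + 5 * L) := by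
  have h1 := (activeVects_spec msgs).2
  have h2 := (maxVects_spec msgs).1
  have h3 := (sumTables_spec msgs).2.2 L hL
  simp only [prepare, Timed.bind_ops, Timed.pure_ops]
  have e : msgs.length * (6 + 5 * L) = msgs.length * (1 + 5 * L) + 5 * msgs.length := by ring
  omega

/-! ### The outcome of the local merge, in terms of vectors and tables only. -/

/-- The properties of the messages that the local merge relies on. -/
structure GoodMsg (h : HD) : Prop where
  vect : h.vect = (-1, -1) ∨ h.vect = (0, 0) ∨ h.vect = (1, 1) ∨ h.vect = (1, 2) ∨
    ∃ a : ℤ, 2 ≤ a ∧ h.vect = (a, a)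
  le_length : h.vect.1 ≤ h.table.length
  cell_one : cell h.table 1 = 0

/-- The reasons for which the union of the associated-trees of process number at most `k`,
together with the merging node, has process number greater than `k`. -/
def Base (msgs : List HD) (k : ℕ) : Prop :=
  2 ≤ tsum msgs k ∨ (1 ≤ tsum msgs k ∧ 1 ≤ cnt msgs k) ∨ (1 ≤ k ∧ 3 ≤ cnt msgs k) ∨
    (∃ h ∈ msgs, (k : ℤ) + 1 ≤ h.vect.1) ∨
    (k = 1 ∧ (∃ h ∈ msgs, h.vect.1 = 1) ∧ active msgs ≠ [(1, 1)])

lemma GoodMsg.neg_one_le {h : HD} (hg : GoodMsg h) : -1 ≤ h.vect.1 := by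
  rcases hg.vect with h | h | h | h | ⟨a, ha, h⟩ <;> rw [h] <;> simp
  omega

lemma tsum_one {msgs : List HD} (hg : ∀ h ∈ msgs, GoodMsg h) : tsum msgs 1 = 0 := by
  simp only [tsum, List.sum_eq_zero_iff, List.mem_map]
  rintro _ ⟨h, hh, rfl⟩
  exact (hg h hh).cell_one

lemma tsum_zero {msgs : List HD} : tsum msgs 0 = 0 := by simp [tsum]

lemma cnt_eq_zero {msgs : List HD} {a b : ℤ} (hb : ∀ h ∈ msgs, h.vect.1 ≤ b) (hab : b < a) :
    cnt msgs a = 0 := by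
  rw [cnt, List.countP_eq_zero]
  intro g hg
  have := hb g hg
  simp only [decide_eq_true_eq]; omega

lemma exists_of_cnt_pos {msgs : List HD} {a : ℤ} (h : 0 < cnt msgs a) :
    ∃ h ∈ msgs, h.vect.1 = a := by
  obtain ⟨g, hg, hga⟩ := List.countP_pos_iff.1 h
  exact ⟨g, hg, by simpa using hga⟩

/-- The possible results of `ownVect`. -/
def OwnOutcome (msgs : List HD) (p : Vect) : Prop :=
  (p = (0, 0) ∧ ∀ h ∈ msgs, h.vect.1 = -1) ∨
  (p = (1, 1) ∧ (∀ h ∈ msgs, h.vect.1 ≤ 0) ∧ ∃ h ∈ msgs, h.vect.1 = 0) ∨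
  (p = (1, 2) ∧ active msgs = [(1, 1)]) ∨
  (∃ k : ℕ, 1 ≤ k ∧ p = (((k + 1 : ℕ) : ℤ), ((k + 1 : ℕ) : ℤ)) ∧
    (∀ h ∈ msgs, h.vect.1 ≤ ((k + 1 : ℕ) : ℤ)) ∧ cnt msgs ((k + 1 : ℕ) : ℤ) ≤ 1 ∧ Base msgs k) ∨
  (∃ k : ℕ, 2 ≤ k ∧ p = ((k : ℤ), (k : ℤ) + 1) ∧ (∀ h ∈ msgs, h.vect.1 ≤ k) ∧ cnt msgs k = 2)

lemma ownVect_spec {msgs : List HD} (hg : ∀ h ∈ msgs, GoodMsg h) :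
    OwnOutcome msgs (ownVect (active msgs) (maxVects msgs).val).val ∧
    (ownVect (active msgs) (maxVects msgs).val).ops ≤ 5 ∧
    (ownVect (active msgs) (maxVects msgs).val).val.1 ≤ tlen msgs + 2 := by
  rcases (maxVects_spec msgs).2 with ⟨rfl, hM⟩ | ⟨μ, hμ, hy, hlen, hpos⟩
  · rw [hM]
    refine ⟨Or.inl ⟨rfl, by simp⟩, by simp [ownVect, initialVect], by
      simp [ownVect, initialVect]; omega⟩
  · obtain ⟨g, hgm, hgμ⟩ := exists_of_cnt_pos hpos
    have hge := (hg g hgm).neg_one_le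
    have hlenμ : μ ≤ tlen msgs := by
      have h1 := (hg g hgm).le_length
      have h2 := le_tlen hgm
      omega
    obtain ⟨y, M, hM⟩ := List.exists_cons_of_length_pos (hlen ▸ hpos)
    have hyμ : y.1 = μ := hy y (by simp [hM])
    rw [hM] at hlen ⊢
    rw [hgμ] at hge
    by_cases h2 : μ < 2
    · have e : ownVect (active msgs) (y :: M) = ⟨(initialVect (active msgs) (y :: M)).val,
          (initialVect (active msgs) (y :: M)).ops + 1⟩ := by
        simp only [ownVect, bind, op, hyμ, h2, decide_true, if_true, add_comm 1]
      rw [e]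
      by_cases hm1 : μ = -1
      · have e : initialVect (active msgs) (y :: M) = ⟨(0, 0), 2⟩ := by
          simp only [initialVect, bind, op, hyμ, hm1, decide_true, if_true]
        rw [e]
        refine ⟨Or.inl ⟨rfl, fun h hh => ?_⟩, by simp, by simp; omega⟩
        have := hμ h hh
        have := (hg h hh).neg_one_le
        omega
      by_cases h0 : μ = 0
      · have e : initialVect (active msgs) (y :: M) = ⟨(1, 1), 3⟩ := by
          simp [initialVect, bind, op, hyμ, h0]
        rw [e]
        exact ⟨Or.inr (Or.inl ⟨rfl, fun h hh => h0 ▸ hμ h hh, g, hgm, hgμ.trans h0⟩), by simp,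
          by simp; omega⟩
      have h1 : μ = 1 := by omega
      have hother : active msgs ≠ [(1, 1)] → OwnOutcome msgs (2, 2) := by
        intro hne
        refine Or.inr (Or.inr (Or.inr (Or.inl ⟨1, le_rfl, by simp, ?_, ?_, ?_⟩)))
        · intro h hh
          have := hμ h hh
          push_cast; omega
        · rw [cnt_eq_zero hμ (by push_cast; omega)]; omega
        · exact Or.inr (Or.inr (Or.inr (Or.inr ⟨rfl, ⟨g, hgm, hgμ.trans h1⟩, hne⟩)))
      have htl : (1 : ℤ) ≤ tlen msgs := by omega
      rcases hN : active msgs with _ | ⟨z, _ | ⟨z', N⟩⟩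
      · have e : initialVect [] (y :: M) = ⟨(2, 2), 3⟩ := by
          simp [initialVect, bind, op, hyμ, h1]
        rw [e]
        exact ⟨hother (by simp [hN]), by simp, by simp⟩
      · by_cases hz : z = (1, 1)
        · have e : initialVect [z] (y :: M) = ⟨(1, 2), 4⟩ := by
            simp [initialVect, bind, op, hyμ, h1, hz]
          rw [e]
          exact ⟨Or.inr (Or.inr (Or.inl ⟨rfl, by rw [hN, hz]⟩)), by simp, by simp; omega⟩
        · have e : initialVect [z] (y :: M) = ⟨(2, 2), 4⟩ := by
            simp [initialVect, bind, op, hyμ, h1, hz]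
          rw [e]
          exact ⟨hother (by simp [hN, hz]), by simp, by simp⟩
      · have e : initialVect (z :: z' :: N) (y :: M) = ⟨(2, 2), 3⟩ := by
          simp [initialVect, bind, op, hyμ, h1]
        rw [e]
        exact ⟨hother (by simp [hN]), by simp, by simp⟩
    · obtain ⟨k, rfl⟩ : ∃ k : ℕ, μ = k := ⟨μ.toNat, by omega⟩
      rcases M with _ | ⟨z, _ | ⟨z', M⟩⟩
      · have e : ownVect (active msgs) [y] = ⟨((k : ℤ), (k : ℤ)), 2⟩ := by
          simp only [ownVect, bind, op, hyμ, h2, decide_false, Bool.false_eq_true, if_false]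
        rw [e]
        -- A single stable tree of process number `j + 1` is its own obstruction at level `j`: the
        -- fourth alternative of `Base`.
        obtain ⟨j, rfl⟩ : ∃ j, k = j + 1 := ⟨k - 1, by omega⟩
        refine ⟨Or.inr (Or.inr (Or.inr (Or.inl ⟨j, by omega, rfl, hμ, ?_, ?_⟩))), by simp, by
          simp only; omega⟩
        · rw [← hlen]; simp
        · exact Or.inr (Or.inr (Or.inr (Or.inl ⟨g, hgm, by rw [hgμ]; push_cast; omega⟩)))
      · have e : ownVect (active msgs) [y, z] = ⟨((k : ℤ), (k : ℤ) + 1), 2⟩ := by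
          simp only [ownVect, bind, op, hyμ, h2, decide_false, Bool.false_eq_true, if_false]
        rw [e]
        refine ⟨Or.inr (Or.inr (Or.inr (Or.inr ⟨k, by omega, rfl, hμ, ?_⟩))), by simp, by
          simp only; omega⟩
        rw [← hlen]; simp
      · have e : ownVect (active msgs) (y :: z :: z' :: M) = ⟨((k : ℤ) + 1, (k : ℤ) + 1), 2⟩ := by
          simp only [ownVect, bind, op, hyμ, h2, decide_false, Bool.false_eq_true, if_false]
        rw [e]
        refine ⟨Or.inr (Or.inr (Or.inr (Or.inl ⟨k, by omega, by simp, ?_, ?_, ?_⟩))), by simp, by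
          simp only; omega⟩
        · intro h hh
          have := hμ h hh
          push_cast; omega
        · rw [cnt_eq_zero hμ (by push_cast; omega)]; omega
        · refine Or.inr (Or.inr (Or.inl ⟨by omega, ?_⟩))
          rw [← hlen]; simp

/-- The last disjunction records why the new level `m` is forced: the cells are nonzero all the way
to `m`, starting above a repeated level or at the level of the own tree. -/
lemma simplify_spec {p : Vect} {t : List ℕ} (hp : p.1.toNat ≤ t.length)
    (hsmall : p.1 < 2 → cell t p.1.toNat = 0) :
    (simplify p t).ops ≤ 7 * t.length + 12 ∧
    (((simplify p t).val = ⟨p, t⟩ ∧ p.1 < 2 ∧ ∀ j, cell t j ≤ 1) ∨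
      ∃ m : ℕ, (simplify p t).val.vect = ((m : ℤ), (m : ℤ)) ∧
        (simplify p t).val.table.length = max t.length m ∧
        (∀ i, cell (simplify p t).val.table i = if i ≤ m then 0 else cell t i) ∧
        cell t m = 0 ∧ p.1 ≤ m ∧ (∀ i, m < i → cell t i ≤ 1) ∧
        ((∃ k < m, 1 < cell t k ∧ ∀ j, k < j → j < m → cell t j ≠ 0) ∨
          (2 ≤ p.1 ∧ ∀ j, p.1.toNat ≤ j → j < m → cell t j ≠ 0))) := by
  obtain ⟨hk1, hk2, hk3⟩ := lastBig_spec t t.length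
  obtain ⟨f1, f2, f3, f4, f5⟩ := firstZero_spec t (t.length + 1 - p.1.toNat) p.1.toNat
  set k₂ := (firstZero t (t.length + 1 - p.1.toNat) p.1.toNat).val with hk₂
  -- A search that runs out of fuel returns `t.length + 1`, a virtual cell, which holds `0`.
  have hz2 : cell t k₂ = 0 := by
    by_cases h : k₂ < p.1.toNat + (t.length + 1 - p.1.toNat)
    · exact f4 h
    · exact cell_of_length_lt (by omega)
  have hbig : ∀ j, (∀ j ≤ t.length, cell t j ≤ 1) → cell t j ≤ 1 := by
    intro j hj
    by_cases hjl : j ≤ t.length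
    · exact hj j hjl
    · rw [cell_of_length_lt (by omega)]; omega
  rcases hk : (lastBig t t.length).val with _ | k
  · by_cases h2 : 2 ≤ p.1
    · obtain ⟨e1, e2, e3⟩ := extendTo_spec t k₂
      obtain ⟨c1, c2, c3⟩ := clear_spec k₂ (extendTo t k₂).val
      have e : simplify p t = ⟨⟨((k₂ : ℤ), (k₂ : ℤ)), (clear (extendTo t k₂).val k₂).val⟩,
          (lastBig t t.length).ops + ((firstZero t (t.length + 1 - p.1.toNat) p.1.toNat).ops +
            (1 + ((extendTo t k₂).ops + ((clear (extendTo t k₂).val k₂).ops + 1))))⟩ := by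
        simp only [simplify, bind, hk, op, h2, decide_true, if_true, ← hk₂]
      rw [e]
      refine ⟨by simp only [e3, c3]; omega, Or.inr ⟨k₂, rfl, ?_, ?_, hz2, by omega, ?_, ?_⟩⟩
      · simp only [c1, e1]
      · intro i; simp only [c2, e2]
      · intro i _; exact hbig i (hk2 hk)
      · exact Or.inr ⟨h2, f3⟩
    · have e : simplify p t = ⟨⟨p, t⟩,
          (lastBig t t.length).ops + ((firstZero t (t.length + 1 - p.1.toNat) p.1.toNat).ops +
            (1 + 1))⟩ := by
        simp only [simplify, bind, hk, op, h2, decide_false, Bool.false_eq_true, if_false]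
      rw [e]
      exact ⟨by simp only; omega, Or.inl ⟨rfl, by omega, fun j => hbig j (hk2 hk)⟩⟩
  · obtain ⟨g1, g2, g3⟩ := hk1 k hk
    obtain ⟨d1, d2, d3, d4, d5⟩ := firstZero_spec t (t.length - k) (k + 1)
    set k₁ := (firstZero t (t.length - k) (k + 1)).val with hk₁
    have hz1 : cell t k₁ = 0 := by
      by_cases h : k₁ < k + 1 + (t.length - k)
      · exact d4 h
      · exact cell_of_length_lt (by omega)
    obtain ⟨e1, e2, e3⟩ := extendTo_spec t (max k₁ k₂)
    obtain ⟨c1, c2, c3⟩ := clear_spec (max k₁ k₂) (extendTo t (max k₁ k₂)).val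
    have e : simplify p t = ⟨⟨((max k₁ k₂ : ℕ), (max k₁ k₂ : ℕ)),
          (clear (extendTo t (max k₁ k₂)).val (max k₁ k₂)).val⟩,
          (lastBig t t.length).ops + ((firstZero t (t.length + 1 - p.1.toNat) p.1.toNat).ops +
            ((firstZero t (t.length - k) (k + 1)).ops + (1 +
              ((extendTo t (max k₁ k₂)).ops +
                ((clear (extendTo t (max k₁ k₂)).val (max k₁ k₂)).ops + 1)))))⟩ := by
        simp only [simplify, bind, hk, op, ← hk₂, ← hk₁]
    rw [e]
    have hzm : cell t (max k₁ k₂) = 0 := by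
      rcases max_choice k₁ k₂ with h | h <;> rw [h] <;> assumption
    refine ⟨by simp only [e3, c3]; omega,
      Or.inr ⟨max k₁ k₂, rfl, ?_, ?_, hzm, by omega, ?_, ?_⟩⟩
    · simp only [c1, e1]
    · intro i; simp only [c2, e2]
    · intro i hi
      by_cases hil : i ≤ t.length
      · exact g3 i (by omega) hil
      · rw [cell_of_length_lt (by omega)]; omega
    · rcases le_total k₂ k₁ with h | h
      · rw [max_eq_left h]
        exact Or.inl ⟨k, by omega, g2, fun j hj hj' => d3 j (by omega) hj'⟩
      · rw [max_eq_right h]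
        by_cases h2 : 2 ≤ p.1
        · exact Or.inr ⟨h2, f3⟩
        -- For `p.1 < 2` the cell at `p` is empty, hence `k₂ ≤ 1`. Since `k ≥ 1` gives `k₁ ≥ 2`, the
        -- maximum cannot be `k₂`.
        · exfalso
          have hz := hsmall (by omega)
          have hle : k₂ ≤ p.1.toNat := by
            by_contra hcon
            exact f3 _ le_rfl (by omega) hz
          have : k ≠ 0 := by rintro rfl; simp at g2
          omega

/-- The possible results of the local merge; `m` is the process number of the associated-tree of
the merging node. -/
structure Outcome (msgs : List HD) (h : HD) (m : ℕ) : Prop where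
  length : h.table.length = max (tlen msgs) m
  cell_eq : ∀ i, m < i → cell h.table i = tsum msgs i
  tsum_le : ∀ i, m < i → tsum msgs i ≤ 1
  cell_lt : ∀ i, i < m → cell h.table i = 0
  le : ∀ g ∈ msgs, g.vect.1 ≤ m
  cases :
    (2 ≤ m ∧ h.vect = (-1, -1) ∧ cnt msgs m = 2 ∧ tsum msgs m = 0 ∧ cell h.table m = 1) ∨
    (cell h.table m = 0 ∧
      ((m = 0 ∧ h.vect = (0, 0) ∧ ∀ g ∈ msgs, g.vect.1 = -1) ∨
       (m = 1 ∧ h.vect = (1, 1) ∧ (∀ g ∈ msgs, g.vect.1 ≤ 0) ∧ ∃ g ∈ msgs, g.vect.1 = 0) ∨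
       (m = 1 ∧ h.vect = (1, 2) ∧ active msgs = [(1, 1)]) ∨
       (2 ≤ m ∧ h.vect = ((m : ℤ), (m : ℤ)) ∧ tsum msgs m = 0 ∧ cnt msgs m ≤ 1 ∧
        ∃ k < m, (∀ j, k < j → j < m → 1 ≤ tsum msgs j) ∧ Base msgs k)))

lemma le_one_of_active {msgs : List HD} (h : active msgs = [(1, 1)]) :
    ∀ g ∈ msgs, g.vect.1 ≤ 1 := by
  intro g hg
  by_cases hv : g.vect = (-1, -1)
  · rw [hv]; simp
  · have : g.vect ∈ active msgs := by
      simp only [active, List.mem_filter, List.mem_map, decide_eq_true_eq]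
      exact ⟨⟨g, hg, rfl⟩, hv⟩
    rw [h] at this
    rw [List.mem_singleton.1 this]

lemma insertOwn_stable {p : Vect} {t : List ℕ} (h : ¬ (p.1 < p.2 ∧ 1 < p.1)) :
    insertOwn p t = ⟨(p, t), 2⟩ := by
  simp only [insertOwn, bind, op, h, decide_false, Bool.false_eq_true, if_false]

lemma insertOwn_unstable {k : ℕ} {t : List ℕ} (h : 2 ≤ k) (hk : k ≤ t.length) :
    (insertOwn ((k : ℤ), (k : ℤ) + 1) t).val.1 = (-1, -1) ∧
    (insertOwn ((k : ℤ), (k : ℤ) + 1) t).val.2.length = t.length ∧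
    (∀ i, cell (insertOwn ((k : ℤ), (k : ℤ) + 1) t).val.2 i =
      if i < k then 0 else if i = k then cell t k + 1 else cell t i) ∧
    (insertOwn ((k : ℤ), (k : ℤ) + 1) t).ops ≤ k + 5 := by
  obtain ⟨c1, c2, c3⟩ := clear_spec (k - 1) (t.set (k - 1) (cell t k + 1))
  have hc : (k : ℤ) < (k : ℤ) + 1 ∧ 1 < (k : ℤ) := ⟨by omega, by omega⟩
  have e : insertOwn ((k : ℤ), (k : ℤ) + 1) t =
      ⟨((-1, -1), (clear (t.set (k - 1) (cell t k + 1)) (k - 1)).val),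
        1 + (1 + (1 + (1 + ((clear (t.set (k - 1) (cell t k + 1)) (k - 1)).ops + 1))))⟩ := by
    simp only [insertOwn, bind, op, write, hc, decide_true, if_true, and_self, Int.toNat_natCast]
  rw [e]
  refine ⟨rfl, by simp [c1], ?_, by simp only [c3]; omega⟩
  intro i
  simp only [c2, cell_set (t := t) (i := k) (x := cell t k + 1) (by omega) i]
  by_cases h1 : i < k
  · simp [h1, show i ≤ k - 1 by omega]
  · simp only [h1, show ¬ (i ≤ k - 1) by omega, if_false, hk, and_true]

lemma mergeMsgs_eq (msgs : List HD) :
    mergeMsgs msgs = mergeHD (active msgs) (maxVects msgs).val (sumTables msgs).val := by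
  simp [mergeMsgs, prepare, (activeVects_spec msgs).1]

/-- All that the correctness proof uses of Algorithm 1. Either the tree of the node stays at the
level given by its own vector, or some conflict `Base` at a level `k` propagates through nonempty
levels up to the new level. -/
lemma mergeMsgs_spec {msgs : List HD} (hg : ∀ h ∈ msgs, GoodMsg h) :
    (∃ m, Outcome msgs (mergeMsgs msgs).val m) ∧ (mergeMsgs msgs).ops ≤ 8 * tlen msgs + 60 := by
  obtain ⟨hown, hops, hple⟩ := ownVect_spec hg
  obtain ⟨s1, s2, _⟩ := sumTables_spec msgs
  rw [mergeMsgs_eq]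
  set p := (ownVect (active msgs) (maxVects msgs).val).val with hp
  set t := (extendTo (sumTables msgs).val p.1.toNat).val with ht
  obtain ⟨e1, e2, e3⟩ := extendTo_spec (sumTables msgs).val p.1.toNat
  rw [← ht, s1] at e1
  have e2 : ∀ i, cell t i = tsum msgs i := fun i => (e2 i).trans (s2 i)
  have hval : (mergeHD (active msgs) (maxVects msgs).val (sumTables msgs).val).val =
      (simplify (insertOwn p t).val.1 (insertOwn p t).val.2).val := by
    simp only [mergeHD, Timed.bind_val, ← hp, ← ht]
  have hopsval : (mergeHD (active msgs) (maxVects msgs).val (sumTables msgs).val).ops =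
      (ownVect (active msgs) (maxVects msgs).val).ops +
        ((extendTo (sumTables msgs).val p.1.toNat).ops + ((insertOwn p t).ops +
        (simplify (insertOwn p t).val.1 (insertOwn p t).val.2).ops)) := by
    simp only [mergeHD, Timed.bind_ops, ← hp, ← ht]
  rw [hval, hopsval, e3, s1]
  clear_value p t
  clear hval hopsval e3 s1 s2
  -- The three cases with an own tree of process number at most `1` are treated together. Unstable
  -- trees have level at least `2`, so here a simplification can only be caused by a repeated level
  -- `k ≥ 2`.
  have small : ∀ m : ℕ, m < 2 → p.1 = m → ¬ (p.1 < p.2 ∧ 1 < p.1) → (∀ g ∈ msgs, g.vect.1 ≤ m) →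
      ((m = 0 ∧ p = (0, 0) ∧ ∀ g ∈ msgs, g.vect.1 = -1) ∨
       (m = 1 ∧ p = (1, 1) ∧ (∀ g ∈ msgs, g.vect.1 ≤ 0) ∧ ∃ g ∈ msgs, g.vect.1 = 0) ∨
       (m = 1 ∧ p = (1, 2) ∧ active msgs = [(1, 1)])) →
      (∃ m, Outcome msgs (simplify (insertOwn p t).val.1 (insertOwn p t).val.2).val m) ∧
        (ownVect (active msgs) (maxVects msgs).val).ops + (1 + (p.1.toNat - tlen msgs) +
        ((insertOwn p t).ops + (simplify (insertOwn p t).val.1 (insertOwn p t).val.2).ops)) ≤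
        8 * tlen msgs + 60 := by
    intro m hm hpm hst hle hcases
    have hpm' : p.1.toNat = m := by omega
    have hz : ∀ i < 2, tsum msgs i = 0 := by
      intro i hi
      interval_cases i
      · exact tsum_zero
      · exact tsum_one hg
    rw [insertOwn_stable hst]
    obtain ⟨so, sc⟩ := simplify_spec (p := p) (t := t) (by omega) (fun _ => by
      rw [hpm', e2]; exact hz m hm)
    refine ⟨?_, by clear sc hcases; simp only; omega⟩
    rcases sc with ⟨h1, _, h3⟩ | ⟨m', v, l, c, cm, pm, hi, hlow⟩
    · refine ⟨m, ?_⟩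
      rw [h1]
      exact {
        length := by simp only [e1, hpm']
        cell_eq := fun i _ => e2 i
        tsum_le := fun i _ => e2 i ▸ h3 i
        cell_lt := fun i hi => by simp only [e2]; exact hz i (by omega)
        le := hle
        cases := Or.inr ⟨by simp only [e2]; exact hz m hm, by
          rcases hcases with h | h | h
          · exact Or.inl h
          · exact Or.inr (Or.inl h)
          · exact Or.inr (Or.inr (Or.inl h))⟩ }
    · rcases hlow with ⟨k, hk, hk1, hk2⟩ | ⟨h2, _⟩
      · have hk0 : 2 ≤ k := by
          by_contra hcon
          rw [e2, hz k (by omega)] at hk1; omega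
        refine ⟨m', ?_, ?_, ?_, ?_, ?_, ?_⟩
        · rw [l, e1]; clear hcases; omega
        · intro i hi; rw [c, if_neg (by omega), e2]
        · intro i hi'; rw [← e2]; exact hi i hi'
        · intro i hi; rw [c, if_pos (by omega)]
        · intro g hg'; have := hle g hg'; omega
        · refine Or.inr ⟨by rw [c, if_pos le_rfl], Or.inr (Or.inr (Or.inr ⟨by omega, v, ?_, ?_,
            k, hk, ?_, Or.inl ?_⟩))⟩
          · rw [← e2]; exact cm
          · rw [cnt_eq_zero hle (by omega)]; omega
          · intro j hj hj'; have := hk2 j hj hj'; rw [e2] at this; omega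
          · rw [← e2]; exact hk1
      · omega
  rcases hown with ⟨hp0, hall⟩ | ⟨hp1, hall, hex⟩ | ⟨hp12, hact⟩ | ⟨k, hk, hpk, hall, hcnt, hbase⟩ |
    ⟨k, hk, hpk, hall, hcnt⟩
  · refine small 0 (by omega) (by rw [hp0]; rfl) (by rw [hp0]; simp) (fun g hg => ?_)
      (Or.inl ⟨rfl, hp0, hall⟩)
    rw [hall g hg]; simp
  · refine small 1 (by omega) (by rw [hp1]; rfl) (by rw [hp1]; simp) (fun g hg => ?_)
      (Or.inr (Or.inl ⟨rfl, hp1, hall, hex⟩))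
    have := hall g hg
    omega
  · refine small 1 (by omega) (by rw [hp12]; rfl) (by rw [hp12]; simp) (fun g hg => ?_)
      (Or.inr (Or.inr ⟨rfl, hp12, hact⟩))
    exact_mod_cast le_one_of_active hact g hg
  · have hpn : p.1 = (k + 1 : ℕ) := by rw [hpk]
    have hpn' : p.1.toNat = k + 1 := by omega
    rw [insertOwn_stable (by rw [hpk]; simp)]
    obtain ⟨so, sc⟩ := simplify_spec (p := p) (t := t) (by omega) (fun h => by omega)
    refine ⟨?_, by clear sc; simp only; omega⟩
    rcases sc with ⟨_, h2, _⟩ | ⟨m, v, l, c, cm, pm, hi, hlow⟩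
    · omega
    · have hcm : cnt msgs m ≤ 1 := by
        rcases Nat.lt_or_ge (k + 1) m with h | h
        · rw [cnt_eq_zero hall (by omega)]; omega
        · obtain rfl : m = k + 1 := by omega
          exact hcnt
      refine ⟨m, ?_, ?_, ?_, ?_, ?_, ?_⟩
      · rw [l, e1]; clear hlow; omega
      · intro i hi; rw [c, if_neg (by omega), e2]
      · intro i hi'; rw [← e2]; exact hi i hi'
      · intro i hi; rw [c, if_pos (by omega)]
      · intro g hg'; have := hall g hg'; omega
      · refine Or.inr ⟨by rw [c, if_pos le_rfl], Or.inr (Or.inr (Or.inr ⟨by omega, v,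
          by rw [← e2]; exact cm, hcm, ?_⟩))⟩
        rcases hlow with ⟨k', hk', hk1, hk2⟩ | ⟨_, h3⟩
        · refine ⟨k', hk', ?_, Or.inl (by rw [← e2]; exact hk1)⟩
          intro j hj hj'; have := hk2 j hj hj'; rw [e2] at this; omega
        · refine ⟨k, by omega, ?_, hbase⟩
          intro j hj hj'; have := h3 j (by omega) hj'; rw [e2] at this; omega
  · have hpn : p.1 = k := by rw [hpk]
    have hpn' : p.1.toNat = k := by omega
    rw [hpk] at e1 hple hpn' ⊢
    obtain ⟨i1, i2, i3, i4⟩ := insertOwn_unstable (k := k) (t := t) hk (by omega)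
    rw [i1]
    -- The first entry `-1` becomes the index `0`, the virtual cell, so the hypotheses hold
    -- trivially.
    obtain ⟨so, sc⟩ := simplify_spec (p := (-1, -1))
      (t := (insertOwn ((k : ℤ), (k : ℤ) + 1) t).val.2) (by simp) (fun h => by simp)
    refine ⟨?_, by clear sc; rw [i2] at so; simp only [hpn']; omega⟩
    rcases sc with ⟨h1, _, h3⟩ | ⟨m, v, l, c, cm, pm, hi, hlow⟩
    · have hk1 : tsum msgs k = 0 := by
        have := h3 k
        rw [i3, if_neg (by omega), if_pos rfl, e2] at this
        omega
      refine ⟨k, ?_⟩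
      rw [h1]
      exact {
        length := by simp only [i2, e1, hpn']
        cell_eq := fun i hi => by simp only [i3]; rw [if_neg (by omega), if_neg (by omega), e2]
        tsum_le := fun i hi => by
          have := h3 i
          rwa [i3, if_neg (by omega), if_neg (by omega), e2] at this
        cell_lt := fun i hi => by simp only [i3]; rw [if_pos (by omega)]
        le := hall
        cases := Or.inl ⟨hk, rfl, hcnt, hk1, by
          have := i3 k; rw [if_neg (by omega), if_pos rfl, e2, hk1] at this; exact this⟩ }
    · rcases hlow with ⟨k', hk', hk1, hk2⟩ | ⟨h2, _⟩
      · have hkk : k ≤ k' := by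
          by_contra hcon
          rw [i3, if_pos (by omega)] at hk1; omega
        refine ⟨m, ?_, ?_, ?_, ?_, ?_, ?_⟩
        · rw [l, i2, e1]; omega
        · intro i hi; rw [c, if_neg (by omega), i3, if_neg (by omega), if_neg (by omega), e2]
        · intro i hi'
          have := hi i hi'
          rwa [i3, if_neg (by omega), if_neg (by omega), e2] at this
        · intro i hi; rw [c, if_pos (by omega)]
        · intro g hg'; have := hall g hg'; omega
        · refine Or.inr ⟨by rw [c, if_pos le_rfl], Or.inr (Or.inr (Or.inr ⟨by omega, v, ?_, ?_,
            k', hk', ?_, ?_⟩))⟩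
          · rwa [i3, if_neg (by omega), if_neg (by omega), e2] at cm
          · rw [cnt_eq_zero hall (by omega)]; omega
          · intro j hj hj'
            have := hk2 j hj hj'
            rw [i3, if_neg (by omega), if_neg (by omega), e2] at this; omega
          -- If the repeated level is `k` itself, the newly counted tree meets an older unstable one
          -- there. In `Base` this appears as an unstable tree next to the stable trees of level
          -- `k`.
          · rw [i3, if_neg (by omega)] at hk1
            split_ifs at hk1 with h
            · subst h
              rw [e2] at hk1
              exact Or.inr (Or.inl ⟨by omega, by omega⟩)
            · rw [e2] at hk1
              exact Or.inl hk1
      · simp at h2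

/-! ### Counting in duplicate-free lists, applied to the children of a node. -/

section Lists

variable {α : Type*} {l : List α} {p : α → Prop} [DecidablePred p]

lemma exists_of_one_le_countP (h : 1 ≤ l.countP p) : ∃ a ∈ l, p a := by
  obtain ⟨a, ha, hp⟩ := List.countP_pos_iff.1 h
  exact ⟨a, ha, by simpa using hp⟩

lemma countP_filter_mem {a : α} {q : List α} (e : l.filter p = q) (ha : a ∈ q) : a ∈ l ∧ p a := by
  rw [← e] at ha
  simpa using List.mem_filter.1 ha

lemma exists_three_of_countP (hl : l.Nodup) (h : 3 ≤ l.countP p) :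
    ∃ a ∈ l, ∃ b ∈ l, ∃ c ∈ l, a ≠ b ∧ a ≠ c ∧ b ≠ c ∧ p a ∧ p b ∧ p c := by
  rw [List.countP_eq_length_filter] at h
  have hn := hl.filter p
  rcases e : l.filter p with _ | ⟨a, _ | ⟨b, _ | ⟨c, t⟩⟩⟩
  · simp [e] at h
  · simp [e] at h
  · simp [e] at h
  · rw [e] at hn
    obtain ⟨ha, pa⟩ := countP_filter_mem e (a := a) (by simp)
    obtain ⟨hb, pb⟩ := countP_filter_mem e (a := b) (by simp)
    obtain ⟨hc, pc⟩ := countP_filter_mem e (a := c) (by simp)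
    simp only [List.nodup_cons, List.mem_cons, not_or] at hn
    exact ⟨a, ha, b, hb, c, hc, hn.1.1, hn.1.2.1, hn.2.1.1, pa, pb, pc⟩

lemma exists_two_of_countP (hl : l.Nodup) (h : 2 ≤ l.countP p) :
    ∃ a ∈ l, ∃ b ∈ l, a ≠ b ∧ p a ∧ p b := by
  rw [List.countP_eq_length_filter] at h
  have hn := hl.filter p
  rcases e : l.filter p with _ | ⟨a, _ | ⟨b, t⟩⟩
  · simp [e] at h
  · simp [e] at h
  · rw [e] at hn
    obtain ⟨ha, pa⟩ := countP_filter_mem e (a := a) (by simp)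
    obtain ⟨hb, pb⟩ := countP_filter_mem e (a := b) (by simp)
    simp only [List.nodup_cons, List.mem_cons, not_or] at hn
    exact ⟨a, ha, b, hb, hn.1.1, pa, pb⟩

lemma eq_of_countP_le_one (hl : l.countP p ≤ 1) {a b : α} (ha : a ∈ l) (hb : b ∈ l)
    (pa : p a) (pb : p b) : a = b := by
  rw [List.countP_eq_length_filter] at hl
  have ha : a ∈ l.filter p := List.mem_filter.2 ⟨ha, by simpa using pa⟩
  have hb : b ∈ l.filter p := List.mem_filter.2 ⟨hb, by simpa using pb⟩
  rcases e : l.filter p with _ | ⟨c, _ | ⟨d, t⟩⟩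
  · simp [e] at ha
  · rw [e] at ha hb
    rw [List.mem_singleton.1 ha, List.mem_singleton.1 hb]
  · simp [e] at hl

lemma exists_pair_of_countP (hl : l.Nodup) (h : l.countP p = 2) :
    ∃ a ∈ l, ∃ b ∈ l, a ≠ b ∧ p a ∧ p b ∧ ∀ c ∈ l, p c → c = a ∨ c = b := by
  rw [List.countP_eq_length_filter] at h
  have hn := hl.filter p
  obtain ⟨a, b, e⟩ := List.length_eq_two.1 h
  rw [e] at hn
  obtain ⟨ha, pa⟩ := countP_filter_mem e (a := a) (by simp)
  obtain ⟨hb, pb⟩ := countP_filter_mem e (a := b) (by simp)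
  refine ⟨a, ha, b, hb, by simpa using hn, pa, pb, fun c hc pc => ?_⟩
  have : c ∈ l.filter p := List.mem_filter.2 ⟨hc, by simpa using pc⟩
  rw [e] at this
  simpa using this

lemma filter_eq_singleton (hl : l.Nodup) {a : α} (ha : a ∈ l) (pa : p a)
    (h : ∀ b ∈ l, p b → b = a) : l.filter p = [a] := by
  have hn := hl.filter p
  have ha : a ∈ l.filter p := List.mem_filter.2 ⟨ha, by simpa using pa⟩
  rcases e : l.filter p with _ | ⟨c, _ | ⟨d, t⟩⟩
  · simp [e] at ha
  · rw [e] at ha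
    rw [List.mem_singleton.1 ha]
    exact e
  · rw [e] at hn
    obtain ⟨hc, pc⟩ := countP_filter_mem e (a := c) (by simp)
    obtain ⟨hd, pd⟩ := countP_filter_mem e (a := d) (by simp)
    have : c = d := (h c hc pc).trans (h d hd pd).symm
    simp [this] at hn

variable {hd : α → HD}

lemma tsum_eq_countP {i : ℕ} (h : ∀ c ∈ l, cell (hd c).table i ≤ 1) :
    tsum (l.map hd) i = l.countP fun c => cell (hd c).table i = 1 := by
  induction l with
  | nil => simp [tsum]
  | cons a l ih =>
    have ih := ih fun c hc => h c (List.mem_cons_of_mem _ hc)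
    have ha := h a (by simp)
    simp only [tsum, List.map_map, List.map_cons, List.sum_cons, List.countP_cons] at ih ⊢
    rw [ih, add_comm]
    by_cases hc : cell (hd a).table i = 1
    · simp [hc]
    · have : cell (hd a).table i = 0 := by omega
      simp [this]

lemma cnt_map (a : ℤ) : cnt (l.map hd) a = l.countP fun c => (hd c).vect.1 = a := by
  simp [cnt, List.countP_map, Function.comp_def]

lemma active_map : active (l.map hd) =
    (l.filter fun c => (hd c).vect ≠ (-1, -1)).map fun c => (hd c).vect := by
  simp [active, List.filter_map, Function.comp_def]

lemma exists_tlen_eq (h : l ≠ []) : ∃ c ∈ l, (hd c).table.length = tlen (l.map hd) := by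
  induction l with
  | nil => exact absurd rfl h
  | cons a l ih =>
    by_cases hl : l = []
    · exact ⟨a, by simp, by simp [tlen, hl]⟩
    · obtain ⟨c, hc, hcl⟩ := ih hl
      have e : tlen ((a :: l).map hd) = max (hd a).table.length (tlen (l.map hd)) := by
        simp [tlen]
      rw [e]
      rcases le_total (hd a).table.length (tlen (l.map hd)) with h1 | h1
      · exact ⟨c, by simp [hc], by rw [max_eq_right h1, hcl]⟩
      · exact ⟨a, by simp, by rw [max_eq_left h1]⟩

end Lists

/-! ### The invariant at a node, with the strategies and obstructions that it provides. -/

section Invariant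

variable {V : Type*} {G : SimpleGraph V} {father : V → Option V} {τ : V → ℕ} {m : V → ℕ}
  {unst : V → Prop} {hd : V → HD}

lemma roots_trans {c x z : V} (hx : x ∈ roots father m unst c) (hz : z ∈ roots father m unst x) :
    z ∈ roots father m unst c := by
  induction hx with
  | self => exact hz
  | @up v c w hc hw hu hm ih =>
    by_cases hzw : z = w
    · subst hzw; exact InRoots.up hc hw hu hm
    · obtain ⟨h1, h2⟩ := unst_of_mem_roots hz hzw
      exact InRoots.up hc (ih hz) h1 (hm.trans h2)

lemma AncClosed.insert_father {v c : V} {S : Set V} (hS : AncClosed father c S)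
    (hc : father c = some v) : AncClosed father v (insert v S) where
  root := Or.inl rfl
  sub := Set.insert_subset (self_mem_desc v) (hS.sub.trans (desc_subset_of_child hc))
  closed := by
    rintro u (rfl | hu) hne
    · exact absurd rfl hne
    · by_cases huc : u = c
      · subst huc; exact ⟨v, Or.inl rfl, hc⟩
      · obtain ⟨f, hf, hf'⟩ := hS.closed u hu huc
        exact ⟨f, Or.inr hf, hf'⟩

lemma AncClosed.insert_child {v w f : V} {S : Set V} (hS : AncClosed father v S) (hf : f ∈ S)
    (hw : father w = some f) : AncClosed father v (insert w S) where
  root := Or.inr hS.root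
  sub := Set.insert_subset (mem_desc_of_father hw (hS.sub hf)) hS.sub
  closed := by
    rintro u (rfl | hu) hne
    · exact ⟨f, Or.inr hf, hw⟩
    · obtain ⟨f', hf, hf'⟩ := hS.closed u hu hne
      exact ⟨f', Or.inr hf, hf'⟩

lemma searchable_singleton_zero (r : V) : Searchable G {r} 0 :=
  (finishable_singleton_zero r).searchable

/-- The children that make `v` the root of an unstable associated-tree. -/
def UnstableAt (G : SimpleGraph V) (father : V → Option V) (m : V → ℕ) (unst : V → Prop)
    (v : V) : Prop :=
  ∃ w₁ w₂ : V, w₁ ≠ w₂ ∧ father w₁ = some v ∧ father w₂ = some v ∧ ¬ unst w₁ ∧ ¬ unst w₂ ∧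
    m w₁ = m v ∧ m w₂ = m v ∧
    ∀ d, father d = some v → d ≠ w₁ → d ≠ w₂ →
      Searchable G (assoc father m unst v ∩ Desc father d) (m v - 1)

/-- What the decomposition computed at `v` tells about the tree rooted at `v`. -/
structure NodeInv (G : SimpleGraph V) (father : V → Option V) (m : V → ℕ) (unst : V → Prop)
    (hd : V → HD) (v : V) : Prop where
  pn_eq : pn G (assoc father m unst v) = m v
  cases :
    (unst v ∧ 2 ≤ m v ∧ (hd v).vect = (-1, -1) ∧ ¬ Endable G (assoc father m unst v) (m v) v ∧
      UnstableAt G father m unst v) ∨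
    (¬ unst v ∧
      ((m v = 0 ∧ (hd v).vect = (0, 0) ∧ assoc father m unst v = {v}) ∨
       (m v = 1 ∧ (hd v).vect = (1, 1) ∧ Endable G (assoc father m unst v) 1 v) ∨
       (m v = 1 ∧ (hd v).vect = (1, 2) ∧ ¬ Endable G (assoc father m unst v) 1 v) ∨
       (2 ≤ m v ∧ (hd v).vect = ((m v : ℤ), (m v : ℤ)) ∧
        Endable G (assoc father m unst v) (m v) v)))
  cell_eq : ∀ i, cell (hd v).table i = {w ∈ roots father m unst v | unst w ∧ m w = i}.ncard
  cell_le : ∀ i, cell (hd v).table i ≤ 1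
  cell_one : cell (hd v).table 1 = 0
  length : IsGreatest (m '' roots father m unst v) (hd v).table.length

namespace NodeInv

variable {v : V} (hI : NodeInv G father m unst hd v)
include hI

lemma two_le (hu : unst v) : 2 ≤ m v := by
  rcases hI.cases with h | h
  · exact h.2.1
  · exact absurd hu h.1

lemma vect_of_unst (hu : unst v) : (hd v).vect = (-1, -1) := by
  rcases hI.cases with h | h
  · exact h.2.2.1
  · exact absurd hu h.1

lemma fst_of_stable (hu : ¬ unst v) : (hd v).vect.1 = m v := by
  rcases hI.cases with h | ⟨_, ⟨h, h', _⟩ | ⟨h, h', _⟩ | ⟨h, h', _⟩ | ⟨_, h', _⟩⟩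
  · exact absurd h.1 hu
  all_goals simp_all

lemma fst_eq_iff {a : ℕ} : (hd v).vect.1 = a ↔ ¬ unst v ∧ m v = a := by
  by_cases hu : unst v
  · simp only [hI.vect_of_unst hu, hu, not_true_eq_false, false_and, iff_false]
    omega
  · simp only [hI.fst_of_stable hu, hu, not_false_eq_true, true_and]
    omega

lemma vect_ne_iff : (hd v).vect ≠ (-1, -1) ↔ ¬ unst v := by
  by_cases hu : unst v
  · simp [hI.vect_of_unst hu, hu]
  · simp only [hu, not_false_eq_true, iff_true]
    intro h
    have := hI.fst_of_stable hu
    rw [h] at this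
    simp only at this
    omega

lemma good : GoodMsg (hd v) where
  vect := by
    rcases hI.cases with h | ⟨_, ⟨_, h, _⟩ | ⟨_, h, _⟩ | ⟨_, h, _⟩ | ⟨h2, h, _⟩⟩
    · exact Or.inl h.2.2.1
    · exact Or.inr (Or.inl h)
    · exact Or.inr (Or.inr (Or.inl h))
    · exact Or.inr (Or.inr (Or.inr (Or.inl h)))
    · exact Or.inr (Or.inr (Or.inr (Or.inr ⟨m v, by omega, h⟩)))
  le_length := by
    have h1 : m v ≤ (hd v).table.length := hI.length.2 ⟨v, mem_roots_self v, rfl⟩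
    by_cases hu : unst v
    · rw [hI.vect_of_unst hu]; simp only; omega
    · rw [hI.fst_of_stable hu]; omega
  cell_one := hI.cell_one

lemma not_searchable {i : ℕ} (hi : i < m v) : ¬ Searchable G (assoc father m unst v) i :=
  fun h => absurd (pn_le h) (by rw [hI.pn_eq]; omega)

lemma searchable [Finite V] : Searchable G (assoc father m unst v) (m v) :=
  hI.pn_eq ▸ pn_spec _

lemma endable (hu : ¬ unst v) (h2 : 2 ≤ m v) : Endable G (assoc father m unst v) (m v) v := by
  rcases hI.cases with h | ⟨_, ⟨h, _, _⟩ | ⟨h, _, _⟩ | ⟨h, _, _⟩ | ⟨_, _, h⟩⟩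
  · exact absurd h.1 hu
  · omega
  · omega
  · omega
  · exact h

lemma one_le_cell [Finite V] {i : ℕ} (hi : 1 ≤ cell (hd v).table i) :
    ∃ w ∈ roots father m unst v, unst w ∧ m w = i := by
  rw [hI.cell_eq] at hi
  obtain ⟨w, hw⟩ := (Set.ncard_pos (Set.toFinite _)).1 hi
  exact ⟨w, hw.1, hw.2⟩

lemma cell_eq_one [Finite V] {w : V} (hw : w ∈ roots father m unst v) (hu : unst w) :
    cell (hd v).table (m w) = 1 := by
  have h1 := hI.cell_le (m w)
  have h2 := hI.cell_eq (m w)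
  have h3 := (Set.ncard_pos (Set.toFinite {x ∈ roots father m unst v | unst x ∧ m x = m w})).2
    ⟨w, hw, hu, rfl⟩
  omega

lemma eq_of_level [Finite V] {w w' : V} (hw : w ∈ roots father m unst v)
    (hw' : w' ∈ roots father m unst v) (hu : unst w) (hu' : unst w') (hm : m w = m w') :
    w = w' := by
  have h1 := hI.cell_le (m w')
  rw [hI.cell_eq] at h1
  exact (Set.ncard_le_one (Set.toFinite _)).1 h1 w ⟨hw, hu, hm⟩ w' ⟨hw', hu', rfl⟩

end NodeInv

namespace Rooted

variable (h : Rooted G father τ)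
include h

/-- Among the nodes of `S` other than `v`, one with maximal `τ` has its father in `S`; as the father
comes later, it can only be `v`. -/
lemma exists_child_mem [Finite V] {v : V} {S : Set V} (hS : AncClosed father v S) (hne : S ≠ {v}) :
    ∃ y ∈ S, father y = some v := by
  have hne' : (S \ {v}).Nonempty := by
    by_contra hcon
    rw [Set.not_nonempty_iff_eq_empty, Set.sdiff_eq_empty] at hcon
    exact hne (hcon.antisymm (by simpa using hS.root))
  obtain ⟨u, hu, hmax⟩ := (Set.toFinite (S \ {v})).exists_maximalFor τ _ hne'
  obtain ⟨f, hf, hf'⟩ := hS.closed u hu.1 hu.2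
  refine ⟨u, hu.1, ?_⟩
  by_cases hfv : f = v
  · exact hfv ▸ hf'
  · have h1 := h.lt _ _ hf'
    have h2 := hmax (j := f) ⟨hf, hfv⟩ h1.le
    omega

/-- The part of the decomposition at `c` inside an unstable associated-tree's branch. -/
lemma not_mem_desc_of_lower {c w u : V} {i : ℕ} (hw : w ∈ roots father m unst c) (hu : unst w)
    (hi : i < m w) (huw : u ∈ Desc father w) : u ∉ lower father m unst c i := by
  rintro ⟨y, hy, hm, huy⟩
  obtain ⟨z, hz, huz⟩ := exists_root_of_mem_desc (m := m) (unst := unst) huw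
  obtain rfl := h.eq_of_mem_assoc hy (roots_trans hw hz) huy huz
  by_cases hyw : y = w
  · subst hyw
    have := hm hu
    omega
  · obtain ⟨h1, h2⟩ := unst_of_mem_roots hz hyw
    have := hm h1
    omega

/-- Below `x`, the decomposition at `c` coincides with that at `x`, whose trees other than that of
`x` all have a larger level. -/
lemma lower_inter_desc {c x : V} (hx : x ∈ roots father m unst c) :
    lower father m unst c (m x) ∩ Desc father x = assoc father m unst x := by
  ext u
  constructor
  · rintro ⟨⟨y, hy, hm, huy⟩, hux⟩
    obtain ⟨z, hz, huz⟩ := exists_root_of_mem_desc (m := m) (unst := unst) hux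
    obtain rfl := h.eq_of_mem_assoc hy (roots_trans hx hz) huy huz
    by_cases hyx : y = x
    · exact hyx ▸ huy
    · obtain ⟨h1, h2⟩ := unst_of_mem_roots hz hyx
      have := hm h1
      omega
  · intro hu
    exact ⟨⟨x, hx, fun _ => le_rfl, hu⟩, assoc_subset_desc _ hu⟩

/-- The restrictions of a decomposition are as easy to process as their associated-trees. -/
lemma searchable_lower [Finite V] {c : V}
    (hI : ∀ x ∈ Desc father c, NodeInv G father m unst hd x) (i : ℕ)
    (hc : ¬ unst c → m c ≤ i) : Searchable G (lower father m unst c i) i := by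
  have hIc := hI c (self_mem_desc c)
  induction i with
  | zero =>
    by_cases hu : unst c
    · rw [lower_eq_empty hu (by have := hIc.two_le hu; omega)]
      exact searchable_empty 0
    · rw [lower_eq_assoc hu (Nat.zero_le _)]
      exact hIc.searchable.mono (hc hu)
  | succ i ih =>
    by_cases hcs : ¬ unst c ∧ m c = i + 1
    -- All other trees lie above the level of the stable one, so nothing else is present.
    · rw [lower_eq_assoc hcs.1 hcs.2.ge]
      exact hIc.searchable.mono hcs.2.le
    · have ih := ih fun hu => by
        have := hc hu
        have : m c ≠ i + 1 := fun e => hcs ⟨hu, e⟩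
        omega
      by_cases hx : ∃ x ∈ roots father m unst c, unst x ∧ m x = i + 1
      -- The tree of `x` is the only unstable one of its level. Its two stable subtrees are joined
      -- through `x`, while its other branches and all nodes that are not descendants of `x` need
      -- only `i` agents.
      · obtain ⟨x, hx, hux, hmx⟩ := hx
        have hIx := hI x (roots_subset_desc _ hx)
        have h2 := hIx.two_le hux
        obtain ⟨p, hp⟩ : ∃ p, i = p + 1 := ⟨i - 1, by omega⟩
        obtain ⟨w₁, w₂, hne, hf₁, hf₂, hs₁, hs₂, hm₁, hm₂, hD⟩ :
            UnstableAt G father m unst x := by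
          rcases hIx.cases with h | h
          · exact h.2.2.2.2
          · exact absurd hux h.1
        have hint : lower father m unst c (i + 1) ∩ Desc father x = assoc father m unst x := by
          rw [← hmx]; exact h.lower_inter_desc hx
        have hsub : ∀ d, father d = some x → lower father m unst c (i + 1) ∩ Desc father d =
            assoc father m unst x ∩ Desc father d := by
          intro d hd
          rw [← hint, Set.inter_assoc, Set.inter_eq_self_of_subset_right (desc_subset_of_child hd)]
        have hw : ∀ w, father w = some x → ¬ unst w → m w = m x →
            lower father m unst c (i + 1) ∩ Desc father w = assoc father m unst w := by
          intro w hw hsw hmw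
          rw [hsub w hw, assoc_eq_joined, h.joined_inter_desc hw, lower_eq_assoc hsw hmw.ge]
        have hE : ∀ w, father w = some x → ¬ unst w → m w = m x →
            Endable G (lower father m unst c (i + 1) ∩ Desc father w) (i + 1) w := by
          intro w hf hsw hmw
          rw [hw w hf hsw hmw]
          have := (hI w (desc_subset (roots_subset_desc _ hx) (child_mem_desc hf))).endable hsw
            (by omega)
          rwa [hmw, hmx] at this
        have hmem : ∀ w, father w = some x → ¬ unst w → m w = m x →
            w ∈ lower father m unst c (i + 1) := by
          intro w hf hsw hmw
          have := mem_assoc_self (father := father) (m := m) (unst := unst) w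
          rw [← hw w hf hsw hmw] at this
          exact this.1
        subst hp
        refine h.searchable_of_two (v := x) (c := w₁) (c' := w₂)
          (assoc_subset_lower hx (fun _ => hmx.le) (mem_assoc_self x)) hf₁ hf₂ hne
          (hmem _ hf₁ hs₁ hm₁) (hmem _ hf₂ hs₂ hm₂) (hE _ hf₁ hs₁ hm₁) (hE _ hf₂ hs₂ hm₂) ?_ ?_
        · intro d hd h1 h2
          rw [hsub d hd]
          have := hD d hd h1 h2
          rwa [hmx] at this
        · refine ih.subset ?_
          rintro u ⟨⟨y, hy, hm, huy⟩, hux'⟩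
          refine ⟨y, hy, fun huy' => ?_, huy⟩
          have h1 := hm huy'
          have h2 : m y ≠ p + 1 + 1 := by
            intro e
            obtain rfl := hIc.eq_of_level hy hx huy' hux (by omega)
            exact hux' (assoc_subset_desc _ huy)
          omega
      · push Not at hx
        rw [lower_eq_of_forall (Nat.le_succ i) (fun x hxr hux hmx => by
          have := hx x hxr hux
          omega)]
        exact ih.mono (Nat.le_succ i)

/-- An unstable associated-tree of process number `k` next to another part of process number at
least `k` makes the process number greater than `k`. -/
lemma not_searchable_joined [Finite V] {v c w : V} {k : ℕ} {Y : Set V} (hc : father c = some v)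
    (hI : ∀ x ∈ Desc father c, NodeInv G father m unst hd x)
    (hw : w ∈ roots father m unst c) (hu : unst w) (hk : m w = k)
    (hY : Y ⊆ joined father m unst v k) (hYw : Disjoint Y (Desc father w))
    (hYk : ¬ Searchable G Y (k - 1)) : ¬ Searchable G (joined father m unst v k) k := by
  have hIw := hI w (roots_subset_desc _ hw)
  have h2 := hIw.two_le hu
  obtain ⟨w₁, w₂, hne, hf₁, hf₂, hs₁, hs₂, hm₁, hm₂, hD⟩ : UnstableAt G father m unst w := by
    rcases hIw.cases with h | h
    · exact h.2.2.2.2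
    · exact absurd hu h.1
  have hwc := roots_subset_desc _ hw
  have hww : Desc father w ⊆ Desc father c := desc_subset hwc
  have hJ := h.joined_ancClosed (m := m) (unst := unst) v k
  obtain ⟨f, hf, hfJ, hfw⟩ : ∃ f, father w = some f ∧ f ∈ joined father m unst v k ∧
      f ∉ Desc father w := by
    have hwJ : w ∈ joined father m unst v k :=
      assoc_subset_joined hc hw (fun _ => hk.le) (mem_assoc_self w)
    obtain ⟨f, hf, hf'⟩ := hJ.closed w hwJ (fun e => h.notMem_desc_child hc (e ▸ hwc))
    exact ⟨f, hf', hf, h.notMem_desc_child hf'⟩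
  have hX : AncClosed father v (joined father m unst v k \ Desc father w) :=
    { root := ⟨hJ.root, fun hv => h.notMem_desc_child hc (hww hv)⟩
      sub := Set.sdiff_subset.trans hJ.sub
      closed := by
        rintro u ⟨hu, huw⟩ hne
        obtain ⟨f', hf1, hf2⟩ := hJ.closed u hu hne
        exact ⟨f', ⟨hf1, fun hf3 => huw (mem_desc_of_father hf2 hf3)⟩, hf2⟩ }
  have hA : ∀ x, father x = some w → ¬ unst x → m x = m w →
      assoc father m unst x ⊆ joined father m unst v k := by
    intro x hx hsx hmx
    refine Set.Subset.trans ?_ (assoc_subset_joined hc hw (fun _ => hk.le))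
    rw [assoc_eq_joined w]
    exact assoc_subset_joined hx (mem_roots_self x) (fun h1 => absurd h1 hsx)
  have hn : ∀ x, father x = some w → ¬ unst x → m x = m w →
      ¬ Searchable G (assoc father m unst x) (k - 1) := by
    intro x hx hsx hmx
    exact (hI x (hww (child_mem_desc hx))).not_searchable (by omega)
  -- The three branches at `w` are the stable trees of its two distinguished children and everything
  -- that is not below `w`. The last one contains `Y` and is attached to `w` through its father.
  have := not_searchable_of_three (G := G) (S := joined father m unst v k)
    (A := assoc father m unst w₁) (B := assoc father m unst w₂)
    (C := joined father m unst v k \ Desc father w) (q := k - 1) (x := w)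
    (assoc_subset_joined hc hw (fun _ => hk.le) (mem_assoc_self w))
    (hA _ hf₁ hs₁ hm₁) (hA _ hf₂ hs₂ hm₂) Set.sdiff_subset
    ((h.disjoint_desc hf₁ hf₂ hne).mono (assoc_subset_desc _) (assoc_subset_desc _))
    (Set.disjoint_left.2 fun u hu hu' =>
      hu'.2 (desc_subset_of_child hf₁ (assoc_subset_desc _ hu)))
    (Set.disjoint_left.2 fun u hu hu' =>
      hu'.2 (desc_subset_of_child hf₂ (assoc_subset_desc _ hu)))
    (fun hu => h.notMem_desc_child hf₁ (assoc_subset_desc _ hu))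
    (fun hu => h.notMem_desc_child hf₂ (assoc_subset_desc _ hu))
    (fun hu => hu.2 (self_mem_desc w))
    (h.conn ((h.assoc_ancClosed w₁).insert_father hf₁))
    (h.conn ((h.assoc_ancClosed w₂).insert_father hf₂))
    (h.conn (hX.insert_child ⟨hfJ, hfw⟩ hf))
    (hn _ hf₁ hs₁ hm₁) (hn _ hf₂ hs₂ hm₂)
    (fun hs => hYk (by
      refine hs.subset ?_
      exact fun u hu => ⟨hY hu, Set.disjoint_left.1 hYw hu⟩))
  rwa [show k - 1 + 1 = k by omega] at this

end Rooted

end Invariant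

/-! ### The local merge preserves the invariant. -/

section Merge

variable {V : Type*} {G : SimpleGraph V} {father : V → Option V} {τ : V → ℕ} {m : V → ℕ}
  {unst : V → Prop} {hd : V → HD} {v : V} {inb : List V}

/-- The situation at `v` after the local merge of the decompositions of its children `inb`. -/
structure MergeStep (G : SimpleGraph V) (father : V → Option V) (m : V → ℕ) (unst : V → Prop)
    (hd : V → HD) (v : V) (inb : List V) : Prop where
  nodup : inb.Nodup
  mem_iff : ∀ c, c ∈ inb ↔ father c = some v
  inv : ∀ c, father c = some v → ∀ x ∈ Desc father c, NodeInv G father m unst hd x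
  outcome : Outcome (inb.map hd) (hd v) (m v)
  unst_iff : unst v ↔ (hd v).vect.1 < 0

lemma Rooted.assoc_inter_desc (h : Rooted G father τ) {c : V} (hc : father c = some v) :
    assoc father m unst v ∩ Desc father c = lower father m unst c (m v) := by
  rw [assoc_eq_joined, h.joined_inter_desc hc]

lemma Rooted.assoc_inter_desc_of_eq (h : Rooted G father τ) {c : V} (hc : father c = some v) (hs : ¬ unst c)
    (hm : m c = m v) : assoc father m unst v ∩ Desc father c = assoc father m unst c := by
  rw [h.assoc_inter_desc hc, lower_eq_assoc hs hm.ge]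

lemma assoc_subset_assoc {c : V} (hc : father c = some v) (hs : ¬ unst c) :
    assoc father m unst c ⊆ assoc father m unst v := by
  rw [assoc_eq_joined v]
  exact assoc_subset_joined hc (mem_roots_self c) fun hu => absurd hu hs

namespace MergeStep

variable (M : MergeStep G father m unst hd v inb)
include M

lemma child {c : V} (hc : c ∈ inb) : NodeInv G father m unst hd c :=
  M.inv c ((M.mem_iff c).1 hc) c (self_mem_desc c)

lemma tsum_eq (i : ℕ) : tsum (inb.map hd) i = inb.countP fun c => cell (hd c).table i = 1 :=
  tsum_eq_countP fun _ hc => (M.child hc).cell_le i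

lemma good : ∀ g ∈ inb.map hd, GoodMsg g := by
  intro g hg
  obtain ⟨c, hc, rfl⟩ := List.mem_map.1 hg
  exact (M.child hc).good

lemma exists_level [Finite V] {i : ℕ} (hi : 1 ≤ tsum (inb.map hd) i) :
    ∃ c, father c = some v ∧ ∃ w ∈ roots father m unst c, unst w ∧ m w = i := by
  rw [M.tsum_eq] at hi
  obtain ⟨c, hc, h1⟩ := exists_of_one_le_countP hi
  exact ⟨c, (M.mem_iff c).1 hc, (M.child hc).one_le_cell h1.ge⟩

lemma cell_pos_of_root [Finite V] {c w : V} (hc : father c = some v)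
    (hw : w ∈ roots father m unst c) (hu : unst w) : 1 ≤ tsum (inb.map hd) (m w) := by
  rw [M.tsum_eq]
  have hc := (M.mem_iff c).2 hc
  exact List.countP_pos_iff.2 ⟨c, hc, by simpa using (M.child hc).cell_eq_one hw hu⟩

lemma stable_iff {c : V} (hc : c ∈ inb) {a : ℕ} :
    (hd c).vect.1 = a ↔ ¬ unst c ∧ m c = a := (M.child hc).fst_eq_iff

lemma level_le {c : V} (hc : father c = some v) (hs : ¬ unst c) : m c ≤ m v := by
  have h1 := M.outcome.le (hd c) (List.mem_map_of_mem ((M.mem_iff c).2 hc))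
  rw [(M.child ((M.mem_iff c).2 hc)).fst_of_stable hs] at h1
  omega

lemma not_unst_of_nonneg (hv : 0 ≤ (hd v).vect.1) : ¬ unst v := by
  rw [M.unst_iff]; omega

/-- No tree of level `m v` comes from `c`: `ht` excludes the unstable ones and `hs` the stable one.
The branch is therefore the part of the decomposition at `c` up to level `m v - 1`. -/
lemma searchable_inter (h : Rooted G father τ) [Finite V] {c : V} (hc : father c = some v)
    (ht : tsum (inb.map hd) (m v) = 0) (hm : 1 ≤ m v) (hs : ¬ unst c → m c ≠ m v) :
    Searchable G (assoc father m unst v ∩ Desc father c) (m v - 1) := by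
  rw [h.assoc_inter_desc hc, lower_eq_of_forall (Nat.sub_le (m v) 1)]
  · refine h.searchable_lower (M.inv c hc) _ fun hu => ?_
    have := M.level_le hc hu
    have := hs hu
    omega
  · intro x hx hu hxm
    have h1 := M.cell_pos_of_root hc hx hu
    have : m x ≠ m v := fun e => by rw [e] at h1; omega
    omega

/-- The first two alternatives place an unstable tree of level `k` next to a second tree of that
level. The third gives three stable branches at `v`, the fourth a subtree that is already too
expensive, and the last a path with four nodes. -/
lemma not_searchable_of_base (h : Rooted G father τ) [Finite V] {k : ℕ}
    (hb : Base (inb.map hd) k) : ¬ Searchable G (joined father m unst v k) k := by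
  have hself : ∀ c, father c = some v → ¬ unst c →
      assoc father m unst c ⊆ joined father m unst v k := fun c hc hs =>
    assoc_subset_joined hc (mem_roots_self c) fun hu => absurd hu hs
  have hv : v ∈ joined father m unst v k := Or.inl rfl
  rcases hb with hb | ⟨hb, hb'⟩ | ⟨hk, hb⟩ | ⟨g, hg, hgk⟩ | ⟨rfl, ⟨g, hg, hg1⟩, hact⟩
  · rw [M.tsum_eq] at hb
    obtain ⟨c₁, hc₁, c₂, hc₂, hne, h1, h2⟩ := exists_two_of_countP M.nodup hb
    obtain ⟨w₁, hw₁, hu₁, hm₁⟩ := (M.child hc₁).one_le_cell h1.ge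
    obtain ⟨w₂, hw₂, hu₂, hm₂⟩ := (M.child hc₂).one_le_cell h2.ge
    rw [M.mem_iff] at hc₁ hc₂
    have hI₂ := M.inv c₂ hc₂ w₂ (roots_subset_desc _ hw₂)
    have := hI₂.two_le hu₂
    refine h.not_searchable_joined hc₁ (M.inv c₁ hc₁) hw₁ hu₁ hm₁
      (assoc_subset_joined hc₂ hw₂ fun _ => hm₂.le) ?_ (hI₂.not_searchable (by omega))
    exact (h.disjoint_desc hc₂ hc₁ hne.symm).mono
      ((assoc_subset_desc _).trans (desc_subset (roots_subset_desc _ hw₂)))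
      (desc_subset (roots_subset_desc _ hw₁))
  · obtain ⟨c, hc, w, hw, hu, hm⟩ := M.exists_level hb
    rw [cnt_map] at hb'
    obtain ⟨c', hc', hv'⟩ := exists_of_one_le_countP hb'
    obtain ⟨hs', hm'⟩ := (M.stable_iff hc').1 hv'
    have hI' := M.child hc'
    rw [M.mem_iff] at hc'
    have hw2 := (M.inv c hc w (roots_subset_desc _ hw)).two_le hu
    refine h.not_searchable_joined hc (M.inv c hc) hw hu hm (hself c' hc' hs') ?_
      (hI'.not_searchable (by omega))
    by_cases hcc : c = c'
    · subst hcc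
      -- Both trees belong to the same child. The stable one is the lower part of its decomposition
      -- and avoids all descendants of `w`.
      rw [← lower_eq_assoc hs' (Nat.zero_le _)]
      exact Set.disjoint_left.2 fun u hu' huw =>
        h.not_mem_desc_of_lower hw hu (by omega) huw hu'
    · exact (h.disjoint_desc hc' hc (Ne.symm hcc)).mono (assoc_subset_desc _)
        (desc_subset (roots_subset_desc _ hw))
  · rw [cnt_map] at hb
    obtain ⟨a, ha, b, hb, c, hc, hab, hac, hbc, pa, pb, pc⟩ := exists_three_of_countP M.nodup hb
    have hn : ∀ c ∈ inb, (hd c).vect.1 = (k : ℤ) →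
        ¬ unst c ∧ ¬ Searchable G (assoc father m unst c) (k - 1) := fun c hc e => by
      obtain ⟨h1, h2⟩ := (M.stable_iff hc).1 e
      exact ⟨h1, (M.child hc).not_searchable (by omega)⟩
    obtain ⟨sa, na⟩ := hn a ha pa
    obtain ⟨sb, nb⟩ := hn b hb pb
    obtain ⟨sc, nc⟩ := hn c hc pc
    rw [M.mem_iff] at ha hb hc
    have hd : ∀ {a b}, father a = some v → father b = some v → a ≠ b →
        Disjoint (assoc father m unst a) (assoc father m unst b) := fun ha hb hne =>
      (h.disjoint_desc ha hb hne).mono (assoc_subset_desc _) (assoc_subset_desc _)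
    have hnot : ∀ {a}, father a = some v → v ∉ assoc father m unst a := fun ha hva =>
      h.notMem_desc_child ha (assoc_subset_desc _ hva)
    have := not_searchable_of_three hv (hself a ha sa) (hself b hb sb) (hself c hc sc)
      (hd ha hb hab) (hd ha hc hac) (hd hb hc hbc) (hnot ha) (hnot hb) (hnot hc)
      (h.conn ((h.assoc_ancClosed a).insert_father ha))
      (h.conn ((h.assoc_ancClosed b).insert_father hb))
      (h.conn ((h.assoc_ancClosed c).insert_father hc)) na nb nc
    rwa [Nat.sub_add_cancel hk] at this
  · obtain ⟨c, hc, rfl⟩ := List.mem_map.1 hg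
    have hs : ¬ unst c := fun hu => by
      rw [(M.child hc).vect_of_unst hu] at hgk
      simp only at hgk
      omega
    rw [(M.child hc).fst_of_stable hs] at hgk
    exact fun hs' => (M.child hc).not_searchable (i := k) (by omega)
      (hs'.subset (hself c ((M.mem_iff c).1 hc) hs))
  · obtain ⟨c, hc, rfl⟩ := List.mem_map.1 hg
    obtain ⟨hs, hm⟩ := (M.stable_iff (a := 1) hc).1 hg1
    have hI := M.child hc
    have hfc := (M.mem_iff c).1 hc
    have hadj : ∀ {a b}, father a = some b → G.Adj b a := fun hab =>
      (h.adj_iff _ _).2 (Or.inr hab)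
    have hvd : ∀ {x c}, father c = some v → x ∈ Desc father c → v ≠ x := fun hc hx e =>
      h.notMem_desc_child hc (e ▸ hx)
    -- If one agent can end at `c`, the vector of `c` is `(1, 1)`. As `N_v` differs from this single
    -- vector, there is a second stable child `c'`, and the path is `y, c, v, c'`.
    by_cases hE : Endable G (assoc father m unst c) 1 c
    · have hvect : (hd c).vect = (1, 1) := by
        rcases hI.cases with h' | ⟨_, ⟨h', _⟩ | ⟨_, h', _⟩ | ⟨_, _, h'⟩ | ⟨h', _⟩⟩
        · exact absurd h'.1 hs
        · omega
        · exact h'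
        · exact absurd hE h'
        · omega
      obtain ⟨c', hc', hs', hne⟩ : ∃ c' ∈ inb, ¬ unst c' ∧ c' ≠ c := by
        by_contra hcon
        push Not at hcon
        refine hact ?_
        rw [active_map, filter_eq_singleton (p := fun c => (hd c).vect ≠ (-1, -1)) M.nodup hc
          (hI.vect_ne_iff.2 hs) fun b hb hb' => hcon b hb ((M.child hb).vect_ne_iff.1 hb')]
        simp [hvect]
      have hfc' := (M.mem_iff c').1 hc'
      obtain ⟨y, hy, hfy⟩ := h.exists_child_mem (h.assoc_ancClosed (m := m) (unst := unst) c)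
        (fun e => hI.not_searchable (i := 0) (by omega) (e ▸ searchable_singleton_zero c))
      exact not_searchable_one_of_path (hself c hfc hs hy) (hself c hfc hs (mem_assoc_self c)) hv
        (hself c' hfc' hs' (mem_assoc_self c')) (hadj hfy).symm (hadj hfc).symm (hadj hfc')
        (hvd hfc (child_mem_desc hfy)).symm hne.symm
    -- Otherwise some branch at `c` cannot be processed without agents and has at least two nodes,
    -- so there is a path `v, c, y, z` going down.
    · obtain ⟨y, hfy, hy⟩ : ∃ y, father y = some c ∧
          ¬ Searchable G (assoc father m unst c ∩ Desc father y) 0 := by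
        by_contra hcon
        push Not at hcon
        exact hE (h.endable_of_children (mem_assoc_self c) (assoc_subset_desc c) hcon)
      rw [assoc_eq_joined, h.joined_inter_desc hfy] at hy
      obtain ⟨u, hu⟩ : (lower father m unst y (m c)).Nonempty := by
        by_contra hcon
        rw [Set.not_nonempty_iff_eq_empty] at hcon
        exact hy (hcon ▸ searchable_empty 0)
      obtain ⟨z, hz, hfz⟩ := h.exists_child_mem (h.lower_ancClosed hu)
        (fun e => hy (e ▸ searchable_singleton_zero y))
      have hsub : lower father m unst y (m c) ⊆ assoc father m unst c := by
        rw [assoc_eq_joined c]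
        exact fun u hu => Or.inr ⟨y, hfy, hu⟩
      refine not_searchable_one_of_path hv (hself c hfc hs (mem_assoc_self c))
        (hself c hfc hs (hsub (Rooted.root_mem_lower hu))) (hself c hfc hs (hsub hz)) (hadj hfc)
        (hadj hfy) (hadj hfz) (hvd hfc (child_mem_desc hfy)) ?_
      rintro rfl
      exact h.notMem_desc_child hfy (child_mem_desc hfz)

/-- If the part up to level `j` needs more than `j` agents and level `j + 1` contains an unstable
tree, that tree sees the lower part as its third expensive branch, so the obstruction moves up one
level. -/
lemma not_searchable_of_chain (h : Rooted G father τ) [Finite V] {k : ℕ}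
    (hb : Base (inb.map hd) k) {j : ℕ} (hkj : k ≤ j)
    (hj : ∀ i, k < i → i ≤ j → 1 ≤ tsum (inb.map hd) i) :
    ¬ Searchable G (joined father m unst v j) j := by
  induction j, hkj using Nat.le_induction with
  | base => exact M.not_searchable_of_base h hb
  | succ j hkj ih =>
    have ih := ih fun i h1 h2 => hj i h1 (by omega)
    obtain ⟨c, hc, w, hw, hu, hm⟩ := M.exists_level (hj (j + 1) (by omega) le_rfl)
    refine h.not_searchable_joined hc (M.inv c hc) hw hu hm (joined_mono (Nat.le_succ j)) ?_
      (by simpa using ih)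
    refine Set.disjoint_left.2 ?_
    rintro u (rfl | ⟨d, hd, hud⟩) huw
    · exact h.notMem_desc_child hc (desc_subset (roots_subset_desc _ hw) huw)
    · by_cases hcd : c = d
      · subst hcd
        exact h.not_mem_desc_of_lower hw hu (by omega) huw hud
      · exact Set.disjoint_left.1 (h.disjoint_desc hd hc (Ne.symm hcd)) (lower_subset_desc _ _ hud)
          (desc_subset (roots_subset_desc _ hw) huw)

/-- Below `m v` everything is absorbed, at `m v` the only possible root is `v`, and above it the
roots are those inherited from the children. There is at most one per level there, since the sum of
the tables is at most `1`. -/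
lemma cell_eq_ncard [Finite V] (i : ℕ) :
    cell (hd v).table i = {w ∈ roots father m unst v | unst w ∧ m w = i}.ncard := by
  have hO := M.outcome
  rcases lt_trichotomy i (m v) with hi | rfl | hi
  · rw [hO.cell_lt i hi, eq_comm, Set.ncard_eq_zero (Set.toFinite _),
      Set.eq_empty_iff_forall_notMem]
    rintro w ⟨hw, hu, rfl⟩
    by_cases hne : w = v
    · subst hne; omega
    · have := (unst_of_mem_roots hw hne).2
      omega
  · have hset : ∀ w ∈ roots father m unst v, m w = m v → w = v := fun w hw hm => by
      by_contra hne
      have := (unst_of_mem_roots hw hne).2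
      omega
    by_cases hu : unst v
    · have hc : cell (hd v).table (m v) = 1 := by
        rcases hO.cases with ⟨_, _, _, _, h1⟩ | ⟨_, h1⟩
        · exact h1
        · have := M.unst_iff.1 hu
          rcases h1 with ⟨_, h1, _⟩ | ⟨_, h1, _⟩ | ⟨_, h1, _⟩ | ⟨_, h1, _⟩ <;> rw [h1] at this <;>
            simp at this
          omega
      rw [hc, eq_comm, Set.ncard_eq_one]
      refine ⟨v, Set.eq_singleton_iff_unique_mem.2 ⟨⟨mem_roots_self v, hu, rfl⟩, ?_⟩⟩
      exact fun w hw => hset w hw.1 hw.2.2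
    · have hc : cell (hd v).table (m v) = 0 := by
        rcases hO.cases with ⟨_, h1, _⟩ | ⟨h1, _⟩
        · exact absurd (M.unst_iff.2 (by rw [h1]; norm_num)) hu
        · exact h1
      rw [hc, eq_comm, Set.ncard_eq_zero (Set.toFinite _), Set.eq_empty_iff_forall_notMem]
      rintro w ⟨hw, hu', hm⟩
      exact hu (hset w hw hm ▸ hu')
  · have hle := hO.tsum_le i hi
    rw [hO.cell_eq i hi]
    have hup : ∀ w ∈ roots father m unst v, unst w ∧ m w = i →
        ∃ c, father c = some v ∧ w ∈ roots father m unst c := by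
      rintro w hw ⟨hu, rfl⟩
      rcases mem_roots_iff.1 hw with rfl | ⟨c, hc, hwc, _⟩
      · omega
      · exact ⟨c, hc, hwc⟩
    rcases Nat.le_one_iff_eq_zero_or_eq_one.1 hle with h0 | h1
    · rw [h0, eq_comm, Set.ncard_eq_zero (Set.toFinite _), Set.eq_empty_iff_forall_notMem]
      rintro w ⟨hw, hu, hm⟩
      obtain ⟨c, hc, hwc⟩ := hup w hw ⟨hu, hm⟩
      have := M.cell_pos_of_root hc hwc hu
      rw [hm] at this
      omega
    · obtain ⟨c, hc, w, hw, hu, hm⟩ := M.exists_level h1.ge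
      rw [h1, eq_comm, Set.ncard_eq_one]
      refine ⟨w, Set.eq_singleton_iff_unique_mem.2 ⟨⟨InRoots.up hc hw hu (by omega), hu, hm⟩, ?_⟩⟩
      rintro w' ⟨hw', hu', hm'⟩
      obtain ⟨c', hc', hwc'⟩ := hup w' hw' ⟨hu', hm'⟩
      have hcin := (M.mem_iff c).2 hc
      have hcin' := (M.mem_iff c').2 hc'
      have hcc : c' = c := by
        rw [M.tsum_eq] at hle
        refine eq_of_countP_le_one hle hcin' hcin ?_ ?_
        · rw [← hm']; exact (M.child hcin').cell_eq_one hwc' hu'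
        · rw [← hm]; exact (M.child hcin).cell_eq_one hw hu
      subst hcc
      exact (M.child hcin).eq_of_level hwc' hw hu' hu (hm'.trans hm.symm)

lemma cell_le_one (i : ℕ) : cell (hd v).table i ≤ 1 := by
  have hO := M.outcome
  rcases lt_trichotomy i (m v) with hi | rfl | hi
  · rw [hO.cell_lt i hi]; exact Nat.zero_le _
  · rcases hO.cases with ⟨_, _, _, _, h1⟩ | ⟨h1, _⟩ <;> omega
  · rw [hO.cell_eq i hi]; exact hO.tsum_le i hi

lemma cell_one_eq_zero : cell (hd v).table 1 = 0 := by
  have hO := M.outcome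
  rcases lt_trichotomy 1 (m v) with hi | hi | hi
  · exact hO.cell_lt 1 hi
  · rcases hO.cases with ⟨_, _⟩ | ⟨h1, _⟩
    · omega
    · rw [hi]; exact h1
  · rw [hO.cell_eq 1 hi]; exact tsum_one M.good

lemma length_isGreatest : IsGreatest (m '' roots father m unst v) (hd v).table.length := by
  rw [M.outcome.length]
  constructor
  · rcases le_or_gt (tlen (inb.map hd)) (m v) with hle | hlt
    · exact ⟨v, mem_roots_self v, (max_eq_right hle).symm⟩
    · rw [max_eq_left hlt.le]
      have hne : inb ≠ [] := by
        rintro rfl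
        simp [tlen] at hlt
      obtain ⟨c, hc, hl⟩ := exists_tlen_eq (hd := hd) hne
      have hfc := (M.mem_iff c).1 hc
      obtain ⟨w, hw, hmw⟩ := (M.child hc).length.1
      rw [hl] at hmw
      by_cases hu : unst w
      · exact ⟨w, InRoots.up hfc hw hu (by omega), hmw⟩
      · have hwc : w = c := by
          by_contra hne
          exact hu (unst_of_mem_roots hw hne).1
        subst hwc
        have := M.level_le hfc hu
        omega
  · rintro _ ⟨w, hw, rfl⟩
    rcases mem_roots_iff.1 hw with rfl | ⟨c, hc, hwc, _⟩
    · exact le_max_right _ _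
    · have hcin := (M.mem_iff c).2 hc
      exact ((M.child hcin).length.2 ⟨w, hwc, rfl⟩).trans
        ((le_tlen (List.mem_map_of_mem hcin)).trans (le_max_left _ _))

/-- Exactly two branches at `v` need `m v` agents. They can be joined through `v`, but they prevent
any optimal strategy from ending there. -/
lemma unstable_case (h : Rooted G father τ) [Finite V] (h2 : 2 ≤ m v)
    (hcnt : cnt (inb.map hd) (m v) = 2) (ht : tsum (inb.map hd) (m v) = 0) :
    pn G (assoc father m unst v) = m v ∧ ¬ Endable G (assoc father m unst v) (m v) v ∧
      UnstableAt G father m unst v := by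
  rw [cnt_map] at hcnt
  obtain ⟨a, ha, b, hb, hne, pa, pb, hall⟩ := exists_pair_of_countP M.nodup hcnt
  obtain ⟨sa, ma⟩ := (M.stable_iff ha).1 pa
  obtain ⟨sb, mb⟩ := (M.stable_iff hb).1 pb
  have hIa := M.child ha
  have hIb := M.child hb
  have fa := (M.mem_iff a).1 ha
  have fb := (M.mem_iff b).1 hb
  have hD : ∀ d, father d = some v → d ≠ a → d ≠ b →
      Searchable G (assoc father m unst v ∩ Desc father d) (m v - 1) := by
    intro d hd hda hdb
    refine M.searchable_inter h hd ht (by omega) fun hs hm => ?_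
    have hdin := (M.mem_iff d).2 hd
    rcases hall d hdin ((M.stable_iff hdin).2 ⟨hs, hm⟩) with h1 | h1
    · exact hda h1
    · exact hdb h1
  obtain ⟨p, hp⟩ : ∃ p, m v = p + 2 := ⟨m v - 2, by omega⟩
  have hE : ∀ c, father c = some v → ¬ unst c → m c = m v →
      NodeInv G father m unst hd c →
      Endable G (assoc father m unst v ∩ Desc father c) (p + 2) c := by
    intro c hc hs hm hI
    rw [h.assoc_inter_desc_of_eq hc hs hm]
    have := hI.endable hs (by omega)
    rwa [hm, hp] at this
  refine ⟨?_, ?_, a, b, hne, fa, fb, sa, sb, ma, mb, hD⟩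
  · rw [hp]
    refine pn_eq_of ?_ ?_
    · refine h.searchable_of_two (mem_assoc_self v) fa fb hne
        (assoc_subset_assoc fa sa (mem_assoc_self a)) (assoc_subset_assoc fb sb (mem_assoc_self b))
        (hE a fa sa ma hIa) (hE b fb sb mb hIb) ?_ ?_
      · intro d hd hda hdb
        have := hD d hd hda hdb
        rwa [hp] at this
      · rw [Set.sdiff_eq_empty.2 (assoc_subset_desc v)]
        exact searchable_empty _
    · exact fun hs => hIa.not_searchable (i := p + 1) (by omega) (hs.subset (assoc_subset_assoc fa sa))
  · have := not_endable_of_two (q := p + 1) (mem_assoc_self v) (assoc_subset_assoc fa sa)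
      (assoc_subset_assoc fb sb)
      ((h.disjoint_desc fa fb hne).mono (assoc_subset_desc _) (assoc_subset_desc _))
      (fun hv => h.notMem_desc_child fa (assoc_subset_desc _ hv))
      (fun hv => h.notMem_desc_child fb (assoc_subset_desc _ hv))
      (h.conn ((h.assoc_ancClosed a).insert_father fa))
      (h.conn ((h.assoc_ancClosed b).insert_father fb))
      (hIa.not_searchable (by omega)) (hIb.not_searchable (by omega))
    rwa [hp]

/-- With at most one branch that needs `m v` agents, a strategy can end at `v`. That fewer agents do
not suffice follows from the chain of nonempty levels leading from the conflict at `k` to level `m v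
- 1`. -/
lemma stable_case (h : Rooted G father τ) [Finite V] (h2 : 2 ≤ m v)
    (hcnt : cnt (inb.map hd) (m v) ≤ 1) (ht : tsum (inb.map hd) (m v) = 0) {k : ℕ} (hk : k < m v)
    (hj : ∀ j, k < j → j < m v → 1 ≤ tsum (inb.map hd) j) (hb : Base (inb.map hd) k) :
    pn G (assoc father m unst v) = m v ∧ Endable G (assoc father m unst v) (m v) v := by
  obtain ⟨p, hp⟩ : ∃ p, m v = p + 2 := ⟨m v - 2, by omega⟩
  have hE : Endable G (assoc father m unst v) (m v) v := by
    -- The expensive branch, if there is one, is processed first. Otherwise an agent stays on `v`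
    -- throughout.
    by_cases hex : ∃ c, father c = some v ∧ ¬ unst c ∧ m c = m v
    · obtain ⟨c, fc, sc, mc⟩ := hex
      have hcin := (M.mem_iff c).2 fc
      rw [hp]
      refine h.endable_of_child (mem_assoc_self v) fc (assoc_subset_assoc fc sc (mem_assoc_self c)) ?_
        ?_
      · rw [h.assoc_inter_desc_of_eq fc sc mc]
        have := (M.child hcin).endable sc (by omega)
        rwa [mc, hp] at this
      · refine h.searchable_of_children (v := v)
          ((Set.sdiff_subset.trans Set.sdiff_subset).trans (assoc_subset_desc v))
          (fun hv => hv.2 rfl) fun d fd => ?_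
        by_cases hdc : d = c
        · subst hdc
          convert searchable_empty (G := G) (p + 1)
          rw [Set.eq_empty_iff_forall_notMem]
          exact fun u hu => hu.1.1.2 hu.2
        · have := M.searchable_inter h fd ht (by omega) fun sd md => hdc (by
            rw [cnt_map] at hcnt
            have hdin := (M.mem_iff d).2 fd
            exact eq_of_countP_le_one hcnt hdin hcin ((M.stable_iff hdin).2 ⟨sd, md⟩)
              ((M.stable_iff hcin).2 ⟨sc, mc⟩))
          rw [hp] at this
          refine this.subset ?_
          exact fun u hu => ⟨hu.1.1.1, hu.2⟩
    · push Not at hex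
      have := h.endable_of_children (p := m v - 1) (mem_assoc_self (m := m) (unst := unst) v)
        (assoc_subset_desc v) fun c fc => M.searchable_inter h fc ht (by omega) (hex c fc)
      rwa [Nat.sub_add_cancel (by omega)] at this
  refine ⟨?_, hE⟩
  rw [hp]
  rw [hp] at hE
  refine pn_eq_of (hE.searchable (mem_assoc_self v)) fun hs => ?_
  refine M.not_searchable_of_chain h hb (j := p + 1) (by omega)
    (fun i h1 h2 => hj i h1 (by omega)) (hs.subset ?_)
  rw [assoc_eq_joined v]
  exact joined_mono (by omega)

lemma nodeInv (h : Rooted G father τ) [Finite V] : NodeInv G father m unst hd v := by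
  suffices H : pn G (assoc father m unst v) = m v ∧
      ((unst v ∧ 2 ≤ m v ∧ (hd v).vect = (-1, -1) ∧ ¬ Endable G (assoc father m unst v) (m v) v ∧
      UnstableAt G father m unst v) ∨
    (¬ unst v ∧
      ((m v = 0 ∧ (hd v).vect = (0, 0) ∧ assoc father m unst v = {v}) ∨
       (m v = 1 ∧ (hd v).vect = (1, 1) ∧ Endable G (assoc father m unst v) 1 v) ∨
       (m v = 1 ∧ (hd v).vect = (1, 2) ∧ ¬ Endable G (assoc father m unst v) 1 v) ∨
       (2 ≤ m v ∧ (hd v).vect = ((m v : ℤ), (m v : ℤ)) ∧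
        Endable G (assoc father m unst v) (m v) v)))) from
    ⟨H.1, H.2, M.cell_eq_ncard, M.cell_le_one, M.cell_one_eq_zero, M.length_isGreatest⟩
  -- Unstable trees have level at least `2`, so a tree of process number at most `1` absorbs only
  -- the stable trees of the children.
  have hlow : ∀ {c}, father c = some v → unst c → m v ≤ 1 →
      assoc father m unst v ∩ Desc father c = ∅ := by
    intro c fc hu hm
    have := (M.child ((M.mem_iff c).2 fc)).two_le hu
    rw [h.assoc_inter_desc fc, lower_eq_empty hu (by omega)]
  have hsame : ∀ {c}, father c = some v → ¬ unst c → m v ≤ 1 →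
      assoc father m unst v ∩ Desc father c = assoc father m unst c := by
    intro c fc hs hm
    rw [h.assoc_inter_desc fc, lower_eq_of_forall (Nat.zero_le _), lower_eq_assoc hs (Nat.zero_le _)]
    intro x hx hu hxm
    have := (M.inv c fc x (roots_subset_desc _ hx)).two_le hu
    omega
  rcases M.outcome.cases with ⟨h2, hvect, hcnt, ht, hc⟩ | ⟨hc, hcase⟩
  · obtain ⟨h1, h3, h4⟩ := M.unstable_case h h2 hcnt ht
    exact ⟨h1, Or.inl ⟨M.unst_iff.2 (by rw [hvect]; norm_num), h2, hvect, h3, h4⟩⟩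
  · have hs : ¬ unst v := M.not_unst_of_nonneg (by
      rcases hcase with ⟨_, h1, _⟩ | ⟨_, h1, _⟩ | ⟨_, h1, _⟩ | ⟨_, h1, _⟩ <;> rw [h1] <;> simp)
    rcases hcase with ⟨hm, hvect, hall⟩ | ⟨hm, hvect, hall, hex⟩ | ⟨hm, hvect, hact⟩ |
      ⟨h2, hvect, ht, hcnt, k, hk, hj, hb⟩
    · have hS : assoc father m unst v = {v} := by
        by_contra hne
        obtain ⟨y, hy, fy⟩ := h.exists_child_mem (h.assoc_ancClosed v) hne
        have hyin := (M.mem_iff y).2 fy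
        have hu : unst y := by
          by_contra hs
          have h1 := (M.child hyin).fst_of_stable hs
          rw [hall (hd y) (List.mem_map_of_mem hyin)] at h1
          omega
        have := hlow fy hu (by omega)
        exact Set.eq_empty_iff_forall_notMem.1 this y ⟨hy, self_mem_desc y⟩
      exact ⟨by rw [hS, pn_singleton, hm], Or.inr ⟨hs, Or.inl ⟨hm, hvect, hS⟩⟩⟩
    · have hE : Endable G (assoc father m unst v) 1 v := by
        refine h.endable_of_children (p := 0) (mem_assoc_self v) (assoc_subset_desc v)
          fun c fc => ?_
        have hcin := (M.mem_iff c).2 fc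
        by_cases hu : unst c
        · rw [hlow fc hu hm.le]
          exact searchable_empty 0
        · have h1 := hall (hd c) (List.mem_map_of_mem hcin)
          rw [(M.child hcin).fst_of_stable hu] at h1
          have h0 : m c = 0 := by omega
          have hS : assoc father m unst c = {c} := by
            rcases (M.child hcin).cases with h' | ⟨_, ⟨_, _, h'⟩ | ⟨h', _⟩ | ⟨h', _⟩ | ⟨h', _⟩⟩
            · exact absurd h'.1 hu
            · exact h'
            all_goals omega
          rw [hsame fc hu hm.le, hS]
          exact searchable_singleton_zero c
      obtain ⟨g, hg, hg0⟩ := hex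
      obtain ⟨c, hcin, rfl⟩ := List.mem_map.1 hg
      have fc := (M.mem_iff c).1 hcin
      obtain ⟨sc, mc⟩ := (M.stable_iff (a := 0) hcin).1 hg0
      have hpn : pn G (assoc father m unst v) = 1 := pn_eq_of (p := 0) (hE.searchable (mem_assoc_self v))
        (not_searchable_zero (assoc_subset_assoc fc sc (mem_assoc_self c)) (mem_assoc_self v)
          ((h.adj_iff _ _).2 (Or.inl fc)))
      exact ⟨hpn.trans hm.symm, Or.inr ⟨hs, Or.inr (Or.inl ⟨hm, hvect, hE⟩)⟩⟩
    -- The only stable child `c` carries a star centred at `c`, and `v` is one more leaf of it. One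
    -- agent on `c` suffices, but the path `v, c, y` prevents it from ending at `v`.
    · rw [active_map] at hact
      obtain ⟨c, hfilter, hvc⟩ := List.map_eq_singleton_iff.1 hact
      obtain ⟨hcin, hvne⟩ := countP_filter_mem hfilter (a := c) (by simp)
      have fc := (M.mem_iff c).1 hcin
      have hI := M.child hcin
      have sc := hI.vect_ne_iff.1 hvne
      have hS : assoc father m unst v = insert v (assoc father m unst c) := by
        refine Set.Subset.antisymm ?_ (Set.insert_subset (mem_assoc_self v)
          (assoc_subset_assoc fc sc))
        intro u hu
        rcases mem_desc_iff.1 (assoc_subset_desc v hu) with rfl | ⟨d, fd, hud⟩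
        · exact Or.inl rfl
        · have hdin := (M.mem_iff d).2 fd
          have sd : ¬ unst d := fun hud' =>
            Set.eq_empty_iff_forall_notMem.1 (hlow fd hud' hm.le) u ⟨hu, hud⟩
          have hdc : d ∈ inb.filter fun c => (hd c).vect ≠ (-1, -1) :=
            List.mem_filter.2 ⟨hdin, by simpa using (M.child hdin).vect_ne_iff.2 sd⟩
          rw [hfilter, List.mem_singleton] at hdc
          subst hdc
          rw [← hsame fd sd hm.le]
          exact Or.inr ⟨hu, hud⟩
      obtain ⟨mc, hE⟩ : m c = 1 ∧ Endable G (assoc father m unst c) 1 c := by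
        rcases hI.cases with h' | ⟨_, ⟨_, h', _⟩ | ⟨h1, _, h'⟩ | ⟨_, h', _⟩ | ⟨h1, h', _⟩⟩
        · exact absurd h'.1 sc
        · rw [hvc] at h'; simp at h'
        · exact ⟨h1, h'⟩
        · rw [hvc] at h'; simp at h'
        · rw [hvc] at h'
          simp only [Prod.mk.injEq] at h'
          omega
      have hvc' : v ∉ assoc father m unst c := fun hv =>
        h.notMem_desc_child fc (assoc_subset_desc _ hv)
      have hadj : G.Adj c v := (h.adj_iff _ _).2 (Or.inl fc)
      have hcS := assoc_subset_assoc (m := m) fc sc (mem_assoc_self c)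
      have hpn : pn G (assoc father m unst v) = 1 := by
        refine pn_eq_of (p := 0) ?_ (not_searchable_zero hcS (mem_assoc_self v) hadj)
        rw [hS]
        refine hE.insert_leaf (mem_assoc_self c) hvc' fun a ha hav => ?_
        exact (h.eq_of_adj_of_notMem (assoc_subset_desc _ ha) (h.notMem_desc_child fc) hav).1
      obtain ⟨y, hy, fy⟩ := h.exists_child_mem (h.assoc_ancClosed (m := m) (unst := unst) c)
        (fun e => hI.not_searchable (i := 0) (by omega) (e ▸ searchable_singleton_zero c))
      have hn : ¬ Endable G (assoc father m unst v) 1 v :=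
        not_endable_one_of_path (mem_assoc_self v) hcS (assoc_subset_assoc fc sc hy) hadj.symm
          ((h.adj_iff _ _).2 (Or.inr fy)) (fun e => hvc' (e ▸ hy))
      exact ⟨hpn.trans hm.symm, Or.inr ⟨hs, Or.inr (Or.inr (Or.inl ⟨hm, hvect, hn⟩))⟩⟩
    · obtain ⟨h1, h3⟩ := M.stable_case h h2 hcnt ht hk hj hb
      exact ⟨h1, Or.inr ⟨hs, Or.inr (Or.inr (Or.inr ⟨h2, hvect, h3⟩))⟩⟩

end MergeStep

end Merge

/-- The process number of the associated-tree of the node that computes `h`. -/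
noncomputable def level (h : HD) : ℕ :=
  if h.vect.1 < 0 then sInf {i | cell h.table i ≠ 0} else h.vect.1.toNat

/-- For the vector `(-1, -1)` the level is not stored in the vector, but it is the lowest nonzero
cell of the table, since the cells below it have been emptied. -/
lemma Outcome.level_eq {msgs : List HD} {h : HD} {m : ℕ} (hO : Outcome msgs h m) :
    level h = m := by
  rcases hO.cases with ⟨_, hv, _, _, hc⟩ | ⟨_, hcase⟩
  · rw [level, if_pos (by rw [hv]; norm_num)]
    refine le_antisymm (Nat.sInf_le (by simp [hc])) ?_
    refine le_csInf ⟨m, by simp [hc]⟩ fun i hi => ?_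
    by_contra hlt
    exact hi (hO.cell_lt i (by omega))
  · rcases hcase with ⟨hm, h1, _⟩ | ⟨hm, h1, _⟩ | ⟨hm, h1, _⟩ | ⟨hm, h1, _⟩ <;>
      rw [level, h1, if_neg (by simp)] <;> simp [hm]

/-! ### From the invariant to minimal decompositions and the process number. -/

section Description

variable {V : Type*} {G : SimpleGraph V} {father : V → Option V} {τ : V → ℕ} {m : V → ℕ}
  {unst : V → Prop} {hd : V → HD} {v : V}

/-- Level and instability are read off the final data of all nodes at once, so the associated-trees
need no recursive construction along the execution. The invariant is then proved by strong induction
on `τ`. -/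
lemma Rooted.nodeInv_of_merge [Finite V] (h : Rooted G father τ) {inb : V → List V}
    (hnd : ∀ v, (inb v).Nodup) (hmem : ∀ v c, c ∈ inb v ↔ father c = some v)
    (hhd : ∀ v, hd v = (mergeMsgs ((inb v).map hd)).val) (v : V) :
    NodeInv G father (fun v => level (hd v)) (fun v => (hd v).vect.1 < 0) hd v := by
  suffices H : ∀ n v, τ v = n →
      NodeInv G father (fun v => level (hd v)) (fun v => (hd v).vect.1 < 0) hd v from H _ v rfl
  intro n
  induction n using Nat.strong_induction_on with
  | _ n ih =>
    rintro v rfl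
    have hinv : ∀ c, father c = some v → ∀ x ∈ Desc father c,
        NodeInv G father (fun v => level (hd v)) (fun v => (hd v).vect.1 < 0) hd x :=
      fun c hc x hx => ih _ ((h.le_of_mem_desc hx).trans_lt (h.lt _ _ hc)) x rfl
    have hg : ∀ g ∈ (inb v).map hd, GoodMsg g := by
      intro g hg
      obtain ⟨c, hc, rfl⟩ := List.mem_map.1 hg
      exact (hinv c ((hmem v c).1 hc) c (self_mem_desc c)).good
    obtain ⟨m, hm⟩ := (mergeMsgs_spec hg).1
    rw [← hhd v] at hm
    exact MergeStep.nodeInv (inb := inb v)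
      ⟨hnd v, hmem v, hinv, by simpa only [hm.level_eq] using hm, Iff.rfl⟩ h

namespace NodeInv

variable [Finite V] (h : Rooted G father τ) (hI : NodeInv G father m unst hd v)
include h hI

lemma stable_iff : Stable G (assoc father m unst v) v ↔ ¬ unst v := by
  have hv := mem_assoc_self (father := father) (m := m) (unst := unst) v
  have hpn := hI.pn_eq
  rcases hI.cases with ⟨hu, h2, _, hE, _⟩ | ⟨hs, hcase⟩
  · simp only [hu, not_true_eq_false, iff_false]
    obtain ⟨p, hp⟩ : ∃ p, m v = p + 2 := ⟨m v - 2, by omega⟩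
    rw [hp] at hE hpn
    exact not_stable (h.conn (h.assoc_ancClosed v)) hv hpn hE
  · simp only [hs, not_false_eq_true, iff_true]
    by_cases h2 : 2 ≤ m v
    · refine stable_of_endable hv ?_
      rw [hpn]
      exact hI.endable hs h2
    -- For process number at most `1`, a second agent waiting on `v` gives a two-agent strategy that
    -- ends there.
    · refine stable_of_endable_two hv (endable_of_searchable_diff hv ?_)
      exact (hI.searchable.mono (by omega)).subset Set.sdiff_subset

lemma pnPlus_of_unst (hu : unst v) : pnPlus G (assoc father m unst v) v = m v + 1 := by
  rcases hI.cases with ⟨_, h2, _, hE, _⟩ | ⟨hs, _⟩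
  · obtain ⟨p, hp⟩ : ∃ p, m v = p + 1 := ⟨m v - 1, by omega⟩
    have hpn := hI.pn_eq
    rw [hp] at hE hpn
    rw [pnPlus_eq_succ (h.conn (h.assoc_ancClosed v)) (mem_assoc_self v) hpn hE, hp]
  · exact absurd hu hs

lemma vect_eq (hu : ¬ unst v) : (hd v).vect =
    ((pn G (assoc father m unst v) : ℤ), (pnPlus G (assoc father m unst v) v : ℤ)) := by
  have hv := mem_assoc_self (father := father) (m := m) (unst := unst) v
  have hpn := hI.pn_eq
  rcases hI.cases with h' | ⟨_, ⟨hm, h', hS⟩ | ⟨hm, h', hE⟩ | ⟨hm, h', hE⟩ | ⟨h2, h', hE⟩⟩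
  · exact absurd h'.1 hu
  · rw [hS, pn_singleton, pnPlus_singleton, h']
    simp
  · rw [hm] at hpn
    rw [pnPlus_eq_of_endable hv hpn hE, hpn, h']
    simp
  · rw [hm] at hpn
    rw [pnPlus_eq_succ (h.conn (h.assoc_ancClosed v)) hv (p := 0) hpn hE, hpn, h']
    simp
  · rw [pnPlus_eq_of_endable hv hpn hE, hpn, h']

lemma unstableShape (hu : unst v)
    (hall : ∀ x, NodeInv G father m unst hd x) :
    UnstableShape G father (assoc father m unst) v := by
  obtain ⟨w₁, w₂, hne, f₁, f₂, s₁, s₂, m₁, m₂, hD⟩ : UnstableAt G father m unst v := by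
    rcases hI.cases with h' | h'
    · exact h'.2.2.2.2
    · exact absurd hu h'.1
  -- The subtrees at the other children are the absorbed lower parts. Children that contribute
  -- nothing are left out, because each subtree has to contain its root.
  refine ⟨w₁, w₂, hne, f₁, f₂, ((hall w₁).stable_iff h).2 s₁, ((hall w₂).stable_iff h).2 s₂, ?_, ?_,
    {d | father d = some v ∧ d ≠ w₁ ∧ d ≠ w₂ ∧ (lower father m unst d (m v)).Nonempty},
    fun d => lower father m unst d (m v), ?_, ?_⟩
  · rw [(hall w₁).pn_eq, hI.pn_eq, m₁]
  · rw [(hall w₂).pn_eq, hI.pn_eq, m₂]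
  · rintro d ⟨hd, h1, h2, u, hu'⟩
    refine ⟨hd, h1, h2, Rooted.root_mem_lower hu', ?_, h.connected (h.lower_ancClosed hu'), ?_⟩
    · rw [h.subtree_eq]
      exact lower_subset_desc _ _
    · have := pn_le (hD d hd h1 h2)
      rw [h.assoc_inter_desc hd] at this
      have h2 := hI.two_le hu
      rw [hI.pn_eq]
      exact lt_of_le_of_lt this (by omega)
  · refine Set.Subset.antisymm ?_ ?_
    · intro u hu'
      rcases mem_desc_iff.1 (assoc_subset_desc v hu') with rfl | ⟨d, fd, hud⟩
      · exact Or.inl (Or.inl (Or.inl rfl))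
      · by_cases h1 : d = w₁
        · subst h1
          rw [← h.assoc_inter_desc_of_eq f₁ s₁ m₁]
          exact Or.inl (Or.inl (Or.inr ⟨hu', hud⟩))
        · by_cases h2 : d = w₂
          · subst h2
            rw [← h.assoc_inter_desc_of_eq f₂ s₂ m₂]
            exact Or.inl (Or.inr ⟨hu', hud⟩)
          · have hul : u ∈ lower father m unst d (m v) := by
              rw [← h.assoc_inter_desc fd]
              exact ⟨hu', hud⟩
            exact Or.inr (Set.mem_biUnion (x := d) ⟨fd, h1, h2, u, hul⟩ hul)
    · refine Set.union_subset (Set.union_subset (Set.union_subset ?_ ?_) ?_) ?_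
      · exact Set.singleton_subset_iff.2 (mem_assoc_self v)
      · exact assoc_subset_assoc f₁ s₁
      · exact assoc_subset_assoc f₂ s₂
      · refine Set.iUnion₂_subset fun d hd => ?_
        simp only [← h.assoc_inter_desc hd.1]
        exact Set.inter_subset_left

end NodeInv

namespace Rooted

variable [Finite V] (h : Rooted G father τ) (hall : ∀ x, NodeInv G father m unst hd x)
include h hall

lemma isHierDecomp (v : V) :
    IsHierDecomp G father (assoc father m unst) v (roots father m unst v) where
  cover := by rw [iUnion_assoc_eq_desc, h.subtree_eq]
  disj := fun w hw w' hw' hne => Set.disjoint_left.2 fun u hu hu' =>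
    hne (h.eq_of_mem_assoc hw hw' hu hu')
  root_mem := fun w _ => mem_assoc_self w
  sub := fun w _ => by
    rw [h.subtree_eq]
    exact assoc_subset_desc w
  connected := fun w _ => h.connected (h.assoc_ancClosed w)
  increasing := by
    rintro x hx w hw ⟨f, hf, hfx⟩
    rw [(hall x).pn_eq, (hall w).pn_eq]
    exact (h.increasing hx hw hf hfx).2
  one_stable := by
    intro w hw w' hw' hs hs'
    rw [(hall _).stable_iff h] at hs hs'
    -- Roots inherited from a child are unstable by construction.
    have key : ∀ w ∈ roots father m unst v, ¬ unst w → w = v := fun w hw hs => by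
      by_contra hne
      exact hs (unst_of_mem_roots hw hne).1
    rw [key w hw hs, key w' hw' hs']
  stable_minimal := by
    rintro w hw hs x hx ⟨f, hf, hfx⟩
    exact ((hall w).stable_iff h).1 hs (h.increasing hx hw hf hfx).1
  unstable_shape := fun w _ hu =>
    (hall w).unstableShape h (not_not.1 (mt ((hall w).stable_iff h).2 hu)) hall

lemma describes (v : V) : Describes G (assoc father m unst) (roots father m unst v) (hd v) where
  vect_stable := by
    intro w hw hs
    rw [(hall w).stable_iff h] at hs
    have hwv : w = v := by
      by_contra hne
      exact hs (unst_of_mem_roots hw hne).1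
    subst hwv
    exact (hall w).vect_eq h hs
  vect_unstable := fun hu => (hall v).vect_of_unst (by
    have := hu v (mem_roots_self v)
    rwa [(hall v).stable_iff h, not_not] at this)
  table_length := by
    simp only [fun w => (hall w).pn_eq]
    exact (hall v).length
  table_cell := by
    intro i _ _
    rw [(hall v).cell_eq]
    congr 1
    ext w
    simp only [Set.mem_ofPred_eq, (hall w).stable_iff h, not_not, (hall w).pn_eq]
    constructor
    · rintro ⟨h1, h2, h3⟩
      exact ⟨h1, h2, h3, by rw [(hall w).pnPlus_of_unst h h2, h3]⟩
    · rintro ⟨h1, h2, h3, _⟩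
      exact ⟨h1, h2, h3⟩

/-- More is true than minimality asks for: every restriction `T_i` has process number at most `i`.
If the stable tree lies above level `i`, then `T_i` is empty, as all other trees lie higher still.
-/
lemma isMinimalHD (v : V) : IsMinimalHD G father (assoc father m unst) v
    (roots father m unst v) (hd v) := by
  refine ⟨h.isHierDecomp hall v, h.describes hall v, fun i _ => ?_⟩
  suffices hle : pn G (restricted G (assoc father m unst) (roots father m unst v) i) ≤ i by omega
  by_cases hv : ¬ unst v → m v ≤ i
  · refine pn_le ((h.searchable_lower (fun x _ => hall x) i hv).subset ?_)
    refine Set.iUnion₂_subset fun w hw => assoc_subset_lower hw.1 fun _ => ?_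
    have := hw.2
    rwa [(hall w).pn_eq] at this
  · push Not at hv
    have he : restricted G (assoc father m unst) (roots father m unst v) i = ∅ := by
      simp only [restricted, Set.iUnion_eq_empty]
      rintro w ⟨hw, hwi⟩
      rw [(hall w).pn_eq] at hwi
      by_cases hwv : w = v
      · subst hwv; omega
      · have := (unst_of_mem_roots hw hwv).2
        omega
    rw [he]
    exact pn_le (searchable_empty i)

-- Among the nodes that are not descendants of `r`, one with maximal `τ` would have a father that
-- comes later, hence a descendant of `r`.
omit hall in
lemma desc_eq_univ {r : V} (hr : ∀ v, father v = none → v = r) : Desc father r = Set.univ := by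
  by_contra hne
  obtain ⟨u, hu, hmax⟩ := (Set.toFinite (Desc father r)ᶜ).exists_maximalFor τ _
    (Set.nonempty_compl.2 hne)
  rcases hf : father u with _ | f
  · exact hu (by rw [hr u hf]; exact self_mem_desc r)
  · have hlt := h.lt _ _ hf
    have hfr : f ∈ Desc father r := by
      by_contra hfr
      have := hmax hfr hlt.le
      omega
    exact hu (mem_desc_of_father hf hfr)

lemma length_le (v : V) : (hd v).table.length ≤ Nat.log 2 (Nat.card V) + 2 := by
  obtain ⟨w, _, hw⟩ := (hall v).length.1
  rw [← hw, ← (hall w).pn_eq]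
  exact h.pn_le_log (assoc_subset_desc w)

/-- The output is the length of the table, which is the largest level. One associated-tree has this
process number, which bounds it from below; the whole tree is the restriction to this level, and
`searchable_lower` gives the other inequality. -/
lemma readPN_eq {r : V} (hr : ∀ v, father v = none → v = r) :
    (readPN (hd r)).val = (pn G Set.univ : ℤ) := by
  rw [readPN_val (hall r).cell_le, Nat.cast_inj]
  refine le_antisymm ?_ ?_
  · obtain ⟨w, _, hw⟩ := (hall r).length.1
    rw [← hw, ← (hall w).pn_eq]
    exact pn_mono (Set.subset_univ _)
  · have hle : ∀ w ∈ roots father m unst r, m w ≤ (hd r).table.length := fun w hw =>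
      (hall r).length.2 ⟨w, hw, rfl⟩
    refine pn_le ((h.searchable_lower (c := r) (fun x _ => hall x) _
      fun _ => hle r (mem_roots_self r)).subset ?_)
    intro u _
    obtain ⟨x, hx, hu⟩ := exists_root_of_mem_desc (m := m) (unst := unst)
      (show u ∈ Desc father r by rw [h.desc_eq_univ hr]; trivial)
    exact ⟨x, hx, fun _ => hle x hx, hu⟩

end Rooted

end Description

/-- In a tree, distances from `r` change by exactly one along an edge. A neighbour that is not
farther than `u` is therefore the penultimate node of the unique path from `r` to `u`. -/
lemma eq_of_adj_of_dist_le {V : Type*} {G : SimpleGraph V} (hG : G.IsTree) {r u x y : V}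
    (hx : G.Adj u x) (hy : G.Adj u y) (hdx : G.dist r x ≤ G.dist r u)
    (hdy : G.dist r y ≤ G.dist r u) : x = y := by
  have key : ∀ x, G.Adj u x → G.dist r x ≤ G.dist r u →
      ∃ p : G.Walk r u, p.IsPath ∧ p.penultimate = x := by
    intro x hx hd
    obtain ⟨q, hq⟩ := hG.connected.exists_walk_length_eq_dist r x
    refine ⟨q.concat hx.symm, SimpleGraph.Walk.isPath_of_length_eq_dist _ ?_, by simp⟩
    rw [SimpleGraph.Walk.length_concat, hq]
    rcases hG.dist_eq_dist_add_one_of_adj r hx with h | h <;> omega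
  obtain ⟨p, hp, rfl⟩ := key x hx hdx
  obtain ⟨q, hq, rfl⟩ := key y hy hdy
  rw [(hG.existsUnique_path r u).unique hp hq]

/-! ### Invariants of executions, and absence of blocking. -/

section Runs

variable {V : Type*} {G : SimpleGraph V} {c : Config V} {v w : V}

namespace Config

lemma compute_hd_self : (c.compute G v).hd v = some (mergeMsgs (c.msgs v)).val := by
  simp [compute]

lemma compute_hd_of_ne {u : V} (h : u ≠ v) : (c.compute G v).hd u = c.hd u := by
  simp [compute, h]

lemma compute_mergeOps_self : (c.compute G v).mergeOps v = (mergeMsgs (c.msgs v)).ops := by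
  simp [compute]

lemma compute_mergeOps_of_ne {u : V} (h : u ≠ v) :
    (c.compute G v).mergeOps u = c.mergeOps u := by
  simp [compute, h]

lemma send_father_self : (c.send G v w).father v = some w := by simp [send]

lemma send_father_of_ne {u : V} (h : u ≠ v) : (c.send G v w).father u = c.father u := by
  simp [send, h]

lemma send_inbox_self : (c.send G v w).inbox w =
    c.inbox w ++ [(v, (mergeMsgs (c.msgs v)).val)] := by simp [send]

lemma send_inbox_of_ne {u : V} (h : u ≠ w) : (c.send G v w).inbox u = c.inbox u := by
  simp [send, h]

lemma msgs_congr {c' : Config V} {u : V} (h : c'.inbox u = c.inbox u) : c'.msgs u = c.msgs u := by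
  rw [msgs, msgs, h]

/-- The number of operations spent by `u`, including those of the root. -/
noncomputable def cost (G : SimpleGraph V) (c : Config V) (u : V) : ℕ :=
  (G.neighborSet u).ncard + (prepare (c.msgs u)).ops + (mergeMsgs (c.msgs u)).ops +
    (readPN (mergeMsgs (c.msgs u)).val).ops

end Config

/-- The properties of a configuration reached after `k` steps; `τ` is the order of the visits. -/
structure RunInv [Fintype V] (G : SimpleGraph V) (k : ℕ) (c : Config V) (τ : V → ℕ) : Prop where
  card : {v | c.hd v ≠ none}.ncard = k
  father : ∀ v w, c.father v = some w → c.hd v ≠ none ∧ G.Adj v w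
  inbox : ∀ w u h, (u, h) ∈ c.inbox w ↔ c.father u = some w ∧ c.hd u = some h
  nodup : ∀ w, ((c.inbox w).map Prod.fst).Nodup
  adj : ∀ v u, c.hd v ≠ none → G.Adj v u → c.father v ≠ some u → c.father u = some v
  hd_eq : ∀ v h, c.hd v = some h → h = (mergeMsgs (c.msgs v)).val
  mergeOps : ∀ v, c.hd v ≠ none → c.mergeOps v = (mergeMsgs (c.msgs v)).ops
  result : ∀ v, c.hd v ≠ none → c.father v = none →
    c.result = some (v, (readPN (mergeMsgs (c.msgs v)).val).val)
  lt : ∀ v u, c.hd v ≠ none → c.father u = some v → τ u < τ v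
  lt_card : ∀ v, c.hd v ≠ none → τ v < k
  totalOps : ∀ A : Finset V, (∀ v, v ∈ A ↔ c.hd v ≠ none) → c.totalOps ≤ ∑ v ∈ A, c.cost G v

namespace RunInv

variable [Fintype V] {k : ℕ} {τ : V → ℕ} (I : RunInv G k c τ)
include I

lemma heard_iff {u : V} : c.Heard v u ↔ c.father u = some v := by
  constructor
  · rintro ⟨h, hh⟩
    exact ((I.inbox v u h).1 hh).1
  · intro hf
    obtain ⟨h, hh⟩ := Option.ne_none_iff_exists'.1 (I.father u v hf).1
    exact ⟨h, (I.inbox v u h).2 ⟨hf, hh⟩⟩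

lemma father_none (hv : c.hd v = none) : c.father v = none := by
  rcases hf : c.father v with _ | w
  · rfl
  · exact absurd hv (I.father v w hf).1

lemma card_insert (hv : c.hd v = none) {c' : Config V} (h1 : c'.hd v ≠ none)
    (h2 : ∀ u, u ≠ v → c'.hd u = c.hd u) : {u | c'.hd u ≠ none}.ncard = k + 1 := by
  have : {u | c'.hd u ≠ none} = insert v {u | c.hd u ≠ none} := by
    ext u
    by_cases hu : u = v
    · subst hu; simp [h1]
    · simp [hu, h2 u hu]
  rw [this, Set.ncard_insert_of_notMem (by simp [hv]), I.card]

/-- The neighbours of a visited node are its father and its children. The descendants of `r` are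
thus closed under adjacency, and by connectedness they are all the nodes. In particular, a root can
only appear in the last step. -/
lemma visited_of_root (hG : G.Connected) {r : V} (hr : c.hd r ≠ none) (hf : c.father r = none)
    (u : V) : c.hd u ≠ none := by
  have hvis : ∀ u ∈ Desc c.father r, c.hd u ≠ none := by
    intro u hu
    rcases mem_desc_iff'.1 hu with rfl | ⟨f, hf', _⟩
    · exact hr
    · exact (I.father _ _ hf').1
  obtain ⟨p⟩ := hG r u
  suffices H : ∀ x y : V, G.Walk x y → x ∈ Desc c.father r → y ∈ Desc c.father r from
    hvis u (H r u p (self_mem_desc r))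
  intro x y p
  induction p with
  | nil => exact id
  | cons hadj _ ih =>
    intro hx
    refine ih ?_
    rename_i a b _ _
    by_cases hab : c.father a = some b
    · rcases mem_desc_iff'.1 hx with rfl | ⟨f, hf', hfr⟩
      · rw [hf] at hab; cases hab
      · rw [hab] at hf'
        cases hf'
        exact hfr
    · exact mem_desc_of_father (I.adj a b (hvis a hx) hadj hab) hx

/-- A visited node has sent its message to `v` or has received one from `v`; the latter is
impossible while `v` is unvisited. -/
lemma hd_none_of_not_heard (hv : c.hd v = none) (hw : G.Adj v w) (hn : ¬ c.Heard v w) :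
    c.hd w = none := by
  by_contra hne
  by_cases hf : c.father w = some v
  · exact hn (I.heard_iff.2 hf)
  · have := I.adj w v hne hw.symm hf
    rw [I.father_none hv] at this
    cases this

-- The common part of the two kinds of steps. The visited node gets the step number `k` as its time,
-- which exceeds the times of all nodes visited before, in particular of its children.
open Classical in
lemma visit (hG : G.Connected) (hv : c.hd v = none) {c' : Config V}
    (hself : c'.hd v = some (mergeMsgs (c.msgs v)).val)
    (hhd : ∀ u, u ≠ v → c'.hd u = c.hd u)
    (hops : c'.mergeOps v = (mergeMsgs (c.msgs v)).ops)
    (hmops : ∀ u, u ≠ v → c'.mergeOps u = c.mergeOps u)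
    (htot : c'.totalOps ≤ c.totalOps + c.cost G v)
    (hinv : c'.inbox v = c.inbox v)
    (hin : ∀ u, c.hd u ≠ none → c'.inbox u = c.inbox u)
    (hfa : ∀ u, u ≠ v → c'.father u = c.father u)
    (hbox : ∀ w u h, (u, h) ∈ c'.inbox w ↔ (u, h) ∈ c.inbox w ∨
      (u = v ∧ h = (mergeMsgs (c.msgs v)).val ∧ c'.father v = some w))
    (hnd : ∀ w, ((c'.inbox w).map Prod.fst).Nodup)
    (hfv : ∀ w, c'.father v = some w → G.Adj v w ∧ c.hd w = none)
    (hadj : ∀ u, G.Adj v u → c'.father v ≠ some u → c.father u = some v)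
    (hres : c'.father v = none →
      c'.result = some (v, (readPN (mergeMsgs (c.msgs v)).val).val)) :
    RunInv G (k + 1) c' (Function.update τ v k) := by
  have hvis : ∀ u, u ≠ v → (c'.hd u ≠ none ↔ c.hd u ≠ none) := fun u hu => by rw [hhd u hu]
  have hmv : c'.msgs v = c.msgs v := Config.msgs_congr hinv
  have hm : ∀ u, c.hd u ≠ none → c'.msgs u = c.msgs u := fun u hu => Config.msgs_congr (hin u hu)
  have hfn := I.father_none hv
  constructor
  · exact I.card_insert hv (by simp [hself]) hhd
  · intro x w hx
    by_cases hxv : x = v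
    · subst hxv
      exact ⟨by simp [hself], (hfv w hx).1⟩
    · rw [hfa x hxv] at hx
      rw [hvis x hxv]
      exact I.father x w hx
  · intro w u h
    rw [hbox, I.inbox]
    by_cases hu : u = v
    · subst hu
      rw [hfn, hself, Option.some_inj]
      constructor
      · rintro (⟨h1, _⟩ | ⟨_, rfl, h1⟩)
        · cases h1
        · exact ⟨h1, rfl⟩
      · rintro ⟨h1, rfl⟩
        exact Or.inr ⟨rfl, rfl, h1⟩
    · rw [hfa u hu, hhd u hu]
      simp [hu]
  · exact hnd
  · intro x u hx hxu hne
    by_cases hxv : x = v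
    · subst hxv
      rw [hfa u hxu.ne']
      exact hadj u hxu hne
    · rw [hfa x hxv] at hne
      have := I.adj x u ((hvis x hxv).1 hx) hxu hne
      rw [hfa u (by rintro rfl; rw [hfn] at this; cases this)]
      exact this
  · intro x h hx
    by_cases hxv : x = v
    · subst hxv
      rw [hself, Option.some_inj] at hx
      rw [hmv, hx]
    · rw [hhd x hxv] at hx
      rw [hm x (by simp [hx])]
      exact I.hd_eq x h hx
  · intro x hx
    by_cases hxv : x = v
    · subst hxv
      rw [hops, hmv]
    · rw [hvis x hxv] at hx
      rw [hmops x hxv, hm x hx]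
      exact I.mergeOps x hx
  · intro x hx hf
    by_cases hxv : x = v
    · subst hxv
      rw [hmv]
      exact hres hf
    · rw [hvis x hxv] at hx
      rw [hfa x hxv] at hf
      -- An earlier root would imply that `v` has been visited already, so the result is never
      -- overwritten.
      exact absurd hv (I.visited_of_root hG hx hf v)
  · intro x u hx hu
    by_cases hxv : x = v
    · subst hxv
      have hux : u ≠ x := by
        rintro rfl
        exact (hfv u hu).1.ne rfl
      rw [hfa u hux] at hu
      rw [Function.update_self, Function.update_of_ne hux]
      exact I.lt_card u (I.father u x hu).1
    · rw [hvis x hxv] at hx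
      have huv : u ≠ v := by
        rintro rfl
        exact hx (hfv x hu).2
      rw [hfa u huv] at hu
      rw [Function.update_of_ne hxv, Function.update_of_ne huv]
      exact I.lt x u hx hu
  · intro x hx
    by_cases hxv : x = v
    · subst hxv
      rw [Function.update_self]
      exact Nat.lt_succ_self k
    · rw [hvis x hxv] at hx
      rw [Function.update_of_ne hxv]
      exact (I.lt_card x hx).trans (Nat.lt_succ_self k)
  · intro A hA
    have hvA : v ∈ A := (hA v).2 (by simp [hself])
    rw [← Finset.add_sum_erase A _ hvA]
    have h1 := I.totalOps (A.erase v) fun x => by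
      rw [Finset.mem_erase, hA]
      constructor
      · rintro ⟨h1, h2⟩
        exact (hvis x h1).1 h2
      · intro hx
        have hxv : x ≠ v := by rintro rfl; exact hx hv
        exact ⟨hxv, (hvis x hxv).2 hx⟩
    -- Messages are sent only to unvisited nodes, so the messages of a visited node, and with them
    -- its cost, no longer change.
    have h2 : ∑ x ∈ A.erase v, c'.cost G x = ∑ x ∈ A.erase v, c.cost G x := by
      refine Finset.sum_congr rfl fun x hx => ?_
      rw [Finset.mem_erase, hA] at hx
      rw [Config.cost, Config.cost, hm x ((hvis x hx.1).1 hx.2)]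
    have h3 : c'.cost G v = c.cost G v := by rw [Config.cost, Config.cost, hmv]
    rw [h2, h3]
    omega

lemma send (hG : G.Connected) (hv : c.hd v = none) (hw : G.Adj v w) (hn : ¬ c.Heard v w)
    (hall : ∀ u, G.Adj v u → u ≠ w → c.Heard v u) :
    ∃ τ', RunInv G (k + 1) (c.send G v w) τ' := by
  have hwn := I.hd_none_of_not_heard hv hw hn
  classical
  refine ⟨_, I.visit (c' := c.send G v w) hG hv (Config.compute_hd_self (G := G))
    (fun u hu => Config.compute_hd_of_ne (G := G) hu)
    (Config.compute_mergeOps_self (G := G)) (fun u hu => Config.compute_mergeOps_of_ne (G := G) hu) ?_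
    (Config.send_inbox_of_ne hw.ne) ?_ (fun u hu => Config.send_father_of_ne hu) ?_ ?_ ?_ ?_ ?_⟩
  · simp only [Config.send, Config.compute, Config.cost]
    omega
  · intro u hu
    exact Config.send_inbox_of_ne (by rintro rfl; exact hu hwn)
  · intro x u h
    rw [Config.send_father_self]
    by_cases hx : x = w
    · subst hx
      simp [Config.send_inbox_self]
    · rw [Config.send_inbox_of_ne hx]
      simp [Ne.symm hx]
  · intro x
    by_cases hx : x = w
    · subst hx
      rw [Config.send_inbox_self, List.map_append, List.nodup_append']
      refine ⟨I.nodup x, by simp, ?_⟩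
      simp only [List.map_cons, List.map_nil, List.disjoint_singleton, List.mem_map, not_exists,
        not_and]
      rintro ⟨u, h⟩ hu rfl
      have := (I.inbox x u h).1 hu
      rw [hv] at this
      cases this.2
    · rw [Config.send_inbox_of_ne hx]
      exact I.nodup x
  · intro x hx
    rw [Config.send_father_self, Option.some_inj] at hx
    exact hx ▸ ⟨hw, hwn⟩
  · intro u hu hne
    rw [Config.send_father_self, Ne, Option.some_inj] at hne
    exact I.heard_iff.1 (hall u hu (Ne.symm hne))
  · intro h
    rw [Config.send_father_self] at h
    cases h

lemma finish (hG : G.Connected) (hv : c.hd v = none) (hall : ∀ u, G.Adj v u → c.Heard v u) :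
    ∃ τ', RunInv G (k + 1) (c.finish G v) τ' := by
  have hfn : (c.finish G v).father v = none := I.father_none hv
  classical
  refine ⟨_, I.visit (c' := c.finish G v) hG hv (Config.compute_hd_self (G := G))
    (fun u hu => Config.compute_hd_of_ne (G := G) hu)
    (Config.compute_mergeOps_self (G := G)) (fun u hu => Config.compute_mergeOps_of_ne (G := G) hu) ?_
    rfl (fun _ _ => rfl) (fun _ _ => rfl) ?_ I.nodup ?_ ?_ fun _ => rfl⟩
  · simp only [Config.finish, Config.compute, Config.cost]
    omega
  · intro x u h
    rw [hfn]
    simp [Config.finish, Config.compute]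
  · intro w hw
    rw [hfn] at hw
    cases hw
  · exact fun u hu _ => I.heard_iff.1 (hall u hu)

lemma le_card : k ≤ Fintype.card V := by
  rw [← I.card, ← Nat.card_eq_fintype_card]
  exact Set.ncard_le_card _

lemma lt_card_iff : k < Fintype.card V ↔ ∃ v, c.hd v = none := by
  rw [← I.card, ← Nat.card_eq_fintype_card, ← Set.ncard_univ]
  constructor
  · intro hlt
    by_contra hcon
    push Not at hcon
    rw [show {v | c.hd v ≠ none} = Set.univ from Set.eq_univ_of_forall hcon] at hlt
    exact lt_irrefl _ hlt
  · rintro ⟨v, hv⟩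
    refine Set.ncard_lt_ncard ?_ (Set.toFinite _)
    exact (Set.ssubset_univ_iff).2 fun e => by
      have : v ∈ {v | c.hd v ≠ none} := e ▸ Set.mem_univ v
      exact this hv

/-- An unvisited node `u` at maximal distance from an unvisited node `r` has no unvisited neighbour
farther away, so by `eq_of_adj_of_dist_le` it has at most one unvisited neighbour. It has heard from
all the others and can act. -/
lemma exists_step (hG : G.IsTree) (hex : ∃ v, c.hd v = none) : ∃ c', Step G c c' := by
  obtain ⟨r, hr⟩ := hex
  obtain ⟨u, hu, hmax⟩ := (Set.toFinite {v | c.hd v = none}).exists_maximalFor (G.dist r) _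
    ⟨r, hr⟩
  have hheard : ∀ x, G.Adj u x → c.hd x ≠ none → c.Heard u x := by
    intro x hx hne
    by_contra hn
    exact hne (I.hd_none_of_not_heard hu hx hn)
  have hd : ∀ x, c.hd x = none → G.dist r x ≤ G.dist r u := by
    intro x hx
    by_contra hlt
    exact hlt (hmax hx (not_le.1 hlt).le)
  by_cases hex : ∃ w, G.Adj u w ∧ c.hd w = none
  · obtain ⟨w, hw, hwn⟩ := hex
    refine ⟨_, Step.send c u w hu hw ?_ fun x hx hne => hheard x hx fun hxn => ?_⟩
    · intro hh
      exact (I.father w u (I.heard_iff.1 hh)).1 hwn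
    · exact hne (eq_of_adj_of_dist_le hG hx hw (hd x hxn) (hd w hwn))
  · push Not at hex
    exact ⟨_, Step.finish c u hu fun x hx => hheard x hx (hex x hx)⟩

end RunInv

lemma Run.exists_runInv [Fintype V] (hG : G.Connected) {k : ℕ} (hr : Run G k c) :
    ∃ τ, RunInv G k c τ := by
  induction hr with
  | init =>
    refine ⟨fun _ => 0, ?_⟩
    constructor <;> simp [Config.initial]
  | step k c c' _ hs ih =>
    obtain ⟨τ, I⟩ := ih
    cases hs with
    | send v w hv hw hn hall => exact I.send hG hv hw hn hall
    | finish v hv hall => exact I.finish hG hv hall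

lemma Step.exists_none {c' : Config V} (h : Step G c c') : ∃ v, c.hd v = none := by
  cases h with
  | send v _ hv => exact ⟨v, hv⟩
  | finish v hv => exact ⟨v, hv⟩

end Runs

/-! ### Complete executions: the output and the number of operations. -/

section Final

variable {V : Type*} {G : SimpleGraph V} {c : Config V} {τ : V → ℕ}

/-- The decomposition computed at a visited node. -/
def Config.data (c : Config V) (v : V) : HD := (c.hd v).getD ⟨(0, 0), []⟩

lemma Config.hd_eq_data {v : V} (hv : c.hd v ≠ none) : c.hd v = some (c.data v) := by
  obtain ⟨h, hh⟩ := Option.ne_none_iff_exists'.1 hv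
  simp [Config.data, hh]

namespace RunInv

variable [Fintype V] {k : ℕ} (I : RunInv G k c τ)
include I

lemma msgs_eq (v : V) : c.msgs v = ((c.inbox v).map Prod.fst).map c.data := by
  rw [Config.msgs, List.map_map]
  refine List.map_congr_left fun x hx => ?_
  have := ((I.inbox v x.1 x.2).1 hx).2
  simp [Config.data, this]

lemma mem_inbox_iff (v u : V) : u ∈ (c.inbox v).map Prod.fst ↔ c.father u = some v := by
  rw [← I.heard_iff]
  simp [Config.Heard]

/-- Each node sends at most one message, namely to its father. -/
lemma sum_length_le : ∑ v, (c.inbox v).length ≤ Fintype.card V := by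
  classical
  have h1 : ∀ v, (c.inbox v).length = ∑ u, if c.father u = some v then 1 else 0 := by
    intro v
    rw [← Finset.card_filter, ← List.length_map Prod.fst, ← List.toFinset_card_of_nodup (I.nodup v)]
    congr 1
    ext u
    rw [List.mem_toFinset, I.mem_inbox_iff]
    simp
  simp only [h1]
  rw [Finset.sum_comm, ← Finset.card_univ, Finset.card_eq_sum_ones]
  refine Finset.sum_le_sum fun u _ => ?_
  rw [← Finset.card_filter, Finset.card_le_one]
  intro a ha b hb
  simp only [Finset.mem_filter, Finset.mem_univ, true_and] at ha hb
  rw [ha] at hb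
  exact Option.some_inj.1 hb

variable (hall : ∀ v, c.hd v ≠ none)
include hall

lemma data_eq (v : V) :
    c.data v = (mergeMsgs (((c.inbox v).map Prod.fst).map c.data)).val := by
  rw [← I.msgs_eq]
  exact I.hd_eq v _ (Config.hd_eq_data (hall v))

lemma rooted : Rooted G c.father τ where
  adj_iff := by
    intro u v
    constructor
    · intro h
      by_cases hf : c.father u = some v
      · exact Or.inl hf
      · exact Or.inr (I.adj u v (hall u) h hf)
    · rintro (h | h)
      · exact (I.father u v h).2
      · exact (I.father v u h).2.symm
  lt := fun u v h => I.lt v u (hall v) h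

lemma nodeInv (v : V) : NodeInv G c.father (fun v => level (c.data v))
    (fun v => (c.data v).vect.1 < 0) c.data v :=
  (I.rooted hall).nodeInv_of_merge I.nodup I.mem_inbox_iff (I.data_eq hall) v

/-- The single field `result` would have to name both nodes. -/
lemma root_unique {r r' : V} (hr : c.father r = none) (hr' : c.father r' = none) : r = r' := by
  have h := I.result r (hall r) hr
  rw [I.result r' (hall r') hr', Option.some_inj, Prod.mk.injEq] at h
  exact h.1.symm

lemma exists_root [Nonempty V] : ∃ r, c.father r = none := by
  obtain ⟨r, hr⟩ := Finite.exists_max τ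
  refine ⟨r, ?_⟩
  rcases hf : c.father r with _ | f
  · rfl
  · have := I.lt f r (hall f) hf
    have := hr f
    omega

lemma result_eq {r : V} (hr : c.father r = none) :
    c.result = some (r, (pn G Set.univ : ℤ)) := by
  rw [I.result r (hall r) hr, I.msgs_eq, ← I.data_eq hall,
    (I.rooted hall).readPN_eq (I.nodeInv hall) fun v hv => I.root_unique hall hv hr]

lemma length_le (v : V) : (c.data v).table.length ≤ Nat.log 2 (Fintype.card V) + 2 := by
  rw [← Nat.card_eq_fintype_card]
  exact (I.rooted hall).length_le (I.nodeInv hall) v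

lemma msgs_length_le (v : V) : ∀ g ∈ c.msgs v,
    g.table.length ≤ Nat.log 2 (Fintype.card V) + 2 := by
  intro g hg
  rw [I.msgs_eq] at hg
  obtain ⟨u, _, rfl⟩ := List.mem_map.1 hg
  exact I.length_le hall u

lemma mergeMsgs_ops_le (v : V) :
    (mergeMsgs (c.msgs v)).ops ≤ 8 * Nat.log 2 (Fintype.card V) + 76 := by
  have hg : ∀ g ∈ c.msgs v, GoodMsg g := by
    intro g hg
    rw [I.msgs_eq] at hg
    obtain ⟨u, _, rfl⟩ := List.mem_map.1 hg
    exact (I.nodeInv hall u).good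
  have h1 := (mergeMsgs_spec hg).2
  have h2 := tlen_le (I.msgs_length_le hall v)
  omega

lemma mergeOps_le (v : V) : c.mergeOps v ≤ 8 * Nat.log 2 (Fintype.card V) + 76 := by
  rw [I.mergeOps v (hall v)]
  exact I.mergeMsgs_ops_le hall v

lemma cost_le (v : V) : c.cost G v ≤
    (c.inbox v).length * (5 * Nat.log 2 (Fintype.card V) + 17) +
      (10 * Nat.log 2 (Fintype.card V) + 87) := by
  classical
  -- Every neighbour is either a child, counted by a message, or the father.
  have h1 : (G.neighborSet v).ncard ≤ (c.inbox v).length + 1 := by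
    have hsub : G.neighborSet v ⊆
        ↑(((c.inbox v).map Prod.fst).toFinset ∪ (c.father v).toFinset) := by
      intro u hu
      rw [Finset.coe_union]
      rcases ((I.rooted hall).adj_iff v u).1 hu with h | h
      · exact Or.inr (by simp [h])
      · exact Or.inl (by simpa using (I.mem_inbox_iff v u).2 h)
    refine (Set.ncard_le_ncard hsub (Finset.finite_toSet _)).trans ?_
    rw [Set.ncard_coe_finset]
    refine (Finset.card_union_le _ _).trans (Nat.add_le_add ?_ ?_)
    · exact (List.toFinset_card_le _).trans (by simp)
    · cases c.father v <;> simp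
  have h2 := prepare_ops (I.msgs_length_le hall v)
  have h3 := I.mergeMsgs_ops_le hall v
  have h4 := readPN_ops (mergeMsgs (c.msgs v)).val
  have h5 := I.length_le hall v
  rw [I.data_eq hall v, ← I.msgs_eq] at h5
  have h6 : (c.msgs v).length = (c.inbox v).length := by simp [Config.msgs]
  rw [h6] at h2
  rw [Config.cost]
  -- With tables of length at most `log₂ n + 2`, each message costs `6 + 5 (log₂ n + 2)` for the
  -- preparation plus `1` for the neighbour. The constant part collects the father, the fixed
  -- preparation cost, the merge and the final reading.
  nlinarith

lemma totalOps_le : c.totalOps ≤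
    Fintype.card V * (15 * Nat.log 2 (Fintype.card V) + 104) := by
  refine (I.totalOps Finset.univ (by simpa using hall)).trans ?_
  refine (Finset.sum_le_sum fun v _ => I.cost_le hall v).trans ?_
  rw [Finset.sum_add_distrib, ← Finset.sum_mul, Finset.sum_const, Finset.card_univ, smul_eq_mul]
  have := Nat.mul_le_mul_right (5 * Nat.log 2 (Fintype.card V) + 17) (I.sum_length_le)
  linarith

end RunInv

/-- The factor `2` comes from `log 2 > 1/2`. The lower bound `1` allows additive constants to be
absorbed into the logarithm. -/
lemma natLog_le_two_mul_log {n : ℕ} (hn : 2 ≤ n) :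
    1 ≤ Nat.log 2 n ∧ (Nat.log 2 n : ℝ) ≤ 2 * Real.log n := by
  refine ⟨Nat.le_log_of_pow_le one_lt_two (by simpa using hn), ?_⟩
  have h1 := Real.natLog_le_logb n 2
  have h2 : Real.log 2 > 1 / 2 := by have := Real.log_two_gt_d9; linarith
  have h3 : 0 ≤ Real.log n := Real.log_natCast_nonneg n
  refine h1.trans ?_
  rw [Real.logb, Nat.cast_ofNat, div_le_iff₀ (by linarith)]
  nlinarith

end Final

end ProcNum

theorem mainTheorem3 :
    ∃ C : ℝ, ∀ (V : Type*) [Fintype V] (G : SimpleGraph V), G.IsTree →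
      (∀ (k : ℕ) (c : ProcNum.Config V), ProcNum.Run G k c →
        k ≤ Fintype.card V ∧ ((∃ c', ProcNum.Step G c c') ↔ k < Fintype.card V)) ∧
      (∀ c : ProcNum.Config V, ProcNum.Run G (Fintype.card V) c →
        (∃! r : V, c.father r = none) ∧
        (∃ r : V, c.father r = none ∧ c.result = some (r, (ProcNum.pn G Set.univ : ℤ))) ∧
        (∃ (aT : V → Set V) (R : V → Set V), ∀ v : V, ∃ h : ProcNum.HD,
          c.hd v = some h ∧ ProcNum.IsMinimalHD G c.father aT v (R v) h) ∧
        (2 ≤ Fintype.card V →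
          (∀ v : V, (c.mergeOps v : ℝ) ≤ C * Real.log (Fintype.card V)) ∧
          (c.totalOps : ℝ) ≤ C * (Fintype.card V * Real.log (Fintype.card V)))) := by
  -- Since `log₂ n ≥ 1`, the bound `15 log₂ n + 104` per node is at most `119 log₂ n`, and passing
  -- to the natural logarithm doubles this constant. The bound `8 log₂ n + 76` for a single merge is
  -- smaller.
  refine ⟨238, fun V _ G hG => ⟨fun k c hr => ?_, fun c hr => ?_⟩⟩
  · obtain ⟨τ, I⟩ := hr.exists_runInv hG.connected
    refine ⟨I.le_card, fun ⟨c', hs⟩ => I.lt_card_iff.2 hs.exists_none, fun hk => ?_⟩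
    exact I.exists_step hG (I.lt_card_iff.1 hk)
  · obtain ⟨τ, I⟩ := hr.exists_runInv hG.connected
    have hall : ∀ v, c.hd v ≠ none := fun v hv => lt_irrefl _ (I.lt_card_iff.2 ⟨v, hv⟩)
    have := hG.connected.nonempty
    obtain ⟨r, hr⟩ := I.exists_root hall
    refine ⟨⟨r, hr, fun r' hr' => I.root_unique hall hr' hr⟩, ⟨r, hr, I.result_eq hall hr⟩,
      ⟨_, _, fun v => ⟨_, ProcNum.Config.hd_eq_data (hall v),
        (I.rooted hall).isMinimalHD (I.nodeInv hall) v⟩⟩, fun hn => ?_⟩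
    obtain ⟨h1, h2⟩ := ProcNum.natLog_le_two_mul_log hn
    refine ⟨fun v => ?_, ?_⟩
    · have h3 : c.mergeOps v ≤ 119 * Nat.log 2 (Fintype.card V) :=
        (I.mergeOps_le hall v).trans (by omega)
      have h3 : (c.mergeOps v : ℝ) ≤ 119 * Nat.log 2 (Fintype.card V) := by exact_mod_cast h3
      linarith
    · have h3 : c.totalOps ≤ Fintype.card V * (119 * Nat.log 2 (Fintype.card V)) :=
        (I.totalOps_le hall).trans (Nat.mul_le_mul_left _ (by omega))
      have h3 : (c.totalOps : ℝ) ≤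
          Fintype.card V * (119 * Nat.log 2 (Fintype.card V)) := by exact_mod_cast h3
      have h4 : (Fintype.card V : ℝ) * (119 * Nat.log 2 (Fintype.card V)) ≤
          Fintype.card V * (238 * Real.log (Fintype.card V)) :=
        mul_le_mul_of_nonneg_left (by linarith) (Nat.cast_nonneg _)
      linarith
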